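/- We work over $\mathbb{C}$. \textbf{The curve.} Let $T\subset\mathbb{P}^7$ be the tangent developable of the rational normal curve $[s^7:s^6t:\cdots:t^7]$, i.e. the (reduced) closure of the set of points $[y_0:\cdots:y_7]$ with $y_k=(7-k)s^{6-k}t^{k}u+k\,s^{7-k}t^{k-1}v$, and let $C=C_{\mathrm{cusp}}\subset\mathbb{P}^6$ be its scheme-theoretic section by the hyperplane $y_7=y_0$, with coordinates $y_0,\dots,y_6$ (the 7-cuspidal curve with heptagonal symmetry). Put \[ \begin{array}{ll} f_0=3y_5^2-4y_4y_6+y_3y_0, & f_5=y_3y_4-2y_1y_6+y_0^2,\\ f_1=2y_4y_5-3y_3y_6+y_2y_0, & f_6=5y_2y_4-8y_1y_5+3y_0y_6,\\ f_2=5y_3y_5-8y_2y_6+3y_1y_0, & f_7=5y_3^2-9y_1y_5+4y_0y_6,\\ f_3=3y_2y_5-5y_1y_6+2y_0^2, & f_8=2y_2y_3-3y_1y_4+y_0y_5,\\ f_4=5y_4^2-9y_2y_6+4y_1y_0, & f_9=3y_2^2-4y_1y_3+y_0y_4, \end{array} \] and $(g_0,\dots,g_9)=(-10f_0,\;15f_1,\;3f_2,\;-2f_4,\;-10f_3+25f_5,\;f_9,\;f_8,\;f_6,\;f_7,\;-f_3+2f_5)$.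 \textbf{Mukai's map.} Let $V=\mathbb{C}^{10}$ with basis $e_{-1},\dots,e_{-5},e_1,\dots,e_5$ (corresponding to $g_0,\dots,g_4,g_5,\dots,g_9$) and quadratic form $Q=\sum_{i=1}^5x_{-i}x_i$; a Lagrangian is a 5-dimensional subspace of $V$ on which $Q$ vanishes. Let $U_\infty=\langle e_1,\dots,e_5\rangle$ and $S^+=\Lambda^{\mathrm{even}}U_\infty$, with basis $e_I=e_{i_1}\wedge\cdots\wedge e_{i_k}$ in the order $1,e_{12},e_{13},e_{14},e_{15},e_{23},e_{24},e_{25},e_{34},e_{35},e_{45},e_{1234},e_{1235},e_{1245},e_{1345},e_{2345}$, and $\mathbb{P}^{15}=\mathbb{P}(S^+)$. For $u\in V$ let $\varphi_u$ be the operator on $\Lambda U_\infty$, linear in $u$, for which $e_i$ acts by left wedging with $e_i$ and $e_{-i}$ by contraction with the functional dual to $e_i$. A half spinor in $S^+$ of a Lagrangian $U$ is a nonzero $s\in S^+$ with $\varphi_u(s)=0$ for all $u\in U$. Let $\operatorname{OG}(5,10)\subset\mathbb{P}^{15}$ be the reduced closed subscheme of all points $[s]$ with $s\in S^+$ a half spinor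 of a Lagrangian. For a point $p=[y]\in C$ let $W_p^\perp\subset V$ be the row space of the Jacobian matrix $\left[\partial g_j/\partial y_i(y)\right]$ (rows indexed by $i$, columns by $j$). \textbf{The linear space.} Let $P_{\mathrm{cusp}}=\mathbb{P}(\operatorname{RowSpace}M_{\mathrm{cusp}})\subset\mathbb{P}^{15}$, where \[ M_{\mathrm{cusp}}=\left[\begin{array}{rrrrrrrrrrrrrrrr} 0&0&0&0&-\frac35&1&0&0&0&0&0&0&0&0&0&0\\ 0&0&0&0&0&0&0&\frac15&1&0&0&0&0&0&0&0\\ 0&0&0&0&0&0&0&0&0&\frac34&1&0&0&0&0&0\\ 30&0&0&0&0&0&0&0&0&0&0&1&0&0&0&0\\ 0&0&0&0&0&0&0&0&0&0&0&0&\frac89&1&0&0\\ 0&-2&0&0&0&0&0&0&0&0&0&0&0&0&1&0\\ 0&0&0&-\frac{15}2&0&0&0&0&0&0&0&0&0&0&0&1 \end{array}\right]. \] \textbf{Proposition.} (1) $C$ is reduced, $g_0,\dots,g_9$ is a basis of the space $I_2$ of quadrics containing $C$, and the kernel of the multiplication map $\operatorname{Sym}^2(I_2)\to\mathbb{C}[y_0,\dots,y_6]_4$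 is spanned by $\sum_{i=0}^4g_i\cdot g_{i+5}$, i.e. by $Q$. (2) For every closed point $p$ of the smooth locus $C^{\mathrm{sm}}$, $W_p^\perp$ is a Lagrangian of $(V,Q)$ having a half spinor $s_p$ in $S^+$, unique up to scalars; so $\rho(p)=[s_p]$ defines Mukai's map $\rho:C^{\mathrm{sm}}\to\mathbb{P}^{15}$. This map extends to an embedding, i.e. there is a closed immersion $\rho:C\to\mathbb{P}^{15}$ of schemes over $\mathbb{C}$ with $\rho(p)=[s_p]$ for all closed points $p\in C^{\mathrm{sm}}$. Its image is the scheme-theoretic intersection: $\rho(C)=P_{\mathrm{cusp}}\cap\operatorname{OG}(5,10)$ as closed subschemes of $\mathbb{P}^{15}$. -/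

import Mathlib

open AlgebraicGeometry CategoryTheory TopologicalSpace

namespace MukaiCusp

noncomputable section

attribute [local instance] MvPolynomial.gradedAlgebra

/-! ### Projective space over `ℂ` -/

/-- The grading of the polynomial ring `ℂ[x_i : i ∈ σ]` by degree. -/
abbrev grading (σ : Type) : ℕ → Submodule ℂ (MvPolynomial σ ℂ) :=
  MvPolynomial.homogeneousSubmodule σ ℂ

/-- The projective space `ℙ^{|σ|-1} = Proj ℂ[x_i : i ∈ σ]`. -/
abbrev PSpace (σ : Type) : Scheme := Proj (grading σ)

/-- The structure morphism `Proj ℂ[x_i : i ∈ σ] ⟶ Spec ℂ`. -/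
def PSpace.toSpecC (σ : Type) : PSpace σ ⟶ Spec (CommRingCat.of ℂ) :=
  Proj.toSpecZero (grading σ) ≫ Spec.map (CommRingCat.ofHom (algebraMap ℂ (grading σ 0)))

/-- The graded ring homomorphism `x_i ↦ L_i`, where the `L_i` are linear forms. -/
def linearSubst {σ τ : Type} (L : σ → MvPolynomial τ ℂ) (hL : ∀ i, (L i).IsHomogeneous 1) :
    grading σ →+*ᵍ grading τ where
  toRingHom := (MvPolynomial.aeval L).toRingHom
  map_mem := by
    intro d F hF
    have h := MvPolynomial.IsHomogeneous.aeval (n := 1)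
      ((MvPolynomial.mem_homogeneousSubmodule d F).mp hF) L hL
    rw [one_mul] at h
    exact (MvPolynomial.mem_homogeneousSubmodule d _).mpr h

theorem linearSubst_apply {σ τ : Type} (L : σ → MvPolynomial τ ℂ)
    (hL : ∀ i, (L i).IsHomogeneous 1) (F : MvPolynomial σ ℂ) :
    linearSubst L hL F = MvPolynomial.aeval L F := rfl

/-- If every variable is one of the linear forms `L_i`, the substitution `x_i ↦ L_i` is
defined on all of `Proj`. -/
theorem irrelevant_le_map_linearSubst {σ τ : Type} (L : σ → MvPolynomial τ ℂ)
    (hL : ∀ i, (L i).IsHomogeneous 1) (h : ∀ j, ∃ i, L i = MvPolynomial.X j) :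
    HomogeneousIdeal.irrelevant (grading τ) ≤
      (HomogeneousIdeal.irrelevant (grading σ)).map (linearSubst L hL) := by
  have hX : ∀ j, (MvPolynomial.X j : MvPolynomial τ ℂ) ∈
      ((HomogeneousIdeal.irrelevant (grading σ)).map (linearSubst L hL)).toIdeal := by
    intro j
    obtain ⟨i, hi⟩ := h j
    rw [← hi, ← MvPolynomial.aeval_X (R := ℂ) L i, ← linearSubst_apply L hL]
    exact Ideal.mem_map_of_mem _ (HomogeneousIdeal.mem_irrelevant_of_mem (grading σ) one_pos
      (MvPolynomial.isHomogeneous_X ℂ i))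
  rw [HomogeneousIdeal.irrelevant_le]
  intro d hd F hF
  have hF' : F.IsHomogeneous d := hF
  rw [F.as_sum]
  refine sum_mem fun m hm => ?_
  have hm' : m ≠ 0 := by
    rintro rfl
    have := hF' (MvPolynomial.mem_support_iff.mp hm)
    simp at this
    omega
  obtain ⟨j, hj⟩ := Finsupp.ne_iff.mp hm'
  have : MvPolynomial.X j ∣ MvPolynomial.monomial m (F.coeff m) := by
    rw [MvPolynomial.X_dvd_monomial]
    exact Or.inr hj
  exact Ideal.mem_of_dvd _ this (hX j)

/-- The closed point `[v]` of projective space with homogeneous coordinates `v ≠ 0`: its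
homogeneous prime ideal consists of the polynomials vanishing on the line `ℂ v`, that is, it is
the kernel of `ℂ[x_i] → ℂ[T]`, `x_i ↦ v_i T`. -/
def point {σ : Type} (v : σ → ℂ) (hv : v ≠ 0) : PSpace σ :=
  ({ asHomogeneousIdeal :=
      (⊥ : HomogeneousIdeal (grading Unit)).comap
        (linearSubst (fun i => MvPolynomial.C (v i) * MvPolynomial.X ())
          fun i => MvPolynomial.isHomogeneous_C_mul_X (v i) ())
     isPrime := by
      have : (⊥ : HomogeneousIdeal (grading Unit)).toIdeal.IsPrime := by
        rw [HomogeneousIdeal.toIdeal_bot]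
        exact Ideal.isPrime_bot
      exact this.comap _
     not_irrelevant_le := by
      intro h
      obtain ⟨i, hi⟩ := Function.ne_iff.mp hv
      have hX := h (HomogeneousIdeal.mem_irrelevant_of_mem (grading σ) one_pos
        (MvPolynomial.isHomogeneous_X ℂ i))
      have h0 : MvPolynomial.aeval
          (fun i => MvPolynomial.C (v i) * (MvPolynomial.X () : MvPolynomial Unit ℂ))
          (MvPolynomial.X i : MvPolynomial σ ℂ) = 0 := hX
      rw [MvPolynomial.aeval_X, mul_eq_zero] at h0
      rcases h0 with h0 | h0
      · exact hi (by simpa using h0)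
      · exact MvPolynomial.X_ne_zero _ h0 } : ProjectiveSpectrum (grading σ))

/-- A form `F` lies in the homogeneous prime ideal of the point `[v]` if and only if
`F(v) = 0`. -/
theorem mem_point_iff {σ : Type} (v : σ → ℂ) (hv : v ≠ 0) {d : ℕ} {F : MvPolynomial σ ℂ}
    (hF : F.IsHomogeneous d) :
    F ∈ (point v hv).asHomogeneousIdeal ↔ MvPolynomial.eval v F = 0 := by
  have key : MvPolynomial.aeval
      (fun i => MvPolynomial.C (v i) * (MvPolynomial.X () : MvPolynomial Unit ℂ)) F =
      MvPolynomial.C (MvPolynomial.eval v F) * MvPolynomial.X () ^ d := by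
    rw [MvPolynomial.aeval_def, MvPolynomial.eval₂_eq, MvPolynomial.eval_eq, map_sum,
      Finset.sum_mul]
    refine Finset.sum_congr rfl fun m hm => ?_
    have hd : ∑ i ∈ m.support, m i = d := by
      have h1 := hF (MvPolynomial.mem_support_iff.mp hm)
      have h2 : m.degree = Finsupp.weight 1 m := by
        rw [Finsupp.degree_eq_weight_one]; rfl
      rw [← h1, ← h2]
      rfl
    simp only [mul_pow, Finset.prod_mul_distrib, Finset.prod_pow_eq_pow_sum, hd,
      MvPolynomial.algebraMap_eq, map_mul, map_prod, map_pow]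
    ring
  have : F ∈ (point v hv).asHomogeneousIdeal ↔ MvPolynomial.aeval
      (fun i => MvPolynomial.C (v i) * (MvPolynomial.X () : MvPolynomial Unit ℂ)) F = 0 :=
    Iff.rfl
  rw [this, key, mul_eq_zero]
  simp

/-- The ideal sheaf of the closure, with its reduced scheme structure, of a set
`{[v] : v ∈ A, v ≠ 0}` of closed points of projective space. -/
def reducedIdealSheaf {σ : Type} (A : Set (σ → ℂ)) : (PSpace σ).IdealSheafData :=
  Scheme.IdealSheafData.vanishingIdeal
    (Closeds.closure {x : PSpace σ | ∃ v, ∃ hv : v ≠ 0, v ∈ A ∧ x = point v hv})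

/-! ### The 7-cuspidal curve with heptagonal symmetry -/

/-- The point `u ∂ν/∂s + v ∂ν/∂t` on the tangent line at `[s : t]` to the rational normal curve
`ν(s, t) = (s^(7-k) t^k)_{0 ≤ k ≤ 7}`. -/
def tangentVector (s t u v : ℂ) : Fin 8 → ℂ := fun k =>
  ((7 - (k : ℕ) : ℕ) : ℂ) * s ^ (6 - (k : ℕ)) * t ^ (k : ℕ) * u +
    ((k : ℕ) : ℂ) * s ^ (7 - (k : ℕ)) * t ^ ((k : ℕ) - 1) * v

/-- The ideal sheaf of the tangent developable of the rational normal curve in `ℙ⁷`. -/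
def tangentDevelopable : (PSpace (Fin 8)).IdealSheafData :=
  reducedIdealSheaf {y | ∃ s t u v : ℂ, y = tangentVector s t u v}

/-- The linear forms `y_0, …, y_6, y_0` on `ℙ⁶`. -/
def hyperplaneForms : Fin 8 → MvPolynomial (Fin 7) ℂ :=
  Fin.snoc (α := fun _ => MvPolynomial (Fin 7) ℂ) MvPolynomial.X (MvPolynomial.X 0)

theorem hyperplaneForms_isHomogeneous (k : Fin 8) : (hyperplaneForms k).IsHomogeneous 1 := by
  refine Fin.lastCases ?_ (fun j => ?_) k
  · rw [hyperplaneForms, Fin.snoc_last]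
    exact MvPolynomial.isHomogeneous_X ℂ 0
  · rw [hyperplaneForms, Fin.snoc_castSucc]
    exact MvPolynomial.isHomogeneous_X ℂ j

/-- The embedding `ℙ⁶ ⟶ ℙ⁷`, `[y_0 : ⋯ : y_6] ↦ [y_0 : ⋯ : y_6 : y_0]`, whose image is the
hyperplane `y_7 = y_0`. -/
def hyperplaneInclusion : PSpace (Fin 7) ⟶ PSpace (Fin 8) :=
  Proj.map (linearSubst hyperplaneForms hyperplaneForms_isHomogeneous)
    (irrelevant_le_map_linearSubst _ _ fun j =>
      ⟨j.castSucc, by rw [hyperplaneForms, Fin.snoc_castSucc]⟩)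

/-- The ideal sheaf on `ℙ⁶` of the scheme-theoretic section of the tangent developable by the
hyperplane `y_7 = y_0`. -/
def cuspIdeal : (PSpace (Fin 7)).IdealSheafData :=
  tangentDevelopable.comap hyperplaneInclusion

/-- The 7-cuspidal curve with heptagonal symmetry. -/
def cuspCurve : Scheme := cuspIdeal.subscheme

/-- The inclusion of the curve in `ℙ⁶`. -/
def cuspCurve.incl : cuspCurve ⟶ PSpace (Fin 7) := cuspIdeal.subschemeι

/-- The structure morphism of the curve. -/
def cuspCurve.toSpecC : cuspCurve ⟶ Spec (CommRingCat.of ℂ) :=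
  cuspCurve.incl ≫ PSpace.toSpecC (Fin 7)

/-- `p` belongs to the smooth locus of the curve: some open neighbourhood of `p` is smooth
over `ℂ`. -/
def IsSmoothPoint (p : cuspCurve) : Prop :=
  ∃ U : cuspCurve.Opens, p ∈ U ∧ Smooth (U.ι ≫ cuspCurve.toSpecC)

/-! ### Quadrics and the quadratic form -/

/-- The vector space `I₂` of quadratic forms on `ℙ⁶` vanishing at all points of the curve. -/
def quadricsThroughCurve : Submodule ℂ (MvPolynomial (Fin 7) ℂ) where
  carrier := {F | F.IsHomogeneous 2 ∧
    ∀ p : cuspCurve, F ∈ (cuspCurve.incl p).asHomogeneousIdeal}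
  add_mem' := fun ha hb => ⟨ha.1.add hb.1, fun p =>
    (cuspCurve.incl p).asHomogeneousIdeal.toIdeal.add_mem (ha.2 p) (hb.2 p)⟩
  zero_mem' := ⟨MvPolynomial.isHomogeneous_zero _ _ _, fun p =>
    (cuspCurve.incl p).asHomogeneousIdeal.toIdeal.zero_mem⟩
  smul_mem' := fun c F hF => ⟨(MvPolynomial.homogeneousSubmodule (Fin 7) ℂ 2).smul_mem c hF.1,
    fun p => by
      rw [MvPolynomial.smul_eq_C_mul]
      exact (cuspCurve.incl p).asHomogeneousIdeal.toIdeal.mul_mem_left _ (hF.2 p)⟩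

open MvPolynomial in
/-- The quadrics `f_0, …, f_9`. -/
def f : Fin 10 → MvPolynomial (Fin 7) ℂ :=
  ![3 * X 5 ^ 2 - 4 * X 4 * X 6 + X 3 * X 0,
    2 * X 4 * X 5 - 3 * X 3 * X 6 + X 2 * X 0,
    5 * X 3 * X 5 - 8 * X 2 * X 6 + 3 * X 1 * X 0,
    3 * X 2 * X 5 - 5 * X 1 * X 6 + 2 * X 0 * X 0,
    5 * X 4 ^ 2 - 9 * X 2 * X 6 + 4 * X 1 * X 0,
    X 3 * X 4 - 2 * X 1 * X 6 + X 0 * X 0,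
    5 * X 2 * X 4 - 8 * X 1 * X 5 + 3 * X 0 * X 6,
    5 * X 3 ^ 2 - 9 * X 1 * X 5 + 4 * X 0 * X 6,
    2 * X 2 * X 3 - 3 * X 1 * X 4 + X 0 * X 5,
    3 * X 2 ^ 2 - 4 * X 1 * X 3 + X 0 * X 4]

/-- The quadrics `g_0, …, g_9`; `g_0, …, g_4` are indexed by the left copy of `Fin 5` and
`g_5, …, g_9` by the right copy. -/
def g : Fin 5 ⊕ Fin 5 → MvPolynomial (Fin 7) ℂ :=
  Sum.elim
    ![-10 * f 0, 15 * f 1, 3 * f 2, -2 * f 4, -10 * f 3 + 25 * f 5]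
    ![f 9, f 8, f 6, f 7, -f 3 + 2 * f 5]

/-- The ten-dimensional space `V`, with basis `e_{-1}, …, e_{-5}` (left copy of `Fin 5`) and
`e_1, …, e_5` (right copy of `Fin 5`). -/
abbrev V : Type := Fin 5 ⊕ Fin 5 → ℂ

/-- The quadratic form `Q = ∑ x_{-i} x_i`, as a polynomial in the ten coordinates of `V`. -/
def Q : MvPolynomial (Fin 5 ⊕ Fin 5) ℂ :=
  ∑ i : Fin 5, MvPolynomial.X (Sum.inl i) * MvPolynomial.X (Sum.inr i)

/-- Lagrangians of `(V, Q)`: five-dimensional totally isotropic subspaces. -/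
def IsLagrangian (W : Submodule ℂ V) : Prop :=
  Module.finrank ℂ W = 5 ∧ ∀ w ∈ W, MvPolynomial.eval w Q = 0

/-- Mukai's space `W_p^⊥` at the point `p = [y]`: the row space of the Jacobian matrix
`(∂g_j/∂y_i (y))`, with rows indexed by `i` and columns by `j`. -/
def mukaiSpace (y : Fin 7 → ℂ) : Submodule ℂ V :=
  Submodule.span ℂ (Set.range fun i : Fin 7 => fun j =>
    MvPolynomial.eval y (MvPolynomial.pderiv i (g j)))

/-! ### Half spinors and the orthogonal Grassmannian -/

/-- `U_∞`, with basis `e_1, …, e_5`. -/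
abbrev UInf : Type := Fin 5 → ℂ

/-- The operator `φ_u` on the exterior algebra of `U_∞`: `e_i` acts as left wedging by `e_i` and
`e_{-i}` as contraction by the coordinate functional dual to `e_i`. -/
def cliffordAction (u : V) (x : ExteriorAlgebra ℂ UInf) : ExteriorAlgebra ℂ UInf :=
  CliffordAlgebra.contractLeft (∑ i : Fin 5, u (Sum.inl i) • LinearMap.proj i) x +
    ExteriorAlgebra.ι ℂ (fun i => u (Sum.inr i)) * x

/-- The exterior monomial `e_{i_1} ∧ ⋯ ∧ e_{i_k}`, for a list `[i_1, …, i_k]`; the indices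
`0, …, 4` stand for `1, …, 5`. -/
def wedge (l : List (Fin 5)) : ExteriorAlgebra ℂ UInf :=
  (l.map fun i => ExteriorAlgebra.ι ℂ (Pi.single i 1)).prod

/-- The index sets of the basis `1, e_12, e_13, …, e_45, e_1234, …, e_2345` of `S⁺`. -/
def evenIndex : Fin 16 → List (Fin 5) :=
  ![[], [0, 1], [0, 2], [0, 3], [0, 4], [1, 2], [1, 3], [1, 4], [2, 3], [2, 4], [3, 4],
    [0, 1, 2, 3], [0, 1, 2, 4], [0, 1, 3, 4], [0, 2, 3, 4], [1, 2, 3, 4]]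

/-- The element of `S⁺ = Λ^even U_∞` with coordinates `x_I`. -/
def spinor (x : Fin 16 → ℂ) : ExteriorAlgebra ℂ UInf :=
  ∑ k, x k • wedge (evenIndex k)

/-- The coordinate vectors of the elements of `S⁺` annihilated by `φ_u` for all `u ∈ W`. If `W` is
a Lagrangian whose half spinor lies in `S⁺`, its nonzero elements are the half spinors of `W`. -/
def halfSpinors (W : Submodule ℂ V) : Submodule ℂ (Fin 16 → ℂ) where
  carrier := {x | ∀ u ∈ W, cliffordAction u (spinor x) = 0}
  add_mem' := by
    intro a b ha hb u hu
    have h : spinor (a + b) = spinor a + spinor b := by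
      simp [spinor, add_smul, Finset.sum_add_distrib]
    have h' : cliffordAction u (spinor a + spinor b) =
        cliffordAction u (spinor a) + cliffordAction u (spinor b) := by
      simp only [cliffordAction, map_add, mul_add]
      abel
    rw [h, h', ha u hu, hb u hu, add_zero]
  zero_mem' := by
    intro u _
    simp [spinor, cliffordAction]
  smul_mem' := by
    intro c a ha u hu
    have h : spinor (c • a) = c • spinor a := by
      simp [spinor, mul_smul, Finset.smul_sum]
    have h' : cliffordAction u (c • spinor a) = c • cliffordAction u (spinor a) := by
      simp only [cliffordAction, map_smul, mul_smul_comm, smul_add]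
    rw [h, h', ha u hu, smul_zero]

/-- The ideal sheaf of `OG(5,10) ⊂ ℙ(S⁺) = ℙ¹⁵`, the variety of half spinors of Lagrangians. -/
def orthogonalGrassmannian : (PSpace (Fin 16)).IdealSheafData :=
  reducedIdealSheaf {x | ∃ W : Submodule ℂ V, IsLagrangian W ∧ x ∈ halfSpinors W}

/-! ### The linear space -/

/-- The matrix `M_cusp`. -/
def cuspMatrix : Matrix (Fin 7) (Fin 16) ℂ :=
  !![0, 0, 0, 0, -3/5, 1, 0, 0, 0, 0, 0, 0, 0, 0, 0, 0;
     0, 0, 0, 0, 0, 0, 0, 1/5, 1, 0, 0, 0, 0, 0, 0, 0;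
     0, 0, 0, 0, 0, 0, 0, 0, 0, 3/4, 1, 0, 0, 0, 0, 0;
     30, 0, 0, 0, 0, 0, 0, 0, 0, 0, 0, 1, 0, 0, 0, 0;
     0, 0, 0, 0, 0, 0, 0, 0, 0, 0, 0, 0, 8/9, 1, 0, 0;
     0, -2, 0, 0, 0, 0, 0, 0, 0, 0, 0, 0, 0, 0, 1, 0;
     0, 0, 0, -15/2, 0, 0, 0, 0, 0, 0, 0, 0, 0, 0, 0, 1]

/-- The ideal sheaf of the linear subspace `P_cusp = ℙ(RowSpace M_cusp)` of `ℙ¹⁵`. -/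
def cuspLinearSpace : (PSpace (Fin 16)).IdealSheafData :=
  reducedIdealSheaf (Submodule.span ℂ (Set.range cuspMatrix.row) : Set (Fin 16 → ℂ))

end

end MukaiCusp

namespace MukaiCusp

noncomputable section

attribute [local instance] MvPolynomial.gradedAlgebra

/-! ### Charts of projective space -/

/-! The curve is parametrized by y_k = k t^(k-1) + (7-k) t^(k+6), 0 ≤ k ≤ 6, completed by [e_6] at t
= ∞; its cusps are at t^7 = 1. The foundation is that the forms vanishing along this parametrization
are generated by the ten quadrics f_j (`mem_span_f_of_aeval_eq_zero`). Modulo the f_j and y_6, the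
polynomial ring is spanned over ℂ[y_1] by twelve monomials, of degrees 0, 1 (five), 2 (five), 3: the
h-vector of a canonical curve of genus 7. Along the parametrization these monomials stay independent
modulo y_6. So a form vanishing on the curve is y_6 G modulo the f_j, and G again vanishes on the
curve: induct on the degree.

The f_j are restrictions of quadrics through the tangent developable. Hence the hyperplane section
is squeezed between the scheme cut out by the f_j and the reduced closure of the parametrized
points, and these agree (`cuspIdeal_eq`). This avoids computing the full ideal of the tangent
developable, and yields reducedness and the description of I_2. A quadratic relation among the g_j
has 55 coefficients; evaluation at 54 points leaves only the multiples of Q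
(`coeff_of_quadratic_relation`).

Mukai's map is the restriction of a linear map S (`spinorPoint`). Three polynomial identities carry
the rest: Q(g(y)) = 0, φ_{g(y)}(S(y)) = 0, and q(S(y)) = 150 g(y), where q is the vector of the ten
quadrics through OG(5,10). The row space of the Jacobian consists of the vectors B(y, z), B being
the polarization of g. Polarizing the first two identities at a zero of g shows that this space is
isotropic and annihilates S(y). It has dimension 5, with a half spinor unique up to scalars, because
it projects onto a suitable coordinate Lagrangian; this is checked for t ≠ 0 with t^7 ≠ 1, for t = 0
and for t = ∞.

For the scheme-theoretic intersection, q vanishes on OG(5,10) because a spinor x with q(x) ≠ 0 is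
annihilated by at most a line (`mul_spinorQ_comm`). By the third identity the quadrics q_j restrict
on P_cusp to multiples of the g_j, which generate the ideal of the curve; the opposite inclusion
holds because generic points of the image are half spinors in P_cusp.

Finally, smooth points are not cusps (`not_isSmoothPoint_of_isCusp`): a cusp has a tangent vector
which does not lift to ℂ[ε]/ε³, against infinitesimal lifting. The smoothness of the other points is
not needed. -/

theorem X_mem_grading {σ : Type} (i : σ) :
    (MvPolynomial.X i : MvPolynomial σ ℂ) ∈ grading σ 1 :=
  MvPolynomial.isHomogeneous_X ℂ i

/-- The standard affine chart `x_i ≠ 0` of projective space. -/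
def chart {σ : Type} (i : σ) : (PSpace σ).affineOpens :=
  ⟨Proj.basicOpen (grading σ) (MvPolynomial.X i),
    Proj.isAffineOpen_basicOpen (grading σ) _ (X_mem_grading i) one_pos⟩

theorem irrelevant_le_span_X (σ : Type) :
    (HomogeneousIdeal.irrelevant (grading σ)).toIdeal ≤
      Ideal.span (Set.range (MvPolynomial.X : σ → MvPolynomial σ ℂ)) := by
  rw [HomogeneousIdeal.toIdeal_irrelevant_le]
  intro d hd F hF
  have hF' : F.IsHomogeneous d := hF
  change F ∈ Ideal.span (Set.range MvPolynomial.X)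
  rw [← Set.image_univ, MvPolynomial.mem_ideal_span_X_image]
  intro m hm
  have hm' : m ≠ 0 := by
    rintro rfl
    have := hF' (MvPolynomial.mem_support_iff.mp hm)
    simp at this
    omega
  obtain ⟨j, hj⟩ := Finsupp.ne_iff.mp hm'
  exact ⟨j, trivial, hj⟩

theorem iSup_chart (σ : Type) : ⨆ i : σ, (chart i).1 = ⊤ :=
  Proj.iSup_basicOpen_eq_top (grading σ) _ (irrelevant_le_span_X σ)

/-- The degree zero localization at `x_i` is the ring of functions on the chart `x_i ≠ 0`. -/
def awayToChart {σ : Type} (i : σ) :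
    HomogeneousLocalization.Away (grading σ) (MvPolynomial.X i) →+* Γ(PSpace σ, (chart i).1) :=
  (Proj.awayToSection (grading σ) (MvPolynomial.X i)).hom

theorem awayToChart_bijective {σ : Type} (i : σ) : Function.Bijective (awayToChart i) := by
  have : IsIso (Proj.awayToSection (grading σ) (MvPolynomial.X i)) :=
    (inferInstance : IsIso (Proj.basicOpenIsoAway (grading σ) (MvPolynomial.X i)
      (X_mem_grading i) one_pos).hom)
  exact ConcreteCategory.bijective_of_isIso (Proj.awayToSection (grading σ) (MvPolynomial.X i))

/-- The section `F / x_i ^ n` on the chart `x_i ≠ 0`. -/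
def frac {σ : Type} (i : σ) (n : ℕ) (F : MvPolynomial σ ℂ) (hF : F.IsHomogeneous n) :
    Γ(PSpace σ, (chart i).1) :=
  awayToChart i
    (HomogeneousLocalization.Away.mk (grading σ) (X_mem_grading i) n F
      ((MvPolynomial.mem_homogeneousSubmodule _ F).mpr (by simpa using hF)))

theorem exists_eq_frac {σ : Type} (i : σ) (z : Γ(PSpace σ, (chart i).1)) :
    ∃ n F, ∃ hF : F.IsHomogeneous n, z = frac i n F hF := by
  obtain ⟨a, rfl⟩ := (awayToChart_bijective i).2 z
  obtain ⟨n, F, hF, rfl⟩ := HomogeneousLocalization.Away.mk_surjective _ (X_mem_grading i) a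
  exact ⟨n, F, by simpa using (MvPolynomial.mem_homogeneousSubmodule _ F).mp hF, rfl⟩

/-- The germ at x is the fraction F / x_i ^ n in the homogeneous local ring, a unit exactly when its
numerator avoids the prime. -/
theorem mem_basicOpen_frac {σ : Type} (i : σ) {n : ℕ} {F : MvPolynomial σ ℂ}
    (hF : F.IsHomogeneous n) {x : PSpace σ} (hx : x ∈ (chart i).1) :
    x ∈ (PSpace σ).basicOpen (frac i n F hF) ↔ F ∉ x.asHomogeneousIdeal := by
  rw [Scheme.mem_basicOpen _ _ _ hx]
  have h := ProjectiveSpectrum.Proj.awayToSection_germ (grading σ) (MvPolynomial.X i) x hx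
  have h2 : (PSpace σ).presheaf.germ _ x hx (frac i n F hF) = _ :=
    congr($h (HomogeneousLocalization.Away.mk (grading σ) (X_mem_grading i) n F
      ((MvPolynomial.mem_homogeneousSubmodule _ F).mpr (by simpa using hF))))
  rw [h2, CommRingCat.comp_apply]
  refine (MulEquiv.isUnit_map (Proj.stalkIso' (grading σ) x).symm).trans ?_
  have : x.asHomogeneousIdeal.toIdeal.IsPrime := ProjectiveSpectrum.isPrime x
  rw [← HomogeneousLocalization.isUnit_iff_isUnit_val]
  have h3 : (HomogeneousLocalization.mapId (grading σ) (Submonoid.powers_le.mpr hx)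
      (HomogeneousLocalization.Away.mk (grading σ) (X_mem_grading i) n F
        ((MvPolynomial.mem_homogeneousSubmodule _ F).mpr (by simpa using hF)))).val =
      IsLocalization.mk' (Localization.AtPrime x.asHomogeneousIdeal.toIdeal) F
        ⟨MvPolynomial.X i ^ n, pow_mem (S := x.asHomogeneousIdeal.toIdeal.primeCompl) hx n⟩ := by
    rw [← Localization.mk_eq_mk']
    rfl
  erw [h3]
  rw [IsLocalization.AtPrime.isUnit_mk'_iff _ x.asHomogeneousIdeal.toIdeal]
  rfl

/-- The ideal sheaf of a set of closed points, on a chart. -/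
theorem frac_mem_reducedIdealSheaf {σ : Type} (A : Set (σ → ℂ)) (i : σ) {n : ℕ}
    {F : MvPolynomial σ ℂ} (hF : F.IsHomogeneous n) :
    frac i n F hF ∈ (reducedIdealSheaf A).ideal (chart i) ↔
      ∀ v ∈ A, v i ≠ 0 → MvPolynomial.eval v F = 0 := by
  -- On an affine chart, lying in the vanishing ideal of the closed set means that the basic open
  -- set of the section misses it.
  have h1 : frac i n F hF ∈ (reducedIdealSheaf A).ideal (chart i) ↔
      ∀ x ∈ (chart i).1, x ∈ closure {x : PSpace σ | ∃ v, ∃ hv : v ≠ 0, v ∈ A ∧ x = point v hv} →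
        x ∉ (PSpace σ).basicOpen (frac i n F hF) := by
    rw [reducedIdealSheaf, Scheme.IdealSheafData.vanishingIdeal_ideal,
      PrimeSpectrum.mem_vanishingIdeal]
    have hb (p : PrimeSpectrum Γ(PSpace σ, (chart i).1)) : frac i n F hF ∈ p.asIdeal ↔
        (chart i).2.fromSpec p ∉ (PSpace σ).basicOpen (frac i n F hF) := by
      have h : (chart i).2.fromSpec p ∈ (PSpace σ).basicOpen (frac i n F hF) ↔
          frac i n F hF ∉ p.asIdeal := by
        change p ∈ (chart i).2.fromSpec ⁻¹ᵁ (PSpace σ).basicOpen (frac i n F hF) ↔ _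
        rw [(chart i).2.fromSpec_preimage_basicOpen]
        rfl
      rw [h, not_not]
    constructor
    · intro h x hxi hx
      obtain ⟨p, rfl⟩ : x ∈ Set.range (chart i).2.fromSpec := by
        rw [(chart i).2.range_fromSpec]; exact hxi
      exact (hb p).mp (h p hx)
    · intro h p hp
      refine (hb p).mpr (h _ ?_ hp)
      have : (chart i).2.fromSpec p ∈ Set.range (chart i).2.fromSpec := ⟨p, rfl⟩
      rwa [(chart i).2.range_fromSpec] at this
  rw [h1]
  constructor
  · intro h v hv hvi
    have hv0 : v ≠ 0 := fun h => hvi (by simp [h])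
    have hx : point v hv0 ∈ (chart i).1 := by
      change MvPolynomial.X i ∉ (point v hv0).asHomogeneousIdeal
      rw [mem_point_iff v hv0 (MvPolynomial.isHomogeneous_X ℂ i)]
      simpa using hvi
    have := h _ hx (subset_closure ⟨v, hv0, hv, rfl⟩)
    rw [mem_basicOpen_frac i hF hx, not_not, mem_point_iff v hv0 hF] at this
    exact this
  · intro h x _ hx hx'
    -- An open set which meets the closure already meets the set of closed points.
    obtain ⟨_, hy, v, hv, hvA, rfl⟩ := mem_closure_iff.mp hx _
      ((PSpace σ).basicOpen (frac i n F hF)).isOpen hx'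
    have hc := (PSpace σ).basicOpen_le _ hy
    rw [SetLike.mem_coe, mem_basicOpen_frac i hF hc, mem_point_iff v hv hF] at hy
    refine hy (h v hvA fun h0 => ?_)
    change MvPolynomial.X i ∉ (point v hv).asHomogeneousIdeal at hc
    rw [mem_point_iff v hv (MvPolynomial.isHomogeneous_X ℂ i)] at hc
    exact hc (by simpa using h0)

/-! ### Dehomogenization -/

theorem frac_add {σ : Type} (i : σ) {n : ℕ} {F G : MvPolynomial σ ℂ} (hF : F.IsHomogeneous n)
    (hG : G.IsHomogeneous n) : frac i n (F + G) (hF.add hG) = frac i n F hF + frac i n G hG := by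
  rw [frac, frac, frac, ← map_add]
  congr 1
  apply HomogeneousLocalization.val_injective
  simp only [HomogeneousLocalization.val_add, HomogeneousLocalization.Away.val_mk,
    Localization.add_mk_self]

theorem frac_mul {σ : Type} (i : σ) {m n : ℕ} {F G : MvPolynomial σ ℂ} (hF : F.IsHomogeneous m)
    (hG : G.IsHomogeneous n) :
    frac i (m + n) (F * G) (hF.mul hG) = frac i m F hF * frac i n G hG := by
  rw [frac, frac, frac, ← map_mul]
  congr 1
  apply HomogeneousLocalization.val_injective
  simp only [HomogeneousLocalization.val_mul, HomogeneousLocalization.Away.val_mk,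
    Localization.mk_mul]
  congr 1
  ext
  simp [pow_add]

theorem frac_congr {σ : Type} (i : σ) {m n : ℕ} {F G : MvPolynomial σ ℂ} (hF : F.IsHomogeneous m)
    (hG : G.IsHomogeneous n) (hmn : m = n) (hFG : F = G) : frac i m F hF = frac i n G hG := by
  subst hmn hFG
  rfl

theorem frac_one {σ : Type} (i : σ) :
    frac i 0 1 (MvPolynomial.isHomogeneous_one σ ℂ) = 1 := by
  rw [frac, ← map_one (awayToChart i)]
  congr 1

theorem frac_zero {σ : Type} (i : σ) (n : ℕ) :
    frac i n 0 (MvPolynomial.isHomogeneous_zero σ ℂ n) = 0 := by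
  rw [frac, ← map_zero (awayToChart i)]
  congr 1
  apply HomogeneousLocalization.val_injective
  rw [HomogeneousLocalization.Away.val_mk, Localization.mk_zero, HomogeneousLocalization.val_zero]

theorem frac_X_self {σ : Type} (i : σ) :
    frac i 1 (MvPolynomial.X i) (MvPolynomial.isHomogeneous_X ℂ i) = 1 := by
  rw [frac, ← map_one (awayToChart i)]
  congr 1
  apply HomogeneousLocalization.val_injective
  rw [HomogeneousLocalization.Away.val_mk, HomogeneousLocalization.val_one,
    ← Localization.mk_one, Localization.mk_eq_mk_iff, Localization.r_iff_exists]
  exact ⟨1, by simp⟩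

/-- The constants on a chart. -/
def chartConst {σ : Type} (i : σ) : ℂ →+* Γ(PSpace σ, (chart i).1) where
  toFun c := frac i 0 (MvPolynomial.C c) (MvPolynomial.isHomogeneous_C σ c)
  map_one' := by
    rw [← frac_one]
    exact frac_congr i _ _ rfl (map_one _)
  map_zero' := by
    rw [← frac_zero i 0]
    exact frac_congr i _ _ rfl (map_zero _)
  map_add' a b := by
    rw [← frac_add]
    exact frac_congr i _ _ rfl (map_add _ _ _)
  map_mul' a b := by
    rw [← frac_mul]
    exact frac_congr i _ _ rfl (map_mul _ _ _)

/-- Dehomogenization `F(x) ↦ F(x / x_i)`. -/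
def dehomog {σ : Type} (i : σ) : MvPolynomial σ ℂ →+* Γ(PSpace σ, (chart i).1) :=
  MvPolynomial.eval₂Hom (chartConst i)
    fun j => frac i 1 (MvPolynomial.X j) (MvPolynomial.isHomogeneous_X ℂ j)

theorem dehomog_monomial {σ : Type} (i : σ) (m : σ →₀ ℕ) (c : ℂ) :
    ∀ (n : ℕ) (hF : (MvPolynomial.monomial m c).IsHomogeneous n),
      dehomog i (MvPolynomial.monomial m c) = frac i n (MvPolynomial.monomial m c) hF := by
  -- The zero monomial is homogeneous of every degree, so the comparison of degrees at the end is
  -- valid only for c ≠ 0.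
  by_cases hc : c = 0
  · subst hc
    intro n hF
    rw [frac_congr i hF (MvPolynomial.isHomogeneous_zero σ ℂ n) rfl (map_zero _), map_zero,
      map_zero, frac_zero]
  have key : ∃ n, ∃ hF : (MvPolynomial.monomial m c).IsHomogeneous n,
      dehomog i (MvPolynomial.monomial m c) = frac i n (MvPolynomial.monomial m c) hF := by
    clear hc
    refine MvPolynomial.induction_on_monomial
      (motive := fun F => ∃ n, ∃ hF : F.IsHomogeneous n, dehomog i F = frac i n F hF) ?_ ?_ m c
    · intro c
      exact ⟨0, MvPolynomial.isHomogeneous_C σ c, MvPolynomial.eval₂Hom_C _ _ _⟩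
    · rintro F j ⟨n, hF, h⟩
      refine ⟨n + 1, hF.mul (MvPolynomial.isHomogeneous_X ℂ j), ?_⟩
      rw [map_mul, h, frac_mul i hF]
      congr 1
      exact MvPolynomial.eval₂Hom_X' _ _ _
  intro n hF
  obtain ⟨n', hF', h⟩ := key
  rw [h]
  refine frac_congr i _ _ (hF'.inj_right hF ?_) rfl
  simpa using hc

/-- On forms, the ring homomorphism `dehomog` agrees with division by x_i ^ n. Ideals of a chart can
thus be pulled back to the whole polynomial ring, without tracking degrees. -/
theorem dehomog_eq_frac {σ : Type} (i : σ) {n : ℕ} {F : MvPolynomial σ ℂ}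
    (hF : F.IsHomogeneous n) : dehomog i F = frac i n F hF := by
  have hS : ∀ S : Finset (σ →₀ ℕ), S ⊆ F.support →
      ∃ hG : (∑ m ∈ S, MvPolynomial.monomial m (F.coeff m)).IsHomogeneous n,
        dehomog i (∑ m ∈ S, MvPolynomial.monomial m (F.coeff m)) =
          frac i n (∑ m ∈ S, MvPolynomial.monomial m (F.coeff m)) hG := by
    classical
    intro S
    induction S using Finset.induction_on with
    | empty =>
      intro _
      refine ⟨by simpa using MvPolynomial.isHomogeneous_zero σ ℂ n, ?_⟩
      have e := Finset.sum_empty (f := fun m => MvPolynomial.monomial m (F.coeff m))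
      rw [frac_congr i _ (MvPolynomial.isHomogeneous_zero σ ℂ n) rfl e, e, map_zero, frac_zero]
    | insert m S hm ih =>
      intro hS
      obtain ⟨hG, h⟩ := ih ((Finset.subset_insert _ _).trans hS)
      have hmon : (MvPolynomial.monomial m (F.coeff m)).IsHomogeneous n := by
        refine MvPolynomial.isHomogeneous_monomial _ ?_
        have := hF (MvPolynomial.mem_support_iff.mp (hS (Finset.mem_insert_self _ _)))
        rw [← this, Finsupp.degree_eq_weight_one]
        rfl
      have e := Finset.sum_insert (f := fun m => MvPolynomial.monomial m (F.coeff m)) hm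
      refine ⟨e ▸ hmon.add hG, ?_⟩
      rw [frac_congr i _ (hmon.add hG) rfl e, e, map_add, h, frac_add, dehomog_monomial i m _ _
        hmon]
  obtain ⟨hG, h⟩ := hS F.support subset_rfl
  rw [← frac_congr i hG hF rfl F.as_sum.symm, ← h, ← F.as_sum]

theorem exists_eq_dehomog {σ : Type} (i : σ) (z : Γ(PSpace σ, (chart i).1)) :
    ∃ n F, F.IsHomogeneous n ∧ z = dehomog i F := by
  obtain ⟨n, F, hF, rfl⟩ := exists_eq_frac i z
  exact ⟨n, F, hF, (dehomog_eq_frac i hF).symm⟩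

theorem dehomog_X_self {σ : Type} (i : σ) : dehomog i (MvPolynomial.X i) = 1 := by
  rw [dehomog_eq_frac i (MvPolynomial.isHomogeneous_X ℂ i), frac_X_self]

theorem dehomog_mem_reducedIdealSheaf {σ : Type} (A : Set (σ → ℂ)) (i : σ) {n : ℕ}
    {F : MvPolynomial σ ℂ} (hF : F.IsHomogeneous n) :
    dehomog i F ∈ (reducedIdealSheaf A).ideal (chart i) ↔
      ∀ v ∈ A, v i ≠ 0 → MvPolynomial.eval v F = 0 := by
  rw [dehomog_eq_frac i hF, frac_mem_reducedIdealSheaf]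

theorem reducedIdealSheaf_anti {σ : Type} {A B : Set (σ → ℂ)} (h : A ⊆ B) :
    reducedIdealSheaf B ≤ reducedIdealSheaf A := by
  apply Scheme.IdealSheafData.vanishingIdeal_antimono
  refine Closeds.gc.monotone_l ?_
  rintro _ ⟨v, hv, hvA, rfl⟩
  exact ⟨v, hv, h hvA, rfl⟩

/-! ### Linear maps of projective spaces -/

/-- Linear forms which generate all the variables have no common zero, so the linear map has no base
points. Here no variable needs to be one of the L_i, as is the case for the rescaled variables of
Mukai's map. -/
theorem irrelevant_le_map_linearSubst' {σ τ : Type} (L : σ → MvPolynomial τ ℂ)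
    (hL : ∀ i, (L i).IsHomogeneous 1) (h : ∀ j, MvPolynomial.X j ∈ Ideal.span (Set.range L)) :
    HomogeneousIdeal.irrelevant (grading τ) ≤
      (HomogeneousIdeal.irrelevant (grading σ)).map (linearSubst L hL) := by
  intro F hF
  have hF' := irrelevant_le_span_X τ hF
  have hle : Ideal.span (Set.range (MvPolynomial.X : τ → MvPolynomial τ ℂ)) ≤
      ((HomogeneousIdeal.irrelevant (grading σ)).map (linearSubst L hL)).toIdeal := by
    rw [Ideal.span_le]
    rintro _ ⟨j, rfl⟩
    refine (Ideal.span_le.mpr ?_ : Ideal.span (Set.range L) ≤ _) (h j)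
    rintro _ ⟨i, rfl⟩
    rw [← MvPolynomial.aeval_X (R := ℂ) L i, ← linearSubst_apply L hL]
    exact Ideal.mem_map_of_mem _ (HomogeneousIdeal.mem_irrelevant_of_mem (grading σ) one_pos
      (MvPolynomial.isHomogeneous_X ℂ i))
  exact hle hF'

theorem eval_aeval {σ τ : Type} (L : σ → MvPolynomial τ ℂ) (v : τ → ℂ) (F : MvPolynomial σ ℂ) :
    MvPolynomial.eval v (MvPolynomial.aeval L F) =
      MvPolynomial.eval (fun i => MvPolynomial.eval v (L i)) F := by
  induction F using MvPolynomial.induction_on with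
  | C a => simp
  | add p q hp hq => rw [map_add, map_add, map_add, hp, hq]
  | mul_X p i hp => rw [map_mul, map_mul, map_mul, hp, MvPolynomial.aeval_X, MvPolynomial.eval_X]

section LinearMaps

variable {σ τ : Type} (L : σ → MvPolynomial τ ℂ) (hL : ∀ i, (L i).IsHomogeneous 1)
  (h : HomogeneousIdeal.irrelevant (grading τ) ≤
      (HomogeneousIdeal.irrelevant (grading σ)).map (linearSubst L hL))

/-- A linear substitution fixes constants; this is compared on the affine pieces of the source. -/
theorem map_toSpecC :
    Proj.map (linearSubst L hL) h ≫ PSpace.toSpecC σ = PSpace.toSpecC τ := by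
  refine (Proj.mapAffineOpenCover _ h).openCover.hom_ext _ _ fun s => ?_
  have key (d : ℕ) (hd : 0 < d) (t : MvPolynomial σ ℂ) (ht : t ∈ grading σ d) :
      Proj.awayι (grading τ) (linearSubst L hL t) ((linearSubst L hL).map_mem ht) hd ≫
        Proj.map (linearSubst L hL) h ≫ PSpace.toSpecC σ =
      Proj.awayι (grading τ) (linearSubst L hL t) ((linearSubst L hL).map_mem ht) hd ≫
        PSpace.toSpecC τ := by
    rw [PSpace.toSpecC, PSpace.toSpecC, Proj.awayι_comp_map_assoc _ _ hd _ ht,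
      Proj.awayι_toSpecZero_assoc, Proj.awayι_toSpecZero_assoc, ← Spec.map_comp, ← Spec.map_comp,
      ← Spec.map_comp]
    congr 1
    ext c
    change Localization.mk (linearSubst L hL (algebraMap ℂ _ c)) ⟨linearSubst L hL 1, _⟩ =
      Localization.mk (algebraMap ℂ _ c) ⟨1, _⟩
    congr 1
    · exact AlgHom.commutes (MvPolynomial.aeval L) c
    · exact Subtype.ext (map_one _)
  exact key s.1 s.1.2 s.2 s.2.2

/-- A homogeneous prime is determined by its forms, and F(L(v)) is the value at v of F after
substitution. -/
theorem map_point (v : τ → ℂ) (hv : v ≠ 0) (hv' : (fun i => MvPolynomial.eval v (L i)) ≠ 0) :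
    Proj.map (linearSubst L hL) h (point v hv) = point (fun i => MvPolynomial.eval v (L i)) hv' := by
  refine ProjectiveSpectrum.ext (HomogeneousIdeal.ext' fun n F hF => ?_)
  have hF' : F.IsHomogeneous n := hF
  rw [mem_point_iff _ hv' hF', ← eval_aeval]
  exact mem_point_iff v hv ((linearSubst L hL).map_mem hF)

theorem appLE_awayToSection {i : σ} {t : MvPolynomial τ ℂ} (ht : linearSubst L hL (.X i) = t)
    (ht1 : t.IsHomogeneous 1)
    (e : Proj.basicOpen (grading τ) t ≤ Proj.map (linearSubst L hL) h ⁻¹ᵁ (chart i).1)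
    {n : ℕ} {F : MvPolynomial σ ℂ} (hF : F.IsHomogeneous n) :
    (Proj.map (linearSubst L hL) h).appLE _ _ e (frac i n F hF) =
      Proj.awayToSection (grading τ) t
        (HomogeneousLocalization.Away.mk (grading τ) (f := t) (d := 1) ht1 n
          (MvPolynomial.aeval L F)
          ((linearSubst L hL).map_mem (by simpa using hF))) := by
  subst ht
  have := congr($(Proj.awayToSection_comp_appLE (linearSubst L hL) h (X_mem_grading i))
    (HomogeneousLocalization.Away.mk (grading σ) (X_mem_grading i) n F (by simpa using hF)))
  refine this.trans (congrArg (Proj.awayToSection (grading τ) (linearSubst L hL (.X i)))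
    (HomogeneousLocalization.Away.map_mk (linearSubst L hL) _ (X_mem_grading i) n F _))

theorem appLE_dehomog (i : σ) (j : τ) (hij : L i = MvPolynomial.X j)
    (e : (chart j).1 ≤ Proj.map (linearSubst L hL) h ⁻¹ᵁ (chart i).1) {n : ℕ}
    {F : MvPolynomial σ ℂ} (hF : F.IsHomogeneous n) :
    (Proj.map (linearSubst L hL) h).appLE _ _ e (dehomog i F) =
      dehomog j (MvPolynomial.aeval L F) := by
  have hF' : (MvPolynomial.aeval L F).IsHomogeneous n := (linearSubst L hL).map_mem hF
  rw [dehomog_eq_frac i hF, dehomog_eq_frac j hF']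
  exact appLE_awayToSection L hL h (by rw [linearSubst_apply, MvPolynomial.aeval_X, hij])
    (MvPolynomial.isHomogeneous_X ℂ j) e hF

/-- A linear right inverse P makes the substitution surjective on forms, hence on the degree zero
localizations at x_i; being a closed immersion is local on the target. -/
theorem isClosedImmersion_map
    (hs : ∀ j, ∃ P : MvPolynomial σ ℂ, P.IsHomogeneous 1 ∧ MvPolynomial.aeval L P = .X j) :
    IsClosedImmersion (Proj.map (linearSubst L hL) h) := by
  choose P hP hPL using hs
  have hsec : ∀ G, MvPolynomial.aeval L (MvPolynomial.aeval P G) = G := by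
    intro G
    induction G using MvPolynomial.induction_on with
    | C a => simp
    | add p q hp hq => rw [map_add, map_add, hp, hq]
    | mul_X p i hp => rw [map_mul, map_mul, hp, MvPolynomial.aeval_X, hPL]
  have hsurj : ∀ i : σ, Function.Surjective
      ((Proj.map (linearSubst L hL) h).appLE (chart i).1 _ le_rfl) := by
    intro i z
    have hd := (linearSubst L hL).map_mem (X_mem_grading i)
    have : IsIso (Proj.awayToSection (grading τ) (linearSubst L hL (.X i))) :=
      (inferInstance : IsIso (Proj.basicOpenIsoAway (grading τ) _ hd one_pos).hom)
    obtain ⟨a, rfl⟩ := (ConcreteCategory.bijective_of_isIso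
      (Proj.awayToSection (grading τ) (linearSubst L hL (.X i)))).2 z
    obtain ⟨n, G, hG, rfl⟩ := HomogeneousLocalization.Away.mk_surjective _ hd a
    have hG' : G.IsHomogeneous n := by simpa using (MvPolynomial.mem_homogeneousSubmodule _ G).mp hG
    have hF : (MvPolynomial.aeval P G).IsHomogeneous n := (linearSubst P hP).map_mem hG'
    refine ⟨frac i n _ hF, (appLE_awayToSection L hL h rfl hd le_rfl hF).trans ?_⟩
    congr 2
    exact hsec G
  refine IsZariskiLocalAtTarget.of_iSup_eq_top (fun i => (chart i).1) (iSup_chart σ) fun i => ?_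
  have h1 : IsAffine ((chart i).1.toScheme) := (chart i).2
  have h2 : IsAffine ((Proj.map (linearSubst L hL) h ⁻¹ᵁ (chart i).1).toScheme) :=
    Proj.isAffineOpen_basicOpen (grading τ) _ ((linearSubst L hL).map_mem (X_mem_grading i))
      one_pos
  apply IsClosedImmersion.of_surjective_of_isAffine
  -- The opens are generalized since the image of ⊤ under an open inclusion equals the open only
  -- propositionally.
  have h3 : ∀ U V e, U = (chart i).1 → V = Proj.map (linearSubst L hL) h ⁻¹ᵁ (chart i).1 →
      Function.Surjective ((Proj.map (linearSubst L hL) h).appLE U V e) := by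
    rintro _ _ e rfl rfl
    exact hsurj i
  rw [Scheme.Hom.appTop, morphismRestrict_app']
  exact h3 _ _ _ (Scheme.Opens.ι_image_top _) (Scheme.Opens.ι_image_top _)

end LinearMaps

/-! ### The homogeneous coordinate ring of the curve -/

/-- The monomials that generate the coordinate ring of the hyperplane section `y_6 = 0` of the
curve over `ℂ[y_1]`. -/
def stdMonomial {R : Type*} [CommRing R] (y : Fin 7 → R) : Fin 12 → R :=
  ![1, y 0, y 2, y 3, y 4, y 5, y 0 * y 0, y 0 * y 2, y 0 * y 3, y 0 * y 4, y 0 * y 5,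
    y 0 * y 0 * y 0]

/-- The degrees of the standard monomials. -/
def stdDegree : Fin 12 → ℕ := ![0, 1, 1, 1, 1, 1, 2, 2, 2, 2, 2, 3]

theorem stdMonomial_isHomogeneous (i : Fin 12) :
    (stdMonomial (MvPolynomial.X : Fin 7 → MvPolynomial (Fin 7) ℂ) i).IsHomogeneous
      (stdDegree i) := by
  have h1 := MvPolynomial.isHomogeneous_X (σ := Fin 7) ℂ
  fin_cases i
  exacts [MvPolynomial.isHomogeneous_one _ _, h1 0, h1 2, h1 3, h1 4, h1 5, (h1 0).mul (h1 0),
    (h1 0).mul (h1 2), (h1 0).mul (h1 3), (h1 0).mul (h1 4), (h1 0).mul (h1 5),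
    ((h1 0).mul (h1 0)).mul (h1 0)]

theorem f_isHomogeneous (j : Fin 10) : (f j).IsHomogeneous 2 := by
  have h1 := MvPolynomial.isHomogeneous_X (σ := Fin 7) ℂ
  have hm (n : ℕ) [n.AtLeastTwo] (a b : Fin 7) :
      (OfNat.ofNat n * MvPolynomial.X a * MvPolynomial.X b :
        MvPolynomial (Fin 7) ℂ).IsHomogeneous 2 := by
    rw [mul_assoc, ← map_ofNat (MvPolynomial.C : ℂ →+* MvPolynomial (Fin 7) ℂ) n]
    exact ((h1 a).mul (h1 b)).C_mul _
  have hm' (a b : Fin 7) : (MvPolynomial.X a * MvPolynomial.X b :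
        MvPolynomial (Fin 7) ℂ).IsHomogeneous 2 := (h1 a).mul (h1 b)
  have hs (n : ℕ) [n.AtLeastTwo] (a : Fin 7) :
      (OfNat.ofNat n * MvPolynomial.X a ^ 2 : MvPolynomial (Fin 7) ℂ).IsHomogeneous 2 := by
    rw [← map_ofNat (MvPolynomial.C : ℂ →+* MvPolynomial (Fin 7) ℂ) n]
    exact ((h1 a).pow 2).C_mul _
  fin_cases j
  exacts [((hs 3 5).sub (hm 4 4 6)).add (hm' 3 0), ((hm 2 4 5).sub (hm 3 3 6)).add (hm' 2 0),
    ((hm 5 3 5).sub (hm 8 2 6)).add (hm 3 1 0), ((hm 3 2 5).sub (hm 5 1 6)).add (hm 2 0 0),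
    ((hs 5 4).sub (hm 9 2 6)).add (hm 4 1 0), ((hm' 3 4).sub (hm 2 1 6)).add (hm' 0 0),
    ((hm 5 2 4).sub (hm 8 1 5)).add (hm 3 0 6), ((hs 5 3).sub (hm 9 1 5)).add (hm 4 0 6),
    ((hm 2 2 3).sub (hm 3 1 4)).add (hm' 0 5), ((hs 3 2).sub (hm 4 1 3)).add (hm' 0 4)]

theorem aeval_f {R : Type*} [CommRing R] [Algebra ℂ R] (y : Fin 7 → R) :
    (fun j => MvPolynomial.aeval y (f j)) =
      ![3 * y 5 ^ 2 - 4 * y 4 * y 6 + y 3 * y 0,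
        2 * y 4 * y 5 - 3 * y 3 * y 6 + y 2 * y 0,
        5 * y 3 * y 5 - 8 * y 2 * y 6 + 3 * y 1 * y 0,
        3 * y 2 * y 5 - 5 * y 1 * y 6 + 2 * y 0 * y 0,
        5 * y 4 ^ 2 - 9 * y 2 * y 6 + 4 * y 1 * y 0,
        y 3 * y 4 - 2 * y 1 * y 6 + y 0 * y 0,
        5 * y 2 * y 4 - 8 * y 1 * y 5 + 3 * y 0 * y 6,
        5 * y 3 ^ 2 - 9 * y 1 * y 5 + 4 * y 0 * y 6,
        2 * y 2 * y 3 - 3 * y 1 * y 4 + y 0 * y 5,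
        3 * y 2 ^ 2 - 4 * y 1 * y 3 + y 0 * y 4] := by
  funext j
  fin_cases j <;>
    simp only [f, Fin.zero_eta, Fin.mk_one, Fin.reduceFinMk, Matrix.cons_val, map_add, map_sub,
      map_mul, map_pow, map_ofNat, MvPolynomial.aeval_X]

/-- If the quadrics `f_j` and `y_6` vanish at `y`, then `R` is generated by the standard monomials
over `ℂ[y_1]`. -/
theorem aeval_mem_span_stdMonomial {R : Type*} [CommRing R] [Algebra ℂ R] (y : Fin 7 → R)
    (hf : ∀ j, MvPolynomial.aeval y (f j) = 0) (h6 : y 6 = 0) (F : MvPolynomial (Fin 7) ℂ) :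
    MvPolynomial.aeval y F ∈
      Submodule.span ℂ (Set.range fun p : ℕ × Fin 12 => y 1 ^ p.1 * stdMonomial y p.2) := by
  set S := Submodule.span ℂ (Set.range fun p : ℕ × Fin 12 => y 1 ^ p.1 * stdMonomial y p.2)
  have hrel : ∀ j, _ = (0 : R) := fun j => (congrFun (aeval_f y) j).symm.trans (hf j)
  have r0 := hrel 0
  have r1 := hrel 1
  have r2 := hrel 2
  have r3 := hrel 3
  have r4 := hrel 4
  have r5 := hrel 5
  have r6 := hrel 6
  have r7 := hrel 7
  have r8 := hrel 8
  have r9 := hrel 9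
  simp only [Matrix.cons_val, h6, mul_zero, sub_zero, add_zero] at r0 r1 r2 r3 r4 r5 r6 r7 r8 r9
  have hstd (k : ℕ) (i : Fin 12) : y 1 ^ k * stdMonomial y i ∈ S :=
    Submodule.subset_span ⟨(k, i), rfl⟩
  have hdiv (n : ℕ) [n.AtLeastTwo] {a : R} (h : (OfNat.ofNat n : R) * a ∈ S) : a ∈ S := by
    rw [← map_ofNat (algebraMap ℂ R), ← Algebra.smul_def] at h
    exact (S.smul_mem_iff (NeZero.ne _)).mp h
  have hsm (n : ℕ) [n.AtLeastTwo] {a : R} (h : a ∈ S) : (OfNat.ofNat n : R) * a ∈ S := by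
    rw [← map_ofNat (algebraMap ℂ R), ← Algebra.smul_def]
    exact S.smul_mem _ h
  -- Closure under multiplication by a need only be tested on the twelve monomials, once S is stable
  -- under y_1.
  have mul_mem (a : R) (h : ∀ i, a * stdMonomial y i ∈ S)
      (hk : ∀ b ∈ S, y 1 * b ∈ S) {b : R} (hb : b ∈ S) : a * b ∈ S := by
    induction hb using Submodule.span_induction with
    | mem x hx =>
      obtain ⟨⟨k, i⟩, rfl⟩ := hx
      induction k with
      | zero => simpa using h i
      | succ k ih =>
        have := hk _ ih
        convert this using 1
        ring
    | zero => simp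
    | add x z _ _ hx hz => rw [mul_add]; exact S.add_mem hx hz
    | smul c x _ hx => rw [mul_smul_comm]; exact S.smul_mem c hx
  have m1 : ∀ b ∈ S, y 1 * b ∈ S := by
    intro b hb
    induction hb using Submodule.span_induction with
    | mem x hx =>
      obtain ⟨⟨k, i⟩, rfl⟩ := hx
      have := hstd (k + 1) i
      rwa [pow_succ', mul_assoc] at this
    | zero => simp
    | add x z _ _ hx hz => rw [mul_add]; exact S.add_mem hx hz
    | smul c x _ hx => rw [mul_smul_comm]; exact S.smul_mem c hx
  have s0 : y 0 ∈ S := by simpa [stdMonomial] using hstd 0 1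
  have s2 : y 2 ∈ S := by simpa [stdMonomial] using hstd 0 2
  have s3 : y 3 ∈ S := by simpa [stdMonomial] using hstd 0 3
  have s4 : y 4 ∈ S := by simpa [stdMonomial] using hstd 0 4
  have s5 : y 5 ∈ S := by simpa [stdMonomial] using hstd 0 5
  have s00 : y 0 * y 0 ∈ S := by simpa [stdMonomial] using hstd 0 6
  have s02 : y 0 * y 2 ∈ S := by simpa [stdMonomial] using hstd 0 7
  have s03 : y 0 * y 3 ∈ S := by simpa [stdMonomial] using hstd 0 8
  have s04 : y 0 * y 4 ∈ S := by simpa [stdMonomial] using hstd 0 9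
  have s05 : y 0 * y 5 ∈ S := by simpa [stdMonomial] using hstd 0 10
  have s000 : y 0 * y 0 * y 0 ∈ S := by simpa [stdMonomial] using hstd 0 11
  -- Stability under y_0 is where the list could fail to close up: y_0² y_2, …, y_0² y_5 and y_0⁴
  -- are reduced by consequences of the quadrics in degrees 3 and 4.
  have m0 : ∀ b ∈ S, y 0 * b ∈ S := by
    refine fun b hb => mul_mem _ (fun i => ?_) m1 hb
    have t2 : y 0 * (y 0 * y 2) ∈ S := by
      refine hdiv 25 ?_
      rw [show 25 * (y 0 * (y 0 * y 2)) = 24 * (y 1 * (y 1 * y 0)) by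
        linear_combination -8 * y 1 * r2 + 25 * y 2 * r5 - 5 * y 3 * r6]
      exact hsm 24 (m1 _ (m1 _ s0))
    have t3 : y 0 * (y 0 * y 3) ∈ S := by
      refine hdiv 30 ?_
      rw [show 30 * (y 0 * (y 0 * y 3)) = 27 * (y 1 * (y 0 * y 2)) by
        linear_combination -32 * y 1 * r1 - 9 * y 2 * r2 + 15 * y 3 * r3 + 8 * y 2 * r4
          - 8 * y 4 * r6]
      exact hsm 27 (m1 _ s02)
    have t4 : y 0 * (y 0 * y 4) ∈ S := by
      refine hdiv 10 ?_
      rw [show 10 * (y 0 * (y 0 * y 4)) = 8 * (y 1 * (y 0 * y 3)) by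
        linear_combination -8 * y 1 * r0 + 5 * y 4 * r3 - 3 * y 5 * r6]
      exact hsm 8 (m1 _ s03)
    have t5 : y 0 * (y 0 * y 5) ∈ S := by
      refine hdiv 25 ?_
      rw [show 25 * (y 0 * (y 0 * y 5)) = 15 * (y 1 * (y 0 * y 4)) by
        linear_combination -5 * y 4 * r2 + 25 * y 5 * r5]
      exact hsm 15 (m1 _ s04)
    have t0 : y 0 * (y 0 * y 0 * y 0) ∈ S := by
      refine hdiv 50 ?_
      rw [show 50 * (y 0 * (y 0 * y 0 * y 0)) = -(72 * (y 1 * (y 1 * (y 0 * y 5)))) by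
        linear_combination 50 * y 0 * y 4 * r0 - 75 * y 0 * y 5 * r1 - 45 * y 1 * y 4 * r1
          + 15 * y 2 * y 4 * r2 + 25 * y 0 * y 0 * r3 - 25 * y 3 * y 4 * r3 + 18 * y 1 * y 5 * r4]
      exact S.neg_mem (hsm 72 (m1 _ (m1 _ s05)))
    fin_cases i
    exacts [by simpa [stdMonomial] using s0, s00, s02, s03, s04, s05,
      by simpa [stdMonomial, mul_assoc] using s000, t2, t3, t4, t5, t0]
  -- With y_6 = 0 the ten quadrics can be solved for the ten products y_i y_j, 2 ≤ i ≤ j ≤ 5, in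
  -- terms of multiples of y_0 and y_1.
  have q22 : y 2 * y 2 ∈ S := by
    refine hdiv 3 ?_
    rw [show 3 * (y 2 * y 2) = 4 * (y 1 * y 3) - y 0 * y 4 by linear_combination r9]
    exact S.sub_mem (hsm 4 (m1 _ s3)) s04
  have q23 : y 2 * y 3 ∈ S := by
    refine hdiv 2 ?_
    rw [show 2 * (y 2 * y 3) = 3 * (y 1 * y 4) - y 0 * y 5 by linear_combination r8]
    exact S.sub_mem (hsm 3 (m1 _ s4)) s05
  have q24 : y 2 * y 4 ∈ S := by
    refine hdiv 5 ?_
    rw [show 5 * (y 2 * y 4) = 8 * (y 1 * y 5) by linear_combination r6]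
    exact hsm 8 (m1 _ s5)
  have q25 : y 2 * y 5 ∈ S := by
    refine hdiv 3 ?_
    rw [show 3 * (y 2 * y 5) = -(2 * (y 0 * y 0)) by linear_combination r3]
    exact S.neg_mem (hsm 2 s00)
  have q33 : y 3 * y 3 ∈ S := by
    refine hdiv 5 ?_
    rw [show 5 * (y 3 * y 3) = 9 * (y 1 * y 5) by linear_combination r7]
    exact hsm 9 (m1 _ s5)
  have q34 : y 3 * y 4 ∈ S := by
    rw [show y 3 * y 4 = -(y 0 * y 0) by linear_combination r5]
    exact S.neg_mem s00
  have q35 : y 3 * y 5 ∈ S := by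
    refine hdiv 5 ?_
    rw [show 5 * (y 3 * y 5) = -(3 * (y 1 * y 0)) by linear_combination r2]
    exact S.neg_mem (hsm 3 (m1 _ s0))
  have q44 : y 4 * y 4 ∈ S := by
    refine hdiv 5 ?_
    rw [show 5 * (y 4 * y 4) = -(4 * (y 1 * y 0)) by linear_combination r4]
    exact S.neg_mem (hsm 4 (m1 _ s0))
  have q45 : y 4 * y 5 ∈ S := by
    refine hdiv 2 ?_
    rw [show 2 * (y 4 * y 5) = -(y 0 * y 2) by linear_combination r1]
    exact S.neg_mem s02
  have q55 : y 5 * y 5 ∈ S := by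
    refine hdiv 3 ?_
    rw [show 3 * (y 5 * y 5) = -(y 0 * y 3) by linear_combination r0]
    exact S.neg_mem s03
  -- For the monomials divisible by y_0, pull that factor out and use stability under y_0.
  have mj (a : R) (h : a ∈ S) (h2 : a * y 2 ∈ S) (h3 : a * y 3 ∈ S) (h4 : a * y 4 ∈ S)
      (h5 : a * y 5 ∈ S) : ∀ b ∈ S, a * b ∈ S := by
    refine fun b hb => mul_mem _ (fun i => ?_) m1 hb
    have c (x : R) : a * (y 0 * x) = y 0 * (a * x) := by ring
    fin_cases i
    · simpa [stdMonomial] using h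
    · simpa [stdMonomial, mul_comm a] using m0 _ h
    · exact h2
    · exact h3
    · exact h4
    · exact h5
    · simpa [stdMonomial, mul_comm a, mul_assoc] using m0 _ (m0 _ h)
    · exact (c _).symm ▸ m0 _ h2
    · exact (c _).symm ▸ m0 _ h3
    · exact (c _).symm ▸ m0 _ h4
    · exact (c _).symm ▸ m0 _ h5
    · simpa [stdMonomial, mul_comm a, mul_assoc] using m0 _ (m0 _ (m0 _ h))
  have hm : ∀ j, ∀ b ∈ S, y j * b ∈ S := by
    intro j
    fin_cases j
    exacts [m0, m1, mj _ s2 q22 q23 q24 q25, mj _ s3 (mul_comm (y 2) _ ▸ q23) q33 q34 q35,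
      mj _ s4 (mul_comm (y 2) _ ▸ q24) (mul_comm (y 3) _ ▸ q34) q44 q45,
      mj _ s5 (mul_comm (y 2) _ ▸ q25) (mul_comm (y 3) _ ▸ q35) (mul_comm (y 4) _ ▸ q45) q55,
      fun b _ => by
        change y 6 * b ∈ S
        rw [h6, zero_mul]
        exact S.zero_mem]
  induction F using MvPolynomial.induction_on with
  | C c =>
    rw [MvPolynomial.aeval_C, Algebra.algebraMap_eq_smul_one]
    exact S.smul_mem c (by simpa [stdMonomial] using hstd 0 0)
  | add p q hp hq => rw [map_add]; exact S.add_mem hp hq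
  | mul_X p i hp =>
    rw [map_mul, MvPolynomial.aeval_X, mul_comm]
    exact hm i _ hp

/-! ### The parametrization, and independence of the standard monomials -/

open Polynomial in
/-- The parametrization of the curve. -/
def curvePoly : Fin 7 → ℂ[X] :=
  ![7 * X ^ 6, 1 + 6 * X ^ 7, 2 * X + 5 * X ^ 8, 3 * X ^ 2 + 4 * X ^ 9, 4 * X ^ 3 + 3 * X ^ 10,
    5 * X ^ 4 + 2 * X ^ 11, 6 * X ^ 5 + X ^ 12]

theorem aeval_curvePoly_f (j : Fin 10) : MvPolynomial.aeval curvePoly (f j) = 0 := by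
  rw [show MvPolynomial.aeval curvePoly (f j) = _ from congrFun (aeval_f curvePoly) j]
  fin_cases j <;>
    simp only [curvePoly, Fin.zero_eta, Fin.mk_one, Fin.reduceFinMk, Matrix.cons_val] <;> ring

open Polynomial in
/-- The standard monomials are linearly independent on the hyperplane section `y_6 = 0` of the
curve. -/
theorem eq_zero_of_sum_stdMonomial {c : Fin 12 → ℂ} {d : ℕ} {H : ℂ[X]}
    (h : ∑ i, C (c i) * (curvePoly 1 ^ (d - stdDegree i) * stdMonomial curvePoly i) =
      curvePoly 6 * H) : c = 0 := by
  -- Along the curve y_6 = X^5 (X^7 + 6), with coprime factors. Modulo X^5 one has y_1 = 1 and y_0 =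
  -- 0; modulo X^7 + 6 one has y_1 = 1 - 36 = -35.
  have h1 (n : ℕ) : ∃ A : ℂ[X], curvePoly 1 ^ n = 1 + X ^ 5 * A := by
    obtain ⟨A, hA⟩ := sub_dvd_pow_sub_pow (curvePoly 1) 1 n
    refine ⟨6 * X ^ 2 * A, ?_⟩
    simp only [curvePoly, Matrix.cons_val, one_pow] at hA ⊢
    linear_combination hA
  have h2 (n : ℕ) : ∃ B : ℂ[X], curvePoly 1 ^ n = C ((-35) ^ n) + (X ^ 7 + 6) * B := by
    obtain ⟨B, hB⟩ := sub_dvd_pow_sub_pow (curvePoly 1) (-35) n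
    refine ⟨6 * B, ?_⟩
    simp only [curvePoly, Matrix.cons_val, map_pow, map_neg, map_ofNat] at hB ⊢
    linear_combination hB
  simp only [Fin.sum_univ_succ, Fin.sum_univ_zero, stdDegree, stdMonomial] at h
  simp only [Fin.succ_zero_eq_one, Fin.succ_one_eq_two, Fin.reduceSucc, Matrix.cons_val,
    Nat.sub_zero] at h
  obtain ⟨A0, hA0⟩ := h1 d
  obtain ⟨A1, hA1⟩ := h1 (d - 1)
  obtain ⟨B1, hB1⟩ := h2 (d - 1)
  obtain ⟨B2, hB2⟩ := h2 (d - 2)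
  obtain ⟨B3, hB3⟩ := h2 (d - 3)
  generalize curvePoly 1 ^ d = P0 at *
  generalize curvePoly 1 ^ (d - 1) = P1 at *
  generalize curvePoly 1 ^ (d - 2) = P2 at *
  generalize curvePoly 1 ^ (d - 3) = P3 at *
  have hk1 : (-35 : ℂ) ^ (d - 1) ≠ 0 := pow_ne_zero _ (by norm_num)
  have hk2 : (-35 : ℂ) ^ (d - 2) ≠ 0 := pow_ne_zero _ (by norm_num)
  have hk3 : (-35 : ℂ) ^ (d - 3) ≠ 0 := pow_ne_zero _ (by norm_num)
  generalize (-35 : ℂ) ^ (d - 1) = k1 at *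
  generalize (-35 : ℂ) ^ (d - 2) = k2 at *
  generalize (-35 : ℂ) ^ (d - 3) = k3 at *
  simp only [curvePoly, Matrix.cons_val] at h
  -- Modulo X^5 only 1, y_2, …, y_5 survive, as 1, 2X, 3X², 4X³, 5X⁴.
  have e1 : C (c 0) + C (2 * c 2) * X + C (3 * c 3) * X ^ 2 + C (4 * c 4) * X ^ 3 +
      C (5 * c 5) * X ^ 4 = X ^ 5 * ((6 + X ^ 7) * H - (C (c 0) * A0 + 7 * X * C (c 1) * P1 +
        C (c 2) * (A1 * (2 * X + 5 * X ^ 8) + 5 * X ^ 3) +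
        C (c 3) * (A1 * (3 * X ^ 2 + 4 * X ^ 9) + 4 * X ^ 4) +
        C (c 4) * (A1 * (4 * X ^ 3 + 3 * X ^ 10) + 3 * X ^ 5) +
        C (c 5) * (A1 * (5 * X ^ 4 + 2 * X ^ 11) + 2 * X ^ 6) +
        7 * X * P2 * (C (c 6) * (7 * X ^ 6) + C (c 7) * (2 * X + 5 * X ^ 8) +
          C (c 8) * (3 * X ^ 2 + 4 * X ^ 9) + C (c 9) * (4 * X ^ 3 + 3 * X ^ 10) +
          C (c 10) * (5 * X ^ 4 + 2 * X ^ 11)) + C (c 11) * P3 * (343 * X ^ 13))) := by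
    simp only [map_mul, map_ofNat]
    linear_combination h - C (c 0) * hA0 - (C (c 2) * (2 * X + 5 * X ^ 8) +
      C (c 3) * (3 * X ^ 2 + 4 * X ^ 9) + C (c 4) * (4 * X ^ 3 + 3 * X ^ 10) +
      C (c 5) * (5 * X ^ 4 + 2 * X ^ 11)) * hA1
  have hc (n : ℕ) (hn : n < 5) : (C (c 0) + C (2 * c 2) * X + C (3 * c 3) * X ^ 2 +
      C (4 * c 4) * X ^ 3 + C (5 * c 5) * X ^ 4).coeff n = 0 := by
    rw [e1, coeff_X_pow_mul', if_neg (by omega)]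
  have c0 : c 0 = 0 := by
    simpa [-map_mul, -map_neg, coeff_C, coeff_X, coeff_X_pow] using hc 0 (by norm_num)
  have c2 : c 2 = 0 := by
    simpa [-map_mul, -map_neg, coeff_C, coeff_X, coeff_X_pow] using hc 1 (by norm_num)
  have c3 : c 3 = 0 := by
    simpa [-map_mul, -map_neg, coeff_C, coeff_X, coeff_X_pow] using hc 2 (by norm_num)
  have c4 : c 4 = 0 := by
    simpa [-map_mul, -map_neg, coeff_C, coeff_X, coeff_X_pow] using hc 3 (by norm_num)
  have c5 : c 5 = 0 := by
    simpa [-map_mul, -map_neg, coeff_C, coeff_X, coeff_X_pow] using hc 4 (by norm_num)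
  clear e1 hc hA0 hA1
  simp only [c0, c2, c3, c4, c5, map_zero, zero_mul, zero_add, add_zero] at h
  -- The other seven monomials are divisible by y_0 = 7X^6. Replacing X^7 by -6 in the cofactors
  -- gives a scalar times a different power of X, from 1 to X^6, for each: for instance y_0 y_2
  -- becomes 7X^6 · (2 - 30)X.
  have e2 : (X ^ 7 + 6 : ℂ[X]) ∣ X ^ 6 * (C (7 * k1 * c 1) + C (-196 * k2 * c 7) * X +
      C (-147 * k2 * c 8) * X ^ 2 + C (-98 * k2 * c 9) * X ^ 3 + C (-49 * k2 * c 10) * X ^ 4 +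
      C (-2058 * k3 * c 11) * X ^ 5 + C (49 * k2 * c 6) * X ^ 6) := by
    refine ⟨X ^ 5 * H - X ^ 6 * (7 * C (c 1) * B1 + B2 * (49 * C (c 6) * X ^ 6 +
      7 * C (c 7) * (2 * X + 5 * X ^ 8) + 7 * C (c 8) * (3 * X ^ 2 + 4 * X ^ 9) +
      7 * C (c 9) * (4 * X ^ 3 + 3 * X ^ 10) + 7 * C (c 10) * (5 * X ^ 4 + 2 * X ^ 11)) +
      B3 * (343 * C (c 11) * X ^ 12) + C k2 * (35 * C (c 7) * X + 28 * C (c 8) * X ^ 2 +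
      21 * C (c 9) * X ^ 3 + 14 * C (c 10) * X ^ 4) + 343 * C k3 * C (c 11) * X ^ 5), ?_⟩
    simp only [map_mul, map_ofNat, map_neg]
    linear_combination h - 7 * C (c 1) * X ^ 6 * hB1 - X ^ 6 * (49 * C (c 6) * X ^ 6 +
      7 * C (c 7) * (2 * X + 5 * X ^ 8) + 7 * C (c 8) * (3 * X ^ 2 + 4 * X ^ 9) +
      7 * C (c 9) * (4 * X ^ 3 + 3 * X ^ 10) + 7 * C (c 10) * (5 * X ^ 4 + 2 * X ^ 11)) * hB2 -
      343 * C (c 11) * X ^ 18 * hB3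
  have hcop : IsCoprime (X ^ 7 + 6 : ℂ[X]) (X ^ 6) := by
    refine IsCoprime.pow_right ⟨C (1 / 6), -C (1 / 6) * X ^ 6, ?_⟩
    have : C (1 / 6) * 6 = (1 : ℂ[X]) := by
      rw [← map_ofNat C, ← map_mul]
      norm_num
    linear_combination this
  have hm : (X ^ 7 + 6 : ℂ[X]).Monic := by
    rw [← map_ofNat C]
    exact monic_X_pow_add_C _ (by norm_num)
  -- X^6 is prime to X^7 + 6, and the remaining factor has degree at most 6.
  have e3 := eq_zero_of_dvd_of_degree_lt (hcop.dvd_of_dvd_mul_left e2) (by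
    rw [← map_ofNat C, degree_X_pow_add_C (by norm_num)]
    compute_degree
    norm_num)
  have hc (n : ℕ) := congr(coeff $e3 n)
  have c1 : c 1 = 0 := by simpa [-map_mul, -map_neg, coeff_C, coeff_X, coeff_X_pow, hk1] using hc 0
  have c7 : c 7 = 0 := by simpa [-map_mul, -map_neg, coeff_C, coeff_X, coeff_X_pow, hk2] using hc 1
  have c8 : c 8 = 0 := by simpa [-map_mul, -map_neg, coeff_C, coeff_X, coeff_X_pow, hk2] using hc 2
  have c9 : c 9 = 0 := by simpa [-map_mul, -map_neg, coeff_C, coeff_X, coeff_X_pow, hk2] using hc 3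
  have c10 : c 10 = 0 := by
    simpa [-map_mul, -map_neg, coeff_C, coeff_X, coeff_X_pow, hk2] using hc 4
  have c11 : c 11 = 0 := by
    simpa [-map_mul, -map_neg, coeff_C, coeff_X, coeff_X_pow, hk3] using hc 5
  have c6 : c 6 = 0 := by simpa [-map_mul, -map_neg, coeff_C, coeff_X, coeff_X_pow, hk2] using hc 6
  funext i
  fin_cases i
  exacts [c0, c1, c2, c3, c4, c5, c6, c7, c8, c9, c10, c11]

/-! ### Normal forms and generation of the ideal by quadrics -/

theorem homogeneousComponent_mem_span {σ ι : Type} (q : ι → MvPolynomial σ ℂ)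
    (hq : ∀ j, ∃ n, (q j).IsHomogeneous n) {F : MvPolynomial σ ℂ}
    (hF : F ∈ Ideal.span (Set.range q)) (d : ℕ) :
    MvPolynomial.homogeneousComponent d F ∈ Ideal.span (Set.range q) := by
  have h : (Ideal.span (Set.range q)).IsHomogeneous (grading σ) := by
    refine Ideal.homogeneous_span _ _ ?_
    rintro _ ⟨j, rfl⟩
    exact hq j
  have := h d hF
  rwa [← MvPolynomial.decomposition.decompose'_apply]

theorem homogeneousComponent_X_mul {σ : Type} (i : σ) (G : MvPolynomial σ ℂ) (d : ℕ) :
    MvPolynomial.homogeneousComponent (d + 1) (MvPolynomial.X i * G) =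
      MvPolynomial.X i * MvPolynomial.homogeneousComponent d G := by
  have := DirectSum.coe_decompose_mul_add_of_left_mem (grading σ) (b := G) (j := d)
    (X_mem_grading i)
  rw [add_comm d 1, ← MvPolynomial.decomposition.decompose'_apply,
    ← MvPolynomial.decomposition.decompose'_apply]
  exact this

theorem homogeneousComponent_zero_X_mul {σ : Type} (i : σ) (G : MvPolynomial σ ℂ) :
    MvPolynomial.homogeneousComponent 0 (MvPolynomial.X i * G) = 0 := by
  rw [MvPolynomial.homogeneousComponent_zero]
  rw [← MvPolynomial.constantCoeff_eq, map_mul, MvPolynomial.constantCoeff_X, zero_mul, map_zero]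

/-- Every form is a combination of standard monomials over `ℂ[y_1]`, modulo `y_6` and the quadrics
`f_j`. -/
theorem exists_eq_sum_stdMonomial {d : ℕ} {F : MvPolynomial (Fin 7) ℂ} (hF : F.IsHomogeneous d) :
    ∃ (c : Fin 12 → ℂ) (G φ : MvPolynomial (Fin 7) ℂ), φ ∈ Ideal.span (Set.range f) ∧
      (G = 0 ∧ d = 0 ∨ ∃ e, d = e + 1 ∧ G.IsHomogeneous e) ∧
      F = ∑ i, MvPolynomial.C (c i) * (MvPolynomial.X 1 ^ (d - stdDegree i) *
        stdMonomial MvPolynomial.X i) + MvPolynomial.X 6 * G + φ := by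
  let J : Ideal (MvPolynomial (Fin 7) ℂ) :=
    Ideal.span (Set.range f) ⊔ Ideal.span {MvPolynomial.X 6}
  have hcomp : ∀ G : MvPolynomial (Fin 7) ℂ,
      MvPolynomial.aeval (fun i => Ideal.Quotient.mk J (MvPolynomial.X i)) G =
        Ideal.Quotient.mkₐ ℂ J G := by
    intro G
    have : MvPolynomial.aeval (fun i => Ideal.Quotient.mk J (MvPolynomial.X i)) =
        Ideal.Quotient.mkₐ ℂ J := by
      ext i
      simp
    rw [this]
  have h1 := aeval_mem_span_stdMonomial (fun i => Ideal.Quotient.mk J (MvPolynomial.X i))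
    (fun j => by
      rw [hcomp]
      exact Ideal.Quotient.eq_zero_iff_mem.mpr
        (Ideal.mem_sup_left (Ideal.subset_span (Set.mem_range_self j))))
    (Ideal.Quotient.eq_zero_iff_mem.mpr (Ideal.mem_sup_right (Ideal.mem_span_singleton_self _))) F
  have hmap : Submodule.span ℂ (Set.range fun p : ℕ × Fin 12 =>
      Ideal.Quotient.mk J (MvPolynomial.X 1) ^ p.1 *
        stdMonomial (fun i => Ideal.Quotient.mk J (MvPolynomial.X i)) p.2) =
      (Submodule.span ℂ (Set.range fun p : ℕ × Fin 12 =>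
        (MvPolynomial.X 1 ^ p.1 * stdMonomial MvPolynomial.X p.2 : MvPolynomial (Fin 7) ℂ))).map
          (Ideal.Quotient.mkₐ ℂ J).toLinearMap := by
    rw [Submodule.map_span, ← Set.range_comp]
    congr 2
    funext ⟨k, i⟩
    simp only [Function.comp, AlgHom.toLinearMap_apply, map_mul, map_pow]
    congr 1
    fin_cases i <;> simp [stdMonomial]
  rw [hcomp, hmap] at h1
  obtain ⟨s, hs, hsF⟩ := h1
  have h2 : F - s ∈ J := by
    rw [← Ideal.Quotient.eq_zero_iff_mem, map_sub, sub_eq_zero]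
    exact hsF.symm
  obtain ⟨φ, hφ, _, hG, hsum⟩ := Submodule.mem_sup.mp h2
  obtain ⟨G, rfl⟩ := Ideal.mem_span_singleton.mp hG
  -- Only the terms y_1^k m with k + deg m = d contribute. A standard monomial of degree above d can
  -- take coefficient 0, so the truncated subtraction in the exponent is harmless.
  have h3 : ∃ c : Fin 12 → ℂ, MvPolynomial.homogeneousComponent d s =
      ∑ i, MvPolynomial.C (c i) * (MvPolynomial.X 1 ^ (d - stdDegree i) *
        stdMonomial MvPolynomial.X i) := by
    clear hsF h2 hsum
    induction hs using Submodule.span_induction with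
    | mem x hx =>
      obtain ⟨⟨k, i⟩, rfl⟩ := hx
      have hh : (MvPolynomial.X 1 ^ k * stdMonomial MvPolynomial.X i :
          MvPolynomial (Fin 7) ℂ).IsHomogeneous (k + stdDegree i) := by
        have := ((MvPolynomial.isHomogeneous_X (σ := Fin 7) ℂ 1).pow k).mul
          (stdMonomial_isHomogeneous i)
        rwa [one_mul] at this
      by_cases hd : k + stdDegree i = d
      · refine ⟨Pi.single i 1, ?_⟩
        rw [Finset.sum_eq_single i (fun l _ hl => by simp [hl]) (by simp), ← hd,
          MvPolynomial.homogeneousComponent_eq_self hh]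
        simp
      · refine ⟨0, ?_⟩
        rw [MvPolynomial.homogeneousComponent_of_mem hh, if_neg (Ne.symm hd)]
        simp
    | zero => exact ⟨0, by simp⟩
    | add x z _ _ hx hz =>
      obtain ⟨a, ha⟩ := hx
      obtain ⟨b, hb⟩ := hz
      exact ⟨a + b, by simp [ha, hb, add_mul, Finset.sum_add_distrib]⟩
    | smul r x _ hx =>
      obtain ⟨a, ha⟩ := hx
      refine ⟨r • a, ?_⟩
      rw [map_smul, ha, Finset.smul_sum]
      refine Finset.sum_congr rfl fun i _ => ?_
      rw [Pi.smul_apply, smul_eq_mul, map_mul, MvPolynomial.smul_eq_C_mul, mul_assoc]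
  obtain ⟨c, hc⟩ := h3
  have hFd : F = MvPolynomial.homogeneousComponent d s +
      MvPolynomial.homogeneousComponent d (MvPolynomial.X 6 * G) +
      MvPolynomial.homogeneousComponent d φ := by
    rw [← MvPolynomial.homogeneousComponent_eq_self hF, ← map_add, ← map_add]
    congr 1
    linear_combination -hsum
  have hφd := homogeneousComponent_mem_span f (fun j => ⟨2, f_isHomogeneous j⟩) hφ d
  cases d with
  | zero =>
    rw [homogeneousComponent_zero_X_mul] at hFd
    exact ⟨c, 0, _, hφd, Or.inl ⟨rfl, rfl⟩, by rw [hFd, hc, mul_zero]⟩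
  | succ e =>
    rw [homogeneousComponent_X_mul] at hFd
    exact ⟨c, _, _, hφd, Or.inr ⟨e, rfl, MvPolynomial.homogeneousComponent_isHomogeneous e G⟩,
      by rw [← hc]; exact hFd⟩

theorem aeval_curvePoly_eq_zero_of_mem {F : MvPolynomial (Fin 7) ℂ}
    (hF : F ∈ Ideal.span (Set.range f)) : MvPolynomial.aeval curvePoly F = 0 := by
  have : Ideal.span (Set.range f) ≤ RingHom.ker (MvPolynomial.aeval (R := ℂ) curvePoly) := by
    rw [Ideal.span_le]
    rintro _ ⟨j, rfl⟩
    exact aeval_curvePoly_f j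
  exact this hF

theorem aeval_stdMonomial {R : Type} [CommRing R] [Algebra ℂ R] (y : Fin 7 → R) (i : Fin 12) :
    MvPolynomial.aeval y (stdMonomial MvPolynomial.X i : MvPolynomial (Fin 7) ℂ) =
      stdMonomial y i := by
  fin_cases i <;> simp [stdMonomial]

theorem curvePoly_ne_zero (i : Fin 7) : curvePoly i ≠ 0 := by
  intro h
  have := congr(Polynomial.eval 1 $h)
  fin_cases i <;> norm_num [curvePoly] at this

/-- The forms vanishing on the curve are generated by the quadrics `f_j`. -/
theorem mem_span_f_of_aeval_eq_zero {d : ℕ} {F : MvPolynomial (Fin 7) ℂ} (hF : F.IsHomogeneous d)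
    (h : MvPolynomial.aeval curvePoly F = 0) : F ∈ Ideal.span (Set.range f) := by
  induction d using Nat.strong_induction_on generalizing F with
  | _ d ih =>
    obtain ⟨c, G, φ, hφ, hG, rfl⟩ := exists_eq_sum_stdMonomial hF
    simp only [map_add, map_sum, map_mul, map_pow, aeval_stdMonomial, MvPolynomial.aeval_X,
      MvPolynomial.aeval_C, aeval_curvePoly_eq_zero_of_mem hφ, add_zero] at h
    -- The form vanishes on the curve, so the standard part equals -y_6 G there, and independence
    -- modulo y_6 kills it.
    have hc : c = 0 := eq_zero_of_sum_stdMonomial (d := d)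
      (H := -MvPolynomial.aeval curvePoly G) (by
        rw [mul_neg]
        exact eq_neg_of_add_eq_zero_left h)
    subst hc
    simp only [Pi.zero_apply, map_zero, zero_mul, Finset.sum_const_zero, zero_add] at h ⊢
    refine add_mem ?_ hφ
    obtain ⟨rfl, -⟩ | ⟨e, rfl, he⟩ := hG
    · simp
    · exact Ideal.mul_mem_left _ _
        (ih e e.lt_succ_self he ((mul_eq_zero.mp h).resolve_left (curvePoly_ne_zero 6)))

/-! ### The ideal of the curve -/

/-- Pushing forward the ideal of a closed set gives the ideal of the closure of its image, and a
continuous map may be applied before taking the closure. -/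
theorem map_reducedIdealSheaf {σ τ : Type} (A : Set (τ → ℂ)) (L : σ → MvPolynomial τ ℂ)
    (hL : ∀ i, (L i).IsHomogeneous 1)
    (h : HomogeneousIdeal.irrelevant (grading τ) ≤
      (HomogeneousIdeal.irrelevant (grading σ)).map (linearSubst L hL))
    (h0 : ∀ v : τ → ℂ, v ≠ 0 → (fun i => MvPolynomial.eval v (L i)) ≠ 0) :
    (reducedIdealSheaf A).map (Proj.map (linearSubst L hL) h) =
      reducedIdealSheaf ((fun v i => MvPolynomial.eval v (L i)) '' A) := by
  rw [reducedIdealSheaf, Scheme.IdealSheafData.map_vanishingIdeal, reducedIdealSheaf]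
  congr 1
  ext1
  simp only [Closeds.coe_closure]
  rw [closure_image_closure (Proj.map (linearSubst L hL) h).continuous]
  congr 1
  ext x
  constructor
  · rintro ⟨_, ⟨v, hv, hvA, rfl⟩, rfl⟩
    exact ⟨_, h0 v hv, ⟨v, hvA, rfl⟩, map_point L hL h v hv (h0 v hv)⟩
  · rintro ⟨_, hv', ⟨v, hvA, rfl⟩, rfl⟩
    have hv : v ≠ 0 := by
      rintro rfl
      refine hv' (funext fun i => ?_)
      have h1 := (hL i).coeff_eq_zero (d := 0) (by simp)
      rw [← MvPolynomial.constantCoeff_eq, ← MvPolynomial.eval_zero] at h1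
      exact h1
    exact ⟨_, ⟨v, hv, hvA, rfl⟩, map_point L hL h v hv hv'⟩

/-- Affine representatives of the points of the curve with parameter `t ≠ 0`, other than the
cusps. -/
def curvePoints : Set (Fin 7 → ℂ) :=
  {y | ∃ t : ℂ, t ≠ 0 ∧ t ^ 7 ≠ 1 ∧ y = fun i => (curvePoly i).eval t}

theorem eval_aeval_curvePoly (F : MvPolynomial (Fin 7) ℂ) (t : ℂ) :
    (MvPolynomial.aeval curvePoly F).eval t =
      MvPolynomial.eval (fun i => (curvePoly i).eval t) F := by
  rw [← Polynomial.coe_evalRingHom, MvPolynomial.map_aeval, MvPolynomial.eval_eq]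
  simp [MvPolynomial.eval₂_eq, MvPolynomial.coe_eval₂Hom]

theorem aeval_curvePoly_eq_zero_iff (F : MvPolynomial (Fin 7) ℂ) :
    MvPolynomial.aeval curvePoly F = 0 ↔ ∀ v ∈ curvePoints, MvPolynomial.eval v F = 0 := by
  constructor
  · rintro h _ ⟨t, -, -, rfl⟩
    rw [← eval_aeval_curvePoly, h, Polynomial.eval_zero]
  · intro h
    -- The omitted parameters are the roots of X (X^7 - 1); multiplying by it gives a polynomial
    -- that vanishes everywhere.
    have h1 : Polynomial.X * (Polynomial.X ^ 7 - Polynomial.C 1) *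
        MvPolynomial.aeval curvePoly F = 0 := by
      refine Polynomial.funext fun t => ?_
      by_cases ht : t ≠ 0 ∧ t ^ 7 ≠ 1
      · rw [Polynomial.eval_mul, eval_aeval_curvePoly, h _ ⟨t, ht.1, ht.2, rfl⟩, mul_zero,
          Polynomial.eval_zero]
      · have : t * (t ^ 7 - 1) = 0 := by
          rw [mul_eq_zero, sub_eq_zero]
          tauto
        simp [this]
    exact (mul_eq_zero.mp h1).resolve_left
      (mul_ne_zero Polynomial.X_ne_zero (Polynomial.X_pow_sub_C_ne_zero (by norm_num) 1))

/-- Passes between reduced ideal sheaves on the locus G ≠ 0 and the ideal (f): multiplication by G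
removes the condition G(v) ≠ 0. -/
theorem forall_curvePoints_iff {d : ℕ} {F G : MvPolynomial (Fin 7) ℂ} (hF : F.IsHomogeneous d)
    (hG : G.IsHomogeneous 1) :
    (∀ v ∈ curvePoints, MvPolynomial.eval v G ≠ 0 → MvPolynomial.eval v F = 0) ↔
      G * F ∈ Ideal.span (Set.range f) := by
  have h : G * F ∈ Ideal.span (Set.range f) ↔
      ∀ v ∈ curvePoints, MvPolynomial.eval v (G * F) = 0 := by
    rw [← aeval_curvePoly_eq_zero_iff]
    exact ⟨aeval_curvePoly_eq_zero_of_mem, mem_span_f_of_aeval_eq_zero (hG.mul hF)⟩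
  rw [h]
  refine forall₂_congr fun v _ => ?_
  rw [map_mul, mul_eq_zero, or_iff_not_imp_left]

theorem curvePoint_ne_zero (t : ℂ) : (fun i => (curvePoly i).eval t) ≠ 0 := by
  intro h
  have h0 := congrFun h 0
  have h1 := congrFun h 1
  simp only [curvePoly, Matrix.cons_val_zero, Matrix.cons_val_one, Pi.zero_apply] at h0 h1
  simp at h0
  simp [h0] at h1

theorem eval_hyperplaneForms (y : Fin 7 → ℂ) :
    (fun i => MvPolynomial.eval y (hyperplaneForms i)) =
      ![y 0, y 1, y 2, y 3, y 4, y 5, y 6, y 0] := by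
  funext i
  fin_cases i <;> simp [hyperplaneForms, Fin.snoc] <;> rfl

theorem eval_hyperplaneForms_ne_zero (y : Fin 7 → ℂ) (hy : y ≠ 0) :
    (fun i => MvPolynomial.eval y (hyperplaneForms i)) ≠ 0 := by
  intro h
  refine hy (funext fun i => ?_)
  have := congrFun h i.castSucc
  simpa [hyperplaneForms, Fin.snoc_castSucc] using this

theorem curvePoint_eq_tangentVector (t : ℂ) :
    (fun i => MvPolynomial.eval (fun i => (curvePoly i).eval t) (hyperplaneForms i)) =
      tangentVector 1 t (t ^ 6) 1 := by
  rw [eval_hyperplaneForms]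
  funext i
  fin_cases i <;> simp [tangentVector, curvePoly] <;> ring

theorem cuspIdeal_le : cuspIdeal ≤ reducedIdealSheaf curvePoints := by
  rw [cuspIdeal, ← Scheme.IdealSheafData.le_map_iff_comap_le, hyperplaneInclusion,
    map_reducedIdealSheaf _ _ _ _ eval_hyperplaneForms_ne_zero]
  apply reducedIdealSheaf_anti
  rintro _ ⟨_, ⟨t, -, -, rfl⟩, rfl⟩
  exact ⟨_, _, _, _, curvePoint_eq_tangentVector t⟩

/-! ### Comparison of the hyperplane section with the reduced curve -/

open MvPolynomial in
/-- Quadrics through the tangent developable which restrict to the `f_j`. -/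
def tangentQuadric : Fin 10 → MvPolynomial (Fin 8) ℂ :=
  ![3 * X 5 ^ 2 - 4 * X 4 * X 6 + X 3 * X 7,
    2 * X 4 * X 5 - 3 * X 3 * X 6 + X 2 * X 7,
    5 * X 3 * X 5 - 8 * X 2 * X 6 + 3 * X 1 * X 7,
    3 * X 2 * X 5 - 5 * X 1 * X 6 + 2 * X 0 * X 7,
    5 * X 4 ^ 2 - 9 * X 2 * X 6 + 4 * X 1 * X 7,
    X 3 * X 4 - 2 * X 1 * X 6 + X 0 * X 7,
    5 * X 2 * X 4 - 8 * X 1 * X 5 + 3 * X 0 * X 6,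
    5 * X 3 ^ 2 - 9 * X 1 * X 5 + 4 * X 0 * X 6,
    2 * X 2 * X 3 - 3 * X 1 * X 4 + X 0 * X 5,
    3 * X 2 ^ 2 - 4 * X 1 * X 3 + X 0 * X 4]

theorem aeval_tangentQuadric (j : Fin 10) :
    MvPolynomial.aeval hyperplaneForms (tangentQuadric j) = f j := by
  have h (i : Fin 8) : hyperplaneForms i = (![.X 0, .X 1, .X 2, .X 3, .X 4, .X 5, .X 6, .X 0] :
      Fin 8 → MvPolynomial (Fin 7) ℂ) i := by
    fin_cases i <;> rfl
  fin_cases j <;>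
    simp [tangentQuadric, f, h, map_ofNat, -MvPolynomial.aeval_eq_bind₁]

theorem tangentQuadric_isHomogeneous (j : Fin 10) : (tangentQuadric j).IsHomogeneous 2 := by
  have h1 := MvPolynomial.isHomogeneous_X (σ := Fin 8) ℂ
  have hm (n : ℕ) [n.AtLeastTwo] (a b : Fin 8) :
      (OfNat.ofNat n * MvPolynomial.X a * MvPolynomial.X b :
        MvPolynomial (Fin 8) ℂ).IsHomogeneous 2 := by
    rw [mul_assoc, ← map_ofNat (MvPolynomial.C : ℂ →+* MvPolynomial (Fin 8) ℂ) n]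
    exact ((h1 a).mul (h1 b)).C_mul _
  have hm' (a b : Fin 8) : (MvPolynomial.X a * MvPolynomial.X b :
        MvPolynomial (Fin 8) ℂ).IsHomogeneous 2 := (h1 a).mul (h1 b)
  have hs (n : ℕ) [n.AtLeastTwo] (a : Fin 8) :
      (OfNat.ofNat n * MvPolynomial.X a ^ 2 : MvPolynomial (Fin 8) ℂ).IsHomogeneous 2 := by
    rw [← map_ofNat (MvPolynomial.C : ℂ →+* MvPolynomial (Fin 8) ℂ) n]
    exact ((h1 a).pow 2).C_mul _
  fin_cases j
  exacts [((hs 3 5).sub (hm 4 4 6)).add (hm' 3 7), ((hm 2 4 5).sub (hm 3 3 6)).add (hm' 2 7),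
    ((hm 5 3 5).sub (hm 8 2 6)).add (hm 3 1 7), ((hm 3 2 5).sub (hm 5 1 6)).add (hm 2 0 7),
    ((hs 5 4).sub (hm 9 2 6)).add (hm 4 1 7), ((hm' 3 4).sub (hm 2 1 6)).add (hm' 0 7),
    ((hm 5 2 4).sub (hm 8 1 5)).add (hm 3 0 6), ((hs 5 3).sub (hm 9 1 5)).add (hm 4 0 6),
    ((hm 2 2 3).sub (hm 3 1 4)).add (hm' 0 5), ((hs 3 2).sub (hm 4 1 3)).add (hm' 0 4)]

theorem eval_tangentQuadric (j : Fin 10) (s t u v : ℂ) :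
    MvPolynomial.eval (tangentVector s t u v) (tangentQuadric j) = 0 := by
  fin_cases j <;> simp [tangentQuadric, tangentVector] <;> ring

theorem isClosedImmersion_hyperplaneInclusion : IsClosedImmersion hyperplaneInclusion :=
  isClosedImmersion_map _ _ _ fun j => ⟨MvPolynomial.X j.castSucc, MvPolynomial.isHomogeneous_X ℂ _,
    by rw [MvPolynomial.aeval_X, hyperplaneForms, Fin.snoc_castSucc]⟩

/-- If F / x_i^n vanishes on the curve, then x_i F lies in (f), and on the chart x_i is 1. So it is
enough that the section's ideal contains the f_j, and these are restrictions of quadrics through the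
tangent developable. -/
theorem cuspIdeal_eq : cuspIdeal = reducedIdealSheaf curvePoints := by
  refine le_antisymm cuspIdeal_le
    (Scheme.IdealSheafData.le_of_iSup_eq_top chart (iSup_chart _) fun i z hz => ?_)
  obtain ⟨n, F, hF, rfl⟩ := exists_eq_dehomog i z
  rw [dehomog_mem_reducedIdealSheaf _ _ hF] at hz
  have h1 : MvPolynomial.X i * F ∈ Ideal.span (Set.range f) :=
    (forall_curvePoints_iff hF (MvPolynomial.isHomogeneous_X ℂ i)).mp (by simpa using hz)
  suffices h2 : Ideal.span (Set.range f) ≤ (cuspIdeal.ideal (chart i)).comap (dehomog i) by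
    simpa [dehomog_X_self] using h2 h1
  rw [Ideal.span_le]
  rintro _ ⟨j, rfl⟩
  change dehomog i (f j) ∈ cuspIdeal.ideal (chart i)
  have hpre : hyperplaneInclusion ⁻¹ᵁ (chart i.castSucc).1 = (chart i).1 := by
    have : hyperplaneInclusion ⁻¹ᵁ (chart i.castSucc).1 = Proj.basicOpen (grading (Fin 7))
      (MvPolynomial.aeval hyperplaneForms (MvPolynomial.X i.castSucc)) := rfl
    rw [this, MvPolynomial.aeval_X, hyperplaneForms, Fin.snoc_castSucc]
    rfl
  have hq : QuasiCompact hyperplaneInclusion :=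
    have := isClosedImmersion_hyperplaneInclusion
    inferInstance
  have h3 : dehomog i.castSucc (tangentQuadric j) ∈ tangentDevelopable.ideal (chart i.castSucc) := by
    rw [tangentDevelopable, dehomog_mem_reducedIdealSheaf _ _ (tangentQuadric_isHomogeneous j)]
    rintro _ ⟨s, t, u, v, rfl⟩ -
    exact eval_tangentQuadric j s t u v
  have h4 := tangentDevelopable.le_map_comap hyperplaneInclusion _ h3
  have hA : IsAffineOpen (hyperplaneInclusion ⁻¹ᵁ (chart i.castSucc).1) := by
    rw [hpre]; exact (chart i).2
  rw [Scheme.IdealSheafData.ideal_map _ _ _ hA, Ideal.mem_comap] at h4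
  have h5 := cuspIdeal.ideal_le_comap_ideal (U := chart i) (V := ⟨_, hA⟩) hpre.ge h4
  rw [← aeval_tangentQuadric, ← appLE_dehomog hyperplaneForms hyperplaneForms_isHomogeneous _
    i.castSucc i (by rw [hyperplaneForms, Fin.snoc_castSucc]) hpre.ge
    (tangentQuadric_isHomogeneous j)]
  exact h5

/-- The subscheme defined by the ideal sheaf of a closed set is reduced. -/
theorem isReduced_subscheme_vanishingIdeal {X : Scheme} (Z : Closeds X) :
    IsReduced (Scheme.IdealSheafData.vanishingIdeal Z).subscheme := by
  have h (U : X.affineOpens) : IsReduced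
      ((Scheme.IdealSheafData.vanishingIdeal Z).subschemeCover.openCover.X U) := by
    have : _root_.IsReduced (Γ(X, U) ⧸ (Scheme.IdealSheafData.vanishingIdeal Z).ideal U) := by
      rw [← Ideal.isRadical_iff_quotient_reduced]
      exact PrimeSpectrum.isRadical_vanishingIdeal _
    exact (inferInstance : IsReduced (Spec (CommRingCat.of
      (Γ(X, U) ⧸ (Scheme.IdealSheafData.vanishingIdeal Z).ideal U))))
  apply +allowSynthFailures isReduced_of_isReduced_stalk
  intro x
  obtain ⟨U, y, rfl⟩ :=
    (Scheme.IdealSheafData.vanishingIdeal Z).subschemeCover.openCover.exists_eq x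
  have := h U
  exact isReduced_of_injective _ (asIso (Scheme.Hom.stalkMap
    ((Scheme.IdealSheafData.vanishingIdeal Z).subschemeCover.openCover.f U)
      y)).commRingCatIsoToRingEquiv.injective

theorem isReduced_cuspCurve : IsReduced cuspCurve := by
  rw [cuspCurve, cuspIdeal_eq]
  exact isReduced_subscheme_vanishingIdeal _

/-! ### The quadrics through the curve -/

theorem finSumFinEquiv_symm_eq : ⇑(finSumFinEquiv (m := 5) (n := 5)).symm =
    ![.inl 0, .inl 1, .inl 2, .inl 3, .inl 4, .inr 0, .inr 1, .inr 2, .inr 3, .inr 4] := by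
  decide

theorem eval_g (y : Fin 7 → ℂ) :
    (fun j : Fin 10 => MvPolynomial.eval y (g (finSumFinEquiv.symm j))) =
      ![-10 * (3 * y 5 ^ 2 - 4 * y 4 * y 6 + y 3 * y 0),
        15 * (2 * y 4 * y 5 - 3 * y 3 * y 6 + y 2 * y 0),
        3 * (5 * y 3 * y 5 - 8 * y 2 * y 6 + 3 * y 1 * y 0),
        -2 * (5 * y 4 ^ 2 - 9 * y 2 * y 6 + 4 * y 1 * y 0),
        -10 * (3 * y 2 * y 5 - 5 * y 1 * y 6 + 2 * y 0 * y 0) +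
          25 * (y 3 * y 4 - 2 * y 1 * y 6 + y 0 * y 0),
        3 * y 2 ^ 2 - 4 * y 1 * y 3 + y 0 * y 4,
        2 * y 2 * y 3 - 3 * y 1 * y 4 + y 0 * y 5,
        5 * y 2 * y 4 - 8 * y 1 * y 5 + 3 * y 0 * y 6,
        5 * y 3 ^ 2 - 9 * y 1 * y 5 + 4 * y 0 * y 6,
        -(3 * y 2 * y 5 - 5 * y 1 * y 6 + 2 * y 0 * y 0) +
          2 * (y 3 * y 4 - 2 * y 1 * y 6 + y 0 * y 0)] := by
  have h (j : Fin 10) : MvPolynomial.eval y (f j) = _ := congrFun (aeval_f y) j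
  funext j
  rw [finSumFinEquiv_symm_eq]
  fin_cases j <;>
    simp only [g, Fin.zero_eta, Fin.mk_one, Fin.reduceFinMk, Matrix.cons_val, map_add, map_neg,
      map_mul, map_ofNat, Sum.elim_inl, Sum.elim_inr, h]

/-- The values of the g_j at ten suitable points form an invertible matrix. -/
theorem linearIndependent_g : LinearIndependent ℂ g := by
  rw [← linearIndependent_equiv finSumFinEquiv.symm, Fintype.linearIndependent_iff]
  intro c hc
  have E (v : Fin 10 → ℂ)
      (hv : ∃ y, (fun j : Fin 10 => MvPolynomial.eval y (g (finSumFinEquiv.symm j))) = v) :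
      ∑ i, c i * v i = 0 := by
    obtain ⟨y, rfl⟩ := hv
    have := congr(MvPolynomial.eval y $hc)
    simpa only [map_sum, map_zero, MvPolynomial.smul_eval, Function.comp] using this
  simp only [Fin.sum_univ_succ, Fin.sum_univ_zero, Fin.succ_zero_eq_one, Fin.succ_one_eq_two,
    Fin.reduceSucc] at E
  have e0 := E ![-30, 0, 0, 0, 0, 0, 0, 0, 0, 0]
    ⟨![0, 0, 0, 0, 0, 1, 0], by rw [eval_g]; simp only [Matrix.cons_val]; norm_num⟩
  have e1 := E ![0, 0, 0, -10, 0, 0, 0, 0, 0, 0]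
    ⟨![0, 0, 0, 0, 1, 0, 0], by rw [eval_g]; simp only [Matrix.cons_val]; norm_num⟩
  have e2 := E ![0, 0, 0, 0, 0, 0, 0, 0, 5, 0]
    ⟨![0, 0, 0, 1, 0, 0, 0], by rw [eval_g]; simp only [Matrix.cons_val]; norm_num⟩
  have e3 := E ![0, 0, 0, 0, 0, 3, 0, 0, 0, 0]
    ⟨![0, 0, 1, 0, 0, 0, 0], by rw [eval_g]; simp only [Matrix.cons_val]; norm_num⟩
  have e4 := E ![0, 0, 0, 0, 5, 0, 0, 0, 0, 0]
    ⟨![1, 0, 0, 0, 0, 0, 0], by rw [eval_g]; simp only [Matrix.cons_val]; norm_num⟩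
  have e5 := E ![0, 0, 0, 0, 0, 0, 0, 0, 0, -1]
    ⟨![0, 1, 0, 0, 0, 0, -1], by rw [eval_g]; simp only [Matrix.cons_val]; norm_num⟩
  have e6 := E ![0, 45, 0, 0, 0, 0, 0, 0, 5, 0]
    ⟨![0, 0, 0, 1, 0, 0, -1], by rw [eval_g]; simp only [Matrix.cons_val]; norm_num⟩
  have e7 := E ![0, 0, 0, -10, 0, 0, 3, 0, 0, 0]
    ⟨![0, 1, 0, 0, -1, 0, 0], by rw [eval_g]; simp only [Matrix.cons_val]; norm_num⟩
  have e8 := E ![-30, 0, -15, 0, 0, 0, 0, 0, 5, 0]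
    ⟨![0, 0, 0, 1, 0, -1, 0], by rw [eval_g]; simp only [Matrix.cons_val]; norm_num⟩
  have e9 := E ![0, 0, 0, -10, 0, 3, 0, -5, 0, 0]
    ⟨![0, 0, 1, 0, -1, 0, 0], by rw [eval_g]; simp only [Matrix.cons_val]; norm_num⟩
  simp only [Matrix.cons_val, mul_zero, add_zero, zero_add] at e0 e1 e2 e3 e4 e5 e6 e7 e8 e9
  have h0 : c 0 = 0 := by linear_combination (-1 / 30) * e0
  have h1 : c 1 = 0 := by linear_combination (-1 / 45) * e2 + (1 / 45) * e6
  have h2 : c 2 = 0 := by linear_combination (1 / 15) * e0 + (1 / 15) * e2 + (-1 / 15) * e8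
  have h3 : c 3 = 0 := by linear_combination (-1 / 10) * e1
  have h4 : c 4 = 0 := by linear_combination (1 / 5) * e4
  have h5 : c 5 = 0 := by linear_combination (1 / 3) * e3
  have h6 : c 6 = 0 := by linear_combination (-1 / 3) * e1 + (1 / 3) * e7
  have h7 : c 7 = 0 := by linear_combination (1 / 5) * e1 + (1 / 5) * e3 + (-1 / 5) * e9
  have h8 : c 8 = 0 := by linear_combination (1 / 5) * e2
  have h9 : c 9 = 0 := by linear_combination (-1) * e5
  intro i
  fin_cases i
  exacts [h0, h1, h2, h3, h4, h5, h6, h7, h8, h9]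

theorem aeval_g_Q : MvPolynomial.aeval g Q = 0 := by
  rw [Q, map_sum]
  simp only [map_mul, MvPolynomial.aeval_X, Fin.sum_univ_five]
  simp only [g, Sum.elim_inl, Sum.elim_inr, Matrix.cons_val, f]
  ring

/-! ### Quadratic relations between the quadrics -/

theorem exists_eq_sum_of_isHomogeneous_two {ι : Type} [Fintype ι] [LinearOrder ι]
    {q : MvPolynomial ι ℂ} (hq : q.IsHomogeneous 2) :
    ∃ c : ι → ι → ℂ, (∀ a b, b < a → c a b = 0) ∧
      q = ∑ a, ∑ b, MvPolynomial.C (c a b) * (MvPolynomial.X a * MvPolynomial.X b) := by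
  have key : ∀ S : Finset (ι →₀ ℕ), S ⊆ q.support → ∃ c : ι → ι → ℂ, (∀ a b, b < a → c a b = 0) ∧
      ∑ m ∈ S, MvPolynomial.monomial m (q.coeff m) =
        ∑ a, ∑ b, MvPolynomial.C (c a b) * (MvPolynomial.X a * MvPolynomial.X b) := by
    intro S
    induction S using Finset.induction_on with
    | empty => exact fun _ => ⟨0, by simp⟩
    | insert m S hm ih =>
      intro hS
      obtain ⟨c, hc, h⟩ := ih ((Finset.subset_insert _ _).trans hS)
      have hdeg : m.degree = 2 := by
        rw [← hq (MvPolynomial.mem_support_iff.mp (hS (Finset.mem_insert_self _ _))),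
          Finsupp.degree_eq_weight_one]
        rfl
      have hab : ∃ a b, a ≤ b ∧ m = Finsupp.single a 1 + Finsupp.single b 1 := by
        -- A monomial of degree 2 is a multiset with two elements.
        obtain ⟨a, b, hab⟩ := Multiset.card_eq_two.mp ((Finsupp.card_toMultiset m).trans hdeg)
        have : m = Finsupp.single a 1 + Finsupp.single b 1 := by
          apply Multiset.toFinsupp.symm.injective
          change Finsupp.toMultiset m = Finsupp.toMultiset _
          rw [hab, map_add, Finsupp.toMultiset_single, Finsupp.toMultiset_single]
          rfl
        rcases le_total a b with h | h
        · exact ⟨a, b, h, this⟩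
        · exact ⟨b, a, h, this.trans (add_comm _ _)⟩
      obtain ⟨a, b, hab, rfl⟩ := hab
      refine ⟨c + Pi.single a
        (Pi.single b (q.coeff (Finsupp.single a 1 + Finsupp.single b 1))), fun a' b' hlt => ?_, ?_⟩
      · rw [Pi.add_apply, Pi.add_apply, hc a' b' hlt, zero_add]
        by_cases h1 : a' = a
        · subst h1
          rw [Pi.single_eq_same, Pi.single_eq_of_ne (by rintro rfl; exact absurd hab hlt.not_ge)]
        · rw [Pi.single_eq_of_ne h1, Pi.zero_apply]
      · rw [Finset.sum_insert hm, h]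
        simp only [Pi.add_apply, map_add, add_mul, Finset.sum_add_distrib]
        rw [add_comm]
        congr 1
        rw [Finset.sum_eq_single a (fun a' _ h => by simp [h]) (by simp),
          Finset.sum_eq_single b (fun b' _ h => by simp [h]) (by simp), Pi.single_eq_same,
          Pi.single_eq_same, MvPolynomial.X, MvPolynomial.X, MvPolynomial.monomial_mul,
          MvPolynomial.C_mul_monomial, mul_one, mul_one]
  obtain ⟨c, hc, h⟩ := key q.support subset_rfl
  exact ⟨c, hc, q.as_sum.trans h⟩

set_option maxHeartbeats 4000000 in
/-- A quadratic relation between the quadrics `g_j` is a multiple of `Q`. -/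
theorem coeff_of_quadratic_relation (c : Fin 10 → Fin 10 → ℂ) (hc : ∀ a b, b < a → c a b = 0)
    (h : ∀ y, ∑ a, ∑ b, c a b * (MvPolynomial.eval y (g (finSumFinEquiv.symm a)) *
      MvPolynomial.eval y (g (finSumFinEquiv.symm b))) = 0) (a b : Fin 10) :
    c a b = if (b : ℕ) = a + 5 then c 0 5 else 0 := by
  have E (v : Fin 10 → ℂ)
      (hv : ∃ y, (fun j : Fin 10 => MvPolynomial.eval y (g (finSumFinEquiv.symm j))) = v) :
      c 0 0 * v 0 * v 0 + c 0 1 * v 0 * v 1 + c 0 2 * v 0 * v 2 + c 0 3 * v 0 * v 3 + c 0 4 * v 0 * v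
        4 + c 0 5 * v 0 * v 5 + c 0 6 * v 0 * v 6 + c 0 7 * v 0 * v 7 + c 0 8 * v 0 * v 8 + c 0 9
        * v 0 * v 9 + c 1 1 * v 1 * v 1 + c 1 2 * v 1 * v 2 + c 1 3 * v 1 * v 3 + c 1 4 * v 1 * v
        4 + c 1 5 * v 1 * v 5 + c 1 6 * v 1 * v 6 + c 1 7 * v 1 * v 7 + c 1 8 * v 1 * v 8 + c 1 9
        * v 1 * v 9 + c 2 2 * v 2 * v 2 + c 2 3 * v 2 * v 3 + c 2 4 * v 2 * v 4 + c 2 5 * v 2 * v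
        5 + c 2 6 * v 2 * v 6 + c 2 7 * v 2 * v 7 + c 2 8 * v 2 * v 8 + c 2 9 * v 2 * v 9 + c 3 3
        * v 3 * v 3 + c 3 4 * v 3 * v 4 + c 3 5 * v 3 * v 5 + c 3 6 * v 3 * v 6 + c 3 7 * v 3 * v
        7 + c 3 8 * v 3 * v 8 + c 3 9 * v 3 * v 9 + c 4 4 * v 4 * v 4 + c 4 5 * v 4 * v 5 + c 4 6
        * v 4 * v 6 + c 4 7 * v 4 * v 7 + c 4 8 * v 4 * v 8 + c 4 9 * v 4 * v 9 + c 5 5 * v 5 * v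
        5 + c 5 6 * v 5 * v 6 + c 5 7 * v 5 * v 7 + c 5 8 * v 5 * v 8 + c 5 9 * v 5 * v 9 + c 6 6
        * v 6 * v 6 + c 6 7 * v 6 * v 7 + c 6 8 * v 6 * v 8 + c 6 9 * v 6 * v 9 + c 7 7 * v 7 * v
        7 + c 7 8 * v 7 * v 8 + c 7 9 * v 7 * v 9 + c 8 8 * v 8 * v 8 + c 8 9 * v 8 * v 9 + c 9 9
        * v 9 * v 9 = 0 := by
    obtain ⟨y, rfl⟩ := hv
    rw [← h y]
    have hc' (a b : Fin 10) (hab : b < a) := hc a b hab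
    simp only [Fin.sum_univ_succ, Fin.sum_univ_zero, Fin.succ_zero_eq_one, Fin.succ_one_eq_two,
      Fin.reduceSucc, hc' 1 0 (by decide), hc' 2 0 (by decide), hc' 2 1 (by decide), hc' 3 0 (by
        decide), hc' 3 1 (by
      decide), hc' 3 2 (by decide), hc' 4 0 (by decide), hc' 4 1 (by decide), hc' 4 2 (by decide),
      hc' 4 3 (by decide), hc' 5 0 (by decide), hc' 5 1 (by decide), hc' 5 2 (by decide), hc' 5 3
      (by decide), hc' 5 4 (by decide), hc' 6 0 (by decide), hc' 6 1 (by decide), hc' 6 2 (by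
      decide), hc' 6 3 (by decide), hc' 6 4 (by decide), hc' 6 5 (by decide), hc' 7 0 (by decide),
      hc' 7 1 (by decide), hc' 7 2 (by decide), hc' 7 3 (by decide), hc' 7 4 (by decide), hc' 7 5
      (by decide), hc' 7 6 (by decide), hc' 8 0 (by decide), hc' 8 1 (by decide), hc' 8 2 (by
      decide), hc' 8 3 (by decide), hc' 8 4 (by decide), hc' 8 5 (by decide), hc' 8 6 (by decide),
      hc' 8 7 (by decide), hc' 9 0 (by decide), hc' 9 1 (by decide), hc' 9 2 (by decide), hc' 9 3
      (by decide), hc' 9 4 (by decide), hc' 9 5 (by decide), hc' 9 6 (by decide), hc' 9 7 (by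
      decide), hc' 9 8 (by decide)]
    ring
  -- The relation holds for all y in ℂ^7, so sparse integral points may be used. The 54 chosen ones
  -- give equations of rank 54 in the 55 upper triangular coefficients.
  have e0 := E ![-30, 0, 0, 0, 0, 0, 0, 0, 0, 0]
    ⟨![0, 0, 0, 0, 0, 1, 0], by rw [eval_g]; simp only [Matrix.cons_val]; norm_num⟩
  have e1 := E ![0, 0, 0, -10, 0, 0, 0, 0, 0, 0]
    ⟨![0, 0, 0, 0, 1, 0, 0], by rw [eval_g]; simp only [Matrix.cons_val]; norm_num⟩
  have e2 := E ![0, 0, 0, 0, 0, 0, 0, 0, 5, 0]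
    ⟨![0, 0, 0, 1, 0, 0, 0], by rw [eval_g]; simp only [Matrix.cons_val]; norm_num⟩
  have e3 := E ![0, 0, 0, 0, 0, 3, 0, 0, 0, 0]
    ⟨![0, 0, 1, 0, 0, 0, 0], by rw [eval_g]; simp only [Matrix.cons_val]; norm_num⟩
  have e4 := E ![0, 0, 0, 0, 5, 0, 0, 0, 0, 0]
    ⟨![1, 0, 0, 0, 0, 0, 0], by rw [eval_g]; simp only [Matrix.cons_val]; norm_num⟩
  have e5 := E ![0, 0, 0, 0, 0, 0, 0, 0, 0, -1]
    ⟨![0, 1, 0, 0, 0, 0, -1], by rw [eval_g]; simp only [Matrix.cons_val]; norm_num⟩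
  have e6 := E ![-40, 0, 0, -10, 0, 0, 0, 0, 0, 0]
    ⟨![0, 0, 0, 0, 1, 0, -1], by rw [eval_g]; simp only [Matrix.cons_val]; norm_num⟩
  have e7 := E ![0, 45, 0, 0, 0, 0, 0, 0, 5, 0]
    ⟨![0, 0, 0, 1, 0, 0, -1], by rw [eval_g]; simp only [Matrix.cons_val]; norm_num⟩
  have e8 := E ![0, -45, 0, 0, 0, 0, 0, 0, 5, 0]
    ⟨![0, 0, 0, 1, 0, 0, 1], by rw [eval_g]; simp only [Matrix.cons_val]; norm_num⟩
  have e9 := E ![0, 0, 0, 0, 0, 4, 0, 0, 5, 0]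
    ⟨![0, 1, 0, -1, 0, 0, 0], by rw [eval_g]; simp only [Matrix.cons_val]; norm_num⟩
  have e10 := E ![0, 0, 0, -10, 0, 0, 3, 0, 0, 0]
    ⟨![0, 1, 0, 0, -1, 0, 0], by rw [eval_g]; simp only [Matrix.cons_val]; norm_num⟩
  have e11 := E ![0, 0, 0, -10, 0, 0, -3, 0, 0, 0]
    ⟨![0, 1, 0, 0, 1, 0, 0], by rw [eval_g]; simp only [Matrix.cons_val]; norm_num⟩
  have e12 := E ![-30, -30, 0, -10, 0, 0, 0, 0, 0, 0]
    ⟨![0, 0, 0, 0, 1, -1, 0], by rw [eval_g]; simp only [Matrix.cons_val]; norm_num⟩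
  have e13 := E ![-30, 0, -15, 0, 0, 0, 0, 0, 5, 0]
    ⟨![0, 0, 0, 1, 0, -1, 0], by rw [eval_g]; simp only [Matrix.cons_val]; norm_num⟩
  have e14 := E ![-30, 0, 15, 0, 0, 0, 0, 0, 5, 0]
    ⟨![0, 0, 0, 1, 0, 1, 0], by rw [eval_g]; simp only [Matrix.cons_val]; norm_num⟩
  have e15 := E ![0, 0, 0, 0, 0, 3, -2, 0, 5, 0]
    ⟨![0, 0, 1, -1, 0, 0, 0], by rw [eval_g]; simp only [Matrix.cons_val]; norm_num⟩
  have e16 := E ![0, 0, 0, -10, 0, 3, 0, -5, 0, 0]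
    ⟨![0, 0, 1, 0, -1, 0, 0], by rw [eval_g]; simp only [Matrix.cons_val]; norm_num⟩
  have e17 := E ![0, 0, 24, -18, 0, 3, 0, 0, 0, 0]
    ⟨![0, 0, 1, 0, 0, 0, -1], by rw [eval_g]; simp only [Matrix.cons_val]; norm_num⟩
  have e18 := E ![0, 0, -24, 18, 0, 3, 0, 0, 0, 0]
    ⟨![0, 0, 1, 0, 0, 0, 1], by rw [eval_g]; simp only [Matrix.cons_val]; norm_num⟩
  have e19 := E ![0, 0, 0, -10, 0, 3, 0, 5, 0, 0]
    ⟨![0, 0, 1, 0, 1, 0, 0], by rw [eval_g]; simp only [Matrix.cons_val]; norm_num⟩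
  have e20 := E ![-30, 0, 0, 0, 0, 0, 0, 8, 9, 0]
    ⟨![0, 1, 0, 0, 0, -1, 0], by rw [eval_g]; simp only [Matrix.cons_val]; norm_num⟩
  have e21 := E ![-30, 0, 0, 0, 0, 0, 0, -8, -9, 0]
    ⟨![0, 1, 0, 0, 0, 1, 0], by rw [eval_g]; simp only [Matrix.cons_val]; norm_num⟩
  have e22 := E ![0, 0, -9, 8, 5, 0, 0, 0, 0, 0]
    ⟨![1, -1, 0, 0, 0, 0, 0], by rw [eval_g]; simp only [Matrix.cons_val]; norm_num⟩
  have e23 := E ![0, -15, 0, 0, 5, 3, 0, 0, 0, 0]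
    ⟨![1, 0, -1, 0, 0, 0, 0], by rw [eval_g]; simp only [Matrix.cons_val]; norm_num⟩
  have e24 := E ![10, 0, 0, 0, 5, 0, 0, 0, 5, 0]
    ⟨![1, 0, 0, -1, 0, 0, 0], by rw [eval_g]; simp only [Matrix.cons_val]; norm_num⟩
  have e25 := E ![0, 0, 0, -10, 5, -1, 0, 0, 0, 0]
    ⟨![1, 0, 0, 0, -1, 0, 0], by rw [eval_g]; simp only [Matrix.cons_val]; norm_num⟩
  have e26 := E ![-30, 0, 0, 0, 5, 0, -1, 0, 0, 0]
    ⟨![1, 0, 0, 0, 0, -1, 0], by rw [eval_g]; simp only [Matrix.cons_val]; norm_num⟩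
  have e27 := E ![0, 0, 0, 0, 5, 0, 0, -3, -4, 0]
    ⟨![1, 0, 0, 0, 0, 0, -1], by rw [eval_g]; simp only [Matrix.cons_val]; norm_num⟩
  have e28 := E ![0, 0, 0, 0, 5, 0, 0, 3, 4, 0]
    ⟨![1, 0, 0, 0, 0, 0, 1], by rw [eval_g]; simp only [Matrix.cons_val]; norm_num⟩
  have e29 := E ![-30, 0, 0, 0, 5, 0, 1, 0, 0, 0]
    ⟨![1, 0, 0, 0, 0, 1, 0], by rw [eval_g]; simp only [Matrix.cons_val]; norm_num⟩
  have e30 := E ![0, 0, 0, -10, 5, 1, 0, 0, 0, 0]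
    ⟨![1, 0, 0, 0, 1, 0, 0], by rw [eval_g]; simp only [Matrix.cons_val]; norm_num⟩
  have e31 := E ![-10, 0, 0, 0, 5, 0, 0, 0, 5, 0]
    ⟨![1, 0, 0, 1, 0, 0, 0], by rw [eval_g]; simp only [Matrix.cons_val]; norm_num⟩
  have e32 := E ![-120, 60, 0, -10, 0, 0, 0, 0, 0, 0]
    ⟨![0, 0, 0, 0, 1, 2, 0], by rw [eval_g]; simp only [Matrix.cons_val]; norm_num⟩
  have e33 := E ![-120, 0, 30, 0, 0, 0, 0, 0, 5, 0]
    ⟨![0, 0, 0, 1, 0, 2, 0], by rw [eval_g]; simp only [Matrix.cons_val]; norm_num⟩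
  have e34 := E ![0, 0, 0, -40, 0, 3, 0, 10, 0, 0]
    ⟨![0, 0, 1, 0, 2, 0, 0], by rw [eval_g]; simp only [Matrix.cons_val]; norm_num⟩
  have e35 := E ![0, 0, 0, 0, 0, 3, 4, 0, 20, 0]
    ⟨![0, 0, 1, 2, 0, 0, 0], by rw [eval_g]; simp only [Matrix.cons_val]; norm_num⟩
  have e36 := E ![-120, 0, 0, 0, 5, 0, 2, 0, 0, 0]
    ⟨![1, 0, 0, 0, 0, 2, 0], by rw [eval_g]; simp only [Matrix.cons_val]; norm_num⟩
  have e37 := E ![0, 30, 0, 0, 5, 12, 0, 0, 0, 0]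
    ⟨![1, 0, 2, 0, 0, 0, 0], by rw [eval_g]; simp only [Matrix.cons_val]; norm_num⟩
  have e38 := E ![0, 0, 0, -10, -25, 0, 0, 0, 5, -2]
    ⟨![0, 0, 0, 1, -1, 0, 0], by rw [eval_g]; simp only [Matrix.cons_val]; norm_num⟩
  have e39 := E ![0, 0, 0, -10, 25, 0, 0, 0, 5, 2]
    ⟨![0, 0, 0, 1, 1, 0, 0], by rw [eval_g]; simp only [Matrix.cons_val]; norm_num⟩
  have e40 := E ![-30, 0, 0, 0, 30, 3, 0, 0, 0, 3]
    ⟨![0, 0, 1, 0, 0, -1, 0], by rw [eval_g]; simp only [Matrix.cons_val]; norm_num⟩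
  have e41 := E ![-30, 0, 0, 0, -30, 3, 0, 0, 0, -3]
    ⟨![0, 0, 1, 0, 0, 1, 0], by rw [eval_g]; simp only [Matrix.cons_val]; norm_num⟩
  have e42 := E ![0, 0, 0, -40, 50, 0, 0, 0, 5, 4]
    ⟨![0, 0, 0, 1, 2, 0, 0], by rw [eval_g]; simp only [Matrix.cons_val]; norm_num⟩
  have e43 := E ![-120, 0, 0, 0, -60, 3, 0, 0, 0, -6]
    ⟨![0, 0, 1, 0, 0, 2, 0], by rw [eval_g]; simp only [Matrix.cons_val]; norm_num⟩
  have e44 := E ![-30, 45, -15, 0, 0, 0, 0, 0, 5, 0]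
    ⟨![0, 0, 0, 1, 0, -1, -1], by rw [eval_g]; simp only [Matrix.cons_val]; norm_num⟩
  have e45 := E ![0, 0, 0, -10, 0, 3, 3, 5, 0, 0]
    ⟨![0, 1, -1, 0, -1, 0, 0], by rw [eval_g]; simp only [Matrix.cons_val]; norm_num⟩
  have e46 := E ![0, 0, -24, 18, 0, 3, 0, 0, 0, -1]
    ⟨![0, 1, -1, 0, 0, 0, -1], by rw [eval_g]; simp only [Matrix.cons_val]; norm_num⟩
  have e47 := E ![0, -45, 0, 0, 0, 4, 0, 0, 5, -1]
    ⟨![0, 1, 0, -1, 0, 0, -1], by rw [eval_g]; simp only [Matrix.cons_val]; norm_num⟩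
  have e48 := E ![40, 0, 0, -10, 0, 0, 3, 0, 0, -1]
    ⟨![0, 1, 0, 0, -1, 0, -1], by rw [eval_g]; simp only [Matrix.cons_val]; norm_num⟩
  have e49 := E ![-30, 0, 0, 0, 0, 0, 0, 8, 9, -1]
    ⟨![0, 1, 0, 0, 0, -1, -1], by rw [eval_g]; simp only [Matrix.cons_val]; norm_num⟩
  have e50 := E ![40, 0, 24, -28, 0, 3, 0, -5, 0, 0]
    ⟨![0, 0, 1, 0, -1, 0, -1], by rw [eval_g]; simp only [Matrix.cons_val]; norm_num⟩
  have e51 := E ![0, 0, -9, -2, 5, -1, -3, 0, 0, 0]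
    ⟨![1, -1, 0, 0, -1, 0, 0], by rw [eval_g]; simp only [Matrix.cons_val]; norm_num⟩
  have e52 := E ![0, -15, 0, -10, 5, 2, 0, 5, 0, 0]
    ⟨![1, 0, -1, 0, -1, 0, 0], by rw [eval_g]; simp only [Matrix.cons_val]; norm_num⟩
  have e53 := E ![0, -45, 24, -18, 0, 3, -2, 0, 5, 0]
    ⟨![0, 0, 1, -1, 0, 0, -1], by rw [eval_g]; simp only [Matrix.cons_val]; norm_num⟩
  simp only [Matrix.cons_val, mul_zero, add_zero, zero_add]
    at e0 e1 e2 e3 e4 e5 e6 e7 e8 e9 e10 e11 e12 e13 e14 e15 e16 e17 e18 e19 e20 e21 e22 e23 e24 e25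
      e26 e27 e28 e29 e30 e31 e32 e33 e34 e35 e36 e37 e38 e39 e40 e41 e42 e43 e44 e45 e46 e47 e48
      e49 e50 e51 e52 e53
  -- Gaussian elimination with `c 0 5` as free parameter: `c 1 6`, `c 2 7`, `c 3 8`, `c 4 9` come
  -- out equal to it, the others zero.
  have h00 : c 0 0 = 0 := by linear_combination (1 / 900) * e0
  have h33 : c 3 3 = 0 := by linear_combination (1 / 100) * e1
  have h03 : c 0 3 = 0 := by linear_combination (1 / 400) * e6 + (-4) * h00 + (-1 / 4) * h33
  have h44 : c 4 4 = 0 := by linear_combination (1 / 25) * e4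
  have h55 : c 5 5 = 0 := by linear_combination (1 / 9) * e3
  have h88 : c 8 8 = 0 := by linear_combination (1 / 25) * e2
  have h58 : c 5 8 = 0 := by linear_combination (1 / 20) * e9 + (-4 / 5) * h55 + (-5 / 4) * h88
  have h99 : c 9 9 = 0 := by linear_combination e5
  have h11 : c 1 1 = 0 := by linear_combination (1 / 4050) * e7 + (1 / 4050) * e8 + (-1 / 81) *
    h88
  have h18 : c 1 8 = 0 := by linear_combination (1 / 225) * e7 + (-9) * h11 + (-1 / 9) * h88
  have h01 : c 0 1 = 0 := by linear_combination (-1 / 2700) * e12 + (-1 / 5400) * e32 + (3) * h00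
    + (1 / 3) * h03 + (1) * h11 + (1 / 18) * h33
  have h13 : c 1 3 = 0 := by linear_combination (1 / 300) * e12 + (-3) * h00 + (-3) * h01 + (-1) *
    h03 + (-3) * h11 + (-1 / 3) * h33
  have h12 : c 1 2 = 0 := by linear_combination (1 / 675) * e13 + (-1 / 675) * e44 + (-2) * h01 +
    (3) * h11 + (1 / 3) * h18
  have h34 : c 3 4 = 0 := by linear_combination (-1 / 100) * e25 + (-1 / 100) * e30 + (2) * h33 +
    (1 / 2) * h44 + (1 / 50) * h55
  have h36 : c 3 6 = 0 := by linear_combination (-1 / 60) * e10 + (1 / 60) * e11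
  have h66 : c 6 6 = 0 := by linear_combination (1 / 9) * e10 + (-100 / 9) * h33 + (10 / 3) * h36
  have h04 : c 0 4 = 0 := by linear_combination (-1 / 300) * e26 + (-1 / 300) * e29 + (6) * h00 +
    (1 / 6) * h44 + (1 / 150) * h66
  have h06 : c 0 6 = 0 := by linear_combination (-1 / 90) * e26 + (-1 / 180) * e36 + (90) * h00 +
    (-5) * h04 + (5 / 12) * h44 + (1 / 30) * h66
  have h46 : c 4 6 = 0 := by linear_combination (-1 / 5) * e26 + (180) * h00 + (-30) * h04 + (6) *
    h06 + (5) * h44 + (1 / 5) * h66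
  have h08 : c 0 8 = 0 := by linear_combination (1 / 100) * e24 + (-1 / 100) * e31 + (-1) * h04
  have h48 : c 4 8 = 0 := by linear_combination (1 / 25) * e24 + (-4) * h00 + (-2) * h04 + (-2) *
    h08 + (-1) * h44 + (-1) * h88
  have h07 : c 0 7 = 0 := by linear_combination (-1 / 480) * e20 + (1 / 480) * e21 + (-9 / 8) *
    h08
  have h22 : c 2 2 = 0 := by linear_combination (1 / 450) * e13 + (1 / 450) * e14 + (-4) * h00 +
    (2 / 3) * h08 + (-1 / 9) * h88
  have h02 : c 0 2 = 0 := by linear_combination (-1 / 1350) * e13 + (-1 / 2700) * e33 + (6) * h00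
    + (-1 / 3) * h08 + (1 / 2) * h22 + (1 / 36) * h88
  have h28 : c 2 8 = 0 := by linear_combination (-1 / 75) * e13 + (12) * h00 + (6) * h02 + (-2) *
    h08 + (3) * h22 + (1 / 3) * h88
  have h23 : c 2 3 = 0 := by linear_combination (-1 / 864) * e17 + (-1 / 864) * e18 + (4 / 3) *
    h22 + (3 / 4) * h33 + (1 / 48) * h55
  have h24 : c 2 4 = 0 := by linear_combination (-1 / 45) * e22 + (9 / 5) * h22 + (-8 / 5) * h23 +
    (64 / 45) * h33 + (8 / 9) * h34 + (5 / 9) * h44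
  have h47 : c 4 7 = 0 := by linear_combination (-1 / 30) * e27 + (1 / 30) * e28 + (-4 / 3) * h48
  have h49 : c 4 9 = c 0 5 := by linear_combination (1 / 180) * e40 + (1 / 180) * e41 + (-10) *
    h00 + (-10) * h44 + (-1 / 10) * h55 + (-1 / 10) * h99
  have h09 : c 0 9 = 0 := by linear_combination (1 / 270) * e40 + (1 / 540) * e43 + (-30) * h00 +
    (-10) * h04 + (-10) * h44 + (-1) * h49 + (-1 / 20) * h55 + (-1 / 10) * h99
  have h38 : c 3 8 = c 0 5 := by linear_combination (-1 / 100) * e38 + (-1 / 100) * e39 + (2) *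
    h33 + (25 / 2) * h44 + (1) * h49 + (1 / 2) * h88 + (2 / 25) * h99
  have h39 : c 3 9 = 0 := by linear_combination (-1 / 60) * e38 + (-1 / 120) * e42 + (15) * h33 +
    (-25 / 2) * h34 + (-5 / 2) * h38 + (125 / 4) * h44 + (5 / 2) * h49 + (5 / 8) * h88 + (1 / 5) *
    h99
  have h69 : c 6 9 = 0 := by linear_combination (-1 / 3) * e48 + (1600 / 3) * h00 + (-400 / 3) *
    h03 + (40) * h06 + (-40 / 3) * h09 + (100 / 3) * h33 + (-10) * h36 + (10 / 3) * h39 + (3) *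
    h66 + (1 / 3) * h99
  have h89 : c 8 9 = 0 := by linear_combination (-1 / 10) * e38 + (10) * h33 + (25) * h34 + (-5) *
    h38 + (2) * h39 + (125 / 2) * h44 + (-25 / 2) * h48 + (5) * h49 + (5 / 2) * h88 + (2 / 5) *
    h99
  have h56 : c 5 6 = 0 := by linear_combination (-2 / 9) * e15 + (-1 / 36) * e35 + (9 / 4) * h55 +
    (5) * h58 + (4 / 3) * h66 + (50 / 3) * h88
  have h68 : c 6 8 = 0 := by linear_combination (-1 / 10) * e15 + (9 / 10) * h55 + (-3 / 5) * h56
    + (3 / 2) * h58 + (2 / 5) * h66 + (5 / 2) * h88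
  have h67 : c 6 7 = 0 := by linear_combination (-1 / 15) * e19 + (1 / 15) * e45 + (2) * h36 + (-3
    / 5) * h56 + (-3 / 5) * h66
  have h77 : c 7 7 = 0 := by linear_combination (1 / 10) * e20 + (-3 / 5) * e27 + (-90) * h00 +
    (24) * h07 + (27) * h08 + (15) * h44 + (-9) * h47 + (-12) * h48 + (3 / 2) * h88
  have h78 : c 7 8 = 0 := by linear_combination (1 / 72) * e20 + (-25 / 2) * h00 + (10 / 3) * h07
    + (15 / 4) * h08 + (-8 / 9) * h77 + (-9 / 8) * h88
  have h79 : c 7 9 = 0 := by linear_combination (-1 / 8) * e49 + (225 / 2) * h00 + (-30) * h07 +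
    (-135 / 4) * h08 + (15 / 4) * h09 + (8) * h77 + (9) * h78 + (81 / 8) * h88 + (-9 / 8) * h89 +
    (1 / 8) * h99
  have h35 : c 3 5 = 0 := by linear_combination (-1 / 60) * e16 + (-1 / 60) * e19 + (10 / 3) * h33
    + (3 / 10) * h55 + (5 / 6) * h77
  have h25 : c 2 5 = 0 := by linear_combination (1 / 72) * e17 + (-8) * h22 + (6) * h23 + (-9 / 2)
    * h33 + (3 / 4) * h35 + (-1 / 8) * h55
  have h45 : c 4 5 = 0 := by linear_combination (-1 / 5) * e25 + (20) * h33 + (-10) * h34 + (2) *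
    h35 + (5) * h44 + (1 / 5) * h55
  have h26 : c 2 6 = 0 := by linear_combination (1 / 27) * e51 + (-3) * h22 + (-2 / 3) * h23 + (5
    / 3) * h24 + (-1 / 3) * h25 + (-4 / 27) * h33 + (10 / 27) * h34 + (-2 / 27) * h35 + (-2 / 9) *
    h36 + (-25 / 27) * h44 + (5 / 27) * h45 + (5 / 9) * h46 + (-1 / 27) * h55 + (-1 / 9) * h56 +
    (-1 / 3) * h66
  have h59 : c 5 9 = 0 := by linear_combination (1 / 9) * e40 + (-100) * h00 + (100) * h04 + (10)
    * h09 + (-100) * h44 + (-10) * h45 + (-10) * h49 + (-1) * h55 + (-1) * h99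
  have h29 : c 2 9 = 0 := by linear_combination (1 / 24) * e46 + (-24) * h22 + (18) * h23 + (3) *
    h25 + (-27 / 2) * h33 + (-9 / 4) * h35 + (3 / 4) * h39 + (-3 / 8) * h55 + (1 / 8) * h59 + (-1
    / 24) * h99
  have h14 : c 1 4 = 0 := by linear_combination (-4 / 225) * e23 + (-1 / 450) * e37 + (6) * h11 +
    (1 / 2) * h44 + (2 / 5) * h45 + (12 / 25) * h55
  have h15 : c 1 5 = 0 := by linear_combination (-1 / 45) * e23 + (5) * h11 + (-5 / 3) * h14 + (5
    / 9) * h44 + (1 / 3) * h45 + (1 / 5) * h55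
  have h16 : c 1 6 = c 0 5 := by linear_combination (1 / 90) * e53 + (-45 / 2) * h11 + (12) * h12
    + (-9) * h13 + (3 / 2) * h15 + (5 / 2) * h18 + (-32 / 5) * h22 + (24 / 5) * h23 + (-4 / 5) *
    h25 + (8 / 15) * h26 + (-4 / 3) * h28 + (-18 / 5) * h33 + (3 / 5) * h35 + (-2 / 5) * h36 + (1)
    * h38 + (-1 / 10) * h55 + (1 / 15) * h56 + (-1 / 6) * h58 + (-2 / 45) * h66 + (1 / 9) * h68 +
    (-5 / 18) * h88
  have h19 : c 1 9 = 0 := by linear_combination (1 / 45) * e47 + (-45) * h11 + (4) * h15 + (5) *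
    h18 + (-16 / 45) * h55 + (-4 / 9) * h58 + (4 / 45) * h59 + (-5 / 9) * h88 + (1 / 9) * h89 +
    (-1 / 45) * h99
  have h37 : c 3 7 = 0 := by linear_combination (-1 / 150) * e16 + (-1 / 300) * e34 + (6) * h33 +
    (-3 / 5) * h35 + (9 / 100) * h55 + (1 / 2) * h77
  have h57 : c 5 7 = 0 := by linear_combination (-1 / 15) * e16 + (20 / 3) * h33 + (-2) * h35 +
    (10 / 3) * h37 + (3 / 5) * h55 + (5 / 3) * h77
  have h17 : c 1 7 = 0 := by linear_combination (-1 / 75) * e52 + (3) * h11 + (2) * h13 + (-1) *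
    h14 + (-2 / 5) * h15 + (4 / 3) * h33 + (-2 / 3) * h34 + (-4 / 15) * h35 + (-2 / 3) * h37 + (1
    / 3) * h44 + (2 / 15) * h45 + (1 / 3) * h47 + (4 / 75) * h55 + (2 / 15) * h57 + (1 / 3) * h77
  have h27 : c 2 7 = c 0 5 := by linear_combination (-1 / 120) * e50 + (40 / 3) * h00 + (8) * h02
    + (-28 / 3) * h03 + (-5 / 3) * h07 + (24 / 5) * h22 + (-28 / 5) * h23 + (3 / 5) * h25 + (98 /
    15) * h33 + (-7 / 10) * h35 + (7 / 6) * h37 + (3 / 40) * h55 + (-1 / 8) * h57 + (5 / 24) * h77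
  fin_cases a <;> fin_cases b <;> first
    | exact hc _ _ (by decide)
    | (simp only [Fin.zero_eta, Fin.mk_one, Fin.reduceFinMk, h00, h33, h03, h44, h55, h88, h58, h99,
      h11, h18, h01, h13, h12, h34, h36, h66, h04, h06, h46,
      h08, h48, h07, h22, h02, h28, h23, h24, h47, h49, h09, h38, h39, h69, h89, h56, h68, h67,
      h77, h78, h79, h35, h25, h45, h26, h59, h29, h14, h15, h16, h19, h37, h57, h17, h27];
        norm_num)

theorem aeval_g_eq_zero_iff {q : MvPolynomial (Fin 5 ⊕ Fin 5) ℂ} (hq : q.IsHomogeneous 2) :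
    MvPolynomial.aeval g q = 0 ↔ q ∈ Submodule.span ℂ {Q} := by
  constructor
  · intro h
    obtain ⟨c, hc, hqc⟩ := exists_eq_sum_of_isHomogeneous_two
      (hq.rename_isHomogeneous (f := (finSumFinEquiv : Fin 5 ⊕ Fin 5 ≃ Fin 10)))
    have hq' : q = ∑ a, ∑ b, MvPolynomial.C (c a b) *
        (MvPolynomial.X (finSumFinEquiv.symm a) * MvPolynomial.X (finSumFinEquiv.symm b)) := by
      have := congr(MvPolynomial.rename (finSumFinEquiv (m := 5) (n := 5)).symm $hqc)
      simpa [MvPolynomial.rename_rename] using this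
    have hcoeff := coeff_of_quadratic_relation c hc fun y => by
      have := congr(MvPolynomial.eval y $h)
      rw [hq'] at this
      simpa only [map_sum, map_mul, map_zero, MvPolynomial.aeval_X, MvPolynomial.aeval_C,
        MvPolynomial.algebraMap_eq, MvPolynomial.eval_C] using this
    rw [Submodule.mem_span_singleton]
    refine ⟨c 0 5, ?_⟩
    -- Naming this coefficient keeps `hcoeff` from rewriting its own right-hand side.
    obtain ⟨r, hr⟩ : ∃ r, r = c 0 5 := ⟨_, rfl⟩
    rw [← hr] at hcoeff ⊢
    rw [hq', Q, Finset.smul_sum]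
    simp only [hcoeff, finSumFinEquiv_symm_eq, Fin.sum_univ_succ, Fin.sum_univ_zero,
      Fin.succ_zero_eq_one, Fin.succ_one_eq_two, Fin.reduceSucc, Matrix.cons_val]
    norm_num [MvPolynomial.smul_eq_C_mul]
  · intro h
    obtain ⟨r, rfl⟩ := Submodule.mem_span_singleton.mp h
    rw [map_smul, aeval_g_Q, smul_zero]

/-! ### The space I_2 of quadrics through the curve -/

theorem forall_mem_incl_iff {d : ℕ} {F : MvPolynomial (Fin 7) ℂ} (hF : F.IsHomogeneous d) :
    (∀ p : cuspCurve, F ∈ (cuspCurve.incl p).asHomogeneousIdeal) ↔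
      ∀ v ∈ curvePoints, MvPolynomial.eval v F = 0 := by
  -- The curve is the closure of the parametrized points, and the zero locus of a form is closed.
  have hr : Set.range cuspCurve.incl = closure {x : PSpace (Fin 7) |
      ∃ v, ∃ hv : v ≠ 0, v ∈ curvePoints ∧ x = point v hv} := by
    have h1 : Set.range cuspCurve.incl = cuspIdeal.support :=
      Scheme.IdealSheafData.range_subschemeι _
    rw [h1, cuspIdeal_eq, reducedIdealSheaf, Scheme.IdealSheafData.coe_support_vanishingIdeal]
    rfl
  constructor
  · rintro h v hv
    obtain ⟨t, ht, ht', rfl⟩ := hv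
    have h1 : point _ (curvePoint_ne_zero t) ∈ Set.range cuspCurve.incl := by
      rw [hr]
      exact subset_closure ⟨_, _, ⟨t, ht, ht', rfl⟩, rfl⟩
    obtain ⟨p, hp⟩ := h1
    rw [← mem_point_iff _ (curvePoint_ne_zero t) hF, ← hp]
    exact h p
  · intro h p
    have hcl : IsClosed {x : PSpace (Fin 7) | F ∈ x.asHomogeneousIdeal} := by
      have := ProjectiveSpectrum.isClosed_zeroLocus (grading (Fin 7)) {F}
      have e : {x : PSpace (Fin 7) | F ∈ x.asHomogeneousIdeal} =
          ProjectiveSpectrum.zeroLocus (grading (Fin 7)) {F} :=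
        Set.ext fun x => (Set.singleton_subset_iff (a := F)
          (s := {G : MvPolynomial (Fin 7) ℂ | G ∈ x.asHomogeneousIdeal})).symm
      rw [e]
      exact this
    have h2 : closure {x : PSpace (Fin 7) | ∃ v, ∃ hv : v ≠ 0, v ∈ curvePoints ∧ x = point v hv} ⊆
        {x : PSpace (Fin 7) | F ∈ x.asHomogeneousIdeal} := by
      refine closure_minimal ?_ hcl
      rintro _ ⟨v, hv, hvA, rfl⟩
      exact (mem_point_iff v hv hF).mpr (h v hvA)
    exact h2 (hr ▸ Set.mem_range_self p)

theorem f_mem_span_g (j : Fin 10) : f j ∈ Submodule.span ℂ (Set.range g) := by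
  have h (k) : g k ∈ Submodule.span ℂ (Set.range g) := Submodule.subset_span (Set.mem_range_self k)
  have hC (c : ℂ) (k) : MvPolynomial.C c * g k ∈ Submodule.span ℂ (Set.range g) := by
    rw [← MvPolynomial.smul_eq_C_mul]
    exact Submodule.smul_mem _ _ (h k)
  have hC' (c : ℂ) (k : ℕ) [k.AtLeastTwo] (hk : OfNat.ofNat k * c = 1) :
      (OfNat.ofNat k) * (MvPolynomial.C c : MvPolynomial (Fin 7) ℂ) = 1 := by
    rw [← map_ofNat (MvPolynomial.C : ℂ →+* MvPolynomial (Fin 7) ℂ) k, ← map_mul, hk, map_one]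
  have e0 := hC' (1 / 10) 10 (by norm_num)
  have e1 := hC' (1 / 15) 15 (by norm_num)
  have e2 := hC' (1 / 3) 3 (by norm_num)
  have e3 := hC' (1 / 2) 2 (by norm_num)
  have e4 := hC' (1 / 5) 5 (by norm_num)
  fin_cases j
  · convert hC (-(1 / 10)) (.inl 0) using 1
    simp only [g, Sum.elim_inl, Matrix.cons_val_zero, map_neg, Fin.zero_eta]
    linear_combination -f 0 * e0
  · convert hC (1 / 15) (.inl 1) using 1
    simp only [g, Sum.elim_inl, Matrix.cons_val, Fin.mk_one]
    linear_combination -f 1 * e1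
  · convert hC (1 / 3) (.inl 2) using 1
    simp only [g, Sum.elim_inl, Matrix.cons_val, Fin.reduceFinMk]
    linear_combination -f 2 * e2
  -- f_3 and f_5 are recovered by inverting the system g_4 = -10 f_3 + 25 f_5, g_9 = -f_3 + 2 f_5.
  · convert sub_mem (hC (2 * (1 / 5)) (.inl 4)) (hC 5 (.inr 4)) using 1
    simp only [g, Sum.elim_inl, Sum.elim_inr, Matrix.cons_val, Fin.reduceFinMk, map_mul, map_ofNat]
    linear_combination (4 * f 3 - 10 * f 5) * e4
  · convert hC (-(1 / 2)) (.inl 3) using 1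
    simp only [g, Sum.elim_inl, Matrix.cons_val, map_neg, Fin.reduceFinMk]
    linear_combination -f 4 * e3
  · convert sub_mem (hC (1 / 5) (.inl 4)) (hC 2 (.inr 4)) using 1
    simp only [g, Sum.elim_inl, Sum.elim_inr, Matrix.cons_val, Fin.reduceFinMk, map_ofNat]
    linear_combination (2 * f 3 - 5 * f 5) * e4
  exacts [h (.inr 2), h (.inr 3), h (.inr 1), h (.inr 0)]

theorem g_mem_span_f (k : Fin 5 ⊕ Fin 5) : g k ∈ Submodule.span ℂ (Set.range f) := by
  have h (k) : f k ∈ Submodule.span ℂ (Set.range f) := Submodule.subset_span (Set.mem_range_self k)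
  have hC (n : ℕ) [n.AtLeastTwo] (k) : OfNat.ofNat n * f k ∈ Submodule.span ℂ (Set.range f) := by
    rw [← map_ofNat (MvPolynomial.C : ℂ →+* MvPolynomial (Fin 7) ℂ) n, ← MvPolynomial.smul_eq_C_mul]
    exact Submodule.smul_mem _ _ (h k)
  have hN (n : ℕ) [n.AtLeastTwo] (k) : -OfNat.ofNat n * f k ∈ Submodule.span ℂ (Set.range f) := by
    rw [neg_mul]
    exact neg_mem (hC n k)
  rcases k with k | k <;> fin_cases k
  exacts [hN 10 0, hC 15 1, hC 3 2, hN 2 4, add_mem (hN 10 3) (hC 25 5), h 9, h 8, h 6, h 7,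
    add_mem (neg_mem (h 3)) (hC 2 5)]

/-- A form of degree `n` in the ideal generated by finitely many forms of degree `n` is a linear
combination of them. -/
theorem mem_span_of_mem_ideal_span {σ ι : Type} [Fintype ι] {n : ℕ} {q : ι → MvPolynomial σ ℂ}
    (hq : ∀ i, (q i).IsHomogeneous n) {F : MvPolynomial σ ℂ} (hF : F.IsHomogeneous n)
    (h : F ∈ Ideal.span (Set.range q)) : F ∈ Submodule.span ℂ (Set.range q) := by
  obtain ⟨a, ha⟩ := (Ideal.mem_span_range_iff_exists_fun).mp h
  have h1 := congr(MvPolynomial.homogeneousComponent n $ha)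
  rw [MvPolynomial.homogeneousComponent_eq_self hF, map_sum] at h1
  rw [← h1]
  refine sum_mem fun i _ => ?_
  have h2 : MvPolynomial.homogeneousComponent n (a i * q i) =
      MvPolynomial.homogeneousComponent 0 (a i) * q i := by
    have := DirectSum.coe_decompose_mul_add_of_right_mem (grading σ) (a := a i) (i := 0) (hq i)
    rw [zero_add] at this
    rw [← MvPolynomial.decomposition.decompose'_apply,
      ← MvPolynomial.decomposition.decompose'_apply]
    exact this
  rw [h2, MvPolynomial.homogeneousComponent_zero, ← MvPolynomial.smul_eq_C_mul]
  exact Submodule.smul_mem _ _ (Submodule.subset_span (Set.mem_range_self i))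

theorem span_g_eq : Submodule.span ℂ (Set.range g) = quadricsThroughCurve := by
  have hfg : Submodule.span ℂ (Set.range g) = Submodule.span ℂ (Set.range f) :=
    le_antisymm (Submodule.span_le.mpr (Set.range_subset_iff.mpr g_mem_span_f))
      (Submodule.span_le.mpr (Set.range_subset_iff.mpr f_mem_span_g))
  rw [hfg]
  apply le_antisymm
  · rw [Submodule.span_le]
    rintro _ ⟨j, rfl⟩
    refine ⟨f_isHomogeneous j, (forall_mem_incl_iff (f_isHomogeneous j)).mpr ?_⟩
    rw [← aeval_curvePoly_eq_zero_iff]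
    exact aeval_curvePoly_f j
  · rintro F ⟨hF, h⟩
    refine mem_span_of_mem_ideal_span f_isHomogeneous hF (mem_span_f_of_aeval_eq_zero hF ?_)
    rwa [aeval_curvePoly_eq_zero_iff, ← forall_mem_incl_iff hF]

/-! ### Half spinors in coordinates -/

/-- The basis vector `e_i` of `U_∞`, in the exterior algebra. -/
abbrev basisVector (i : Fin 5) : ExteriorAlgebra ℂ UInf := ExteriorAlgebra.ι ℂ (Pi.single i 1)

theorem basisVector_mul_self (i : Fin 5) (x : ExteriorAlgebra ℂ UInf) :
    basisVector i * (basisVector i * x) = 0 := by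
  rw [← mul_assoc, ExteriorAlgebra.ι_sq_zero, zero_mul]

theorem basisVector_mul_swap {i j : Fin 5} (_ : j < i) (x : ExteriorAlgebra ℂ UInf) :
    basisVector i * (basisVector j * x) = -(basisVector j * (basisVector i * x)) := by
  rw [← mul_assoc, ← mul_assoc, ← neg_mul,
    eq_neg_of_add_eq_zero_left (ExteriorAlgebra.ι_add_mul_swap _ _)]

/-- Contraction by the `i`-th coordinate functional. -/
def contractCoord (i : Fin 5) : ExteriorAlgebra ℂ UInf →ₗ[ℂ] ExteriorAlgebra ℂ UInf :=
  CliffordAlgebra.contractLeft (LinearMap.proj i)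

theorem contractCoord_one (i : Fin 5) : contractCoord i 1 = 0 :=
  CliffordAlgebra.contractLeft_one _ _

theorem contractCoord_mul_self (i : Fin 5) (x : ExteriorAlgebra ℂ UInf) :
    contractCoord i (basisVector i * x) = x - basisVector i * contractCoord i x := by
  refine (CliffordAlgebra.contractLeft_ι_mul _ _ _).trans ?_
  simp [contractCoord]

theorem contractCoord_mul_of_ne {i j : Fin 5} (h : i ≠ j) (x : ExteriorAlgebra ℂ UInf) :
    contractCoord i (basisVector j * x) = -(basisVector j * contractCoord i x) := by
  refine (CliffordAlgebra.contractLeft_ι_mul _ _ _).trans ?_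
  simp [contractCoord, h]

theorem algebraMapInv_basisVector (i : Fin 5) :
    ExteriorAlgebra.algebraMapInv (basisVector i) = (0 : ℂ) := by
  simp [basisVector, ExteriorAlgebra.algebraMapInv]

theorem cliffordAction_eq (u : V) (x : ExteriorAlgebra ℂ UInf) :
    cliffordAction u x = ∑ i : Fin 5, (u (.inl i) • contractCoord i x +
      u (.inr i) • (basisVector i * x)) := by
  have h1 : (fun i => u (.inr i)) = ∑ i : Fin 5, u (.inr i) • (Pi.single i 1 : UInf) := by
    simpa using (pi_eq_sum_univ' fun i => u (.inr i))
  rw [cliffordAction, h1, map_sum, map_sum, LinearMap.sum_apply, Finset.sum_mul,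
    ← Finset.sum_add_distrib]
  refine Finset.sum_congr rfl fun i _ => ?_
  rw [map_smul, map_smul, smul_mul_assoc]
  rfl

/-- The index sets of the basis of `S⁻ = Λ^odd U_∞`. -/
def oddIndex : Fin 16 → List (Fin 5) :=
  ![[0], [1], [2], [3], [4], [0, 1, 2],
    [0, 1, 3], [0, 1, 4], [0, 2, 3], [0, 2, 4], [0, 3, 4], [1, 2, 3],
    [1, 2, 4], [1, 3, 4], [2, 3, 4], [0, 1, 2, 3, 4]]

/-- The coordinates of `φ_u(s)` in `S⁻`. -/
def cliffordCoord (u : V) (x : Fin 16 → ℂ) : Fin 16 → ℂ :=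
  ![u (.inr 0) * x 0 - u (.inl 1) * x 1 - u (.inl 2) * x 2 - u (.inl 3) * x 3 - u (.inl 4) * x 4,
    u (.inr 1) * x 0 + u (.inl 0) * x 1 - u (.inl 2) * x 5 - u (.inl 3) * x 6 - u (.inl 4) * x 7,
    u (.inr 2) * x 0 + u (.inl 0) * x 2 + u (.inl 1) * x 5 - u (.inl 3) * x 8 - u (.inl 4) * x 9,
    u (.inr 3) * x 0 + u (.inl 0) * x 3 + u (.inl 1) * x 6 + u (.inl 2) * x 8 - u (.inl 4) * x 10,
    u (.inr 4) * x 0 + u (.inl 0) * x 4 + u (.inl 1) * x 7 + u (.inl 2) * x 9 + u (.inl 3) * x 10,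
    u (.inr 2) * x 1 - u (.inr 1) * x 2 + u (.inr 0) * x 5 - u (.inl 3) * x 11 - u (.inl 4) * x 12,
    u (.inr 3) * x 1 - u (.inr 1) * x 3 + u (.inr 0) * x 6 + u (.inl 2) * x 11 - u (.inl 4) * x 13,
    u (.inr 4) * x 1 - u (.inr 1) * x 4 + u (.inr 0) * x 7 + u (.inl 2) * x 12 + u (.inl 3) * x 13,
    u (.inr 3) * x 2 - u (.inr 2) * x 3 + u (.inr 0) * x 8 - u (.inl 1) * x 11 - u (.inl 4) * x 14,
    u (.inr 4) * x 2 - u (.inr 2) * x 4 + u (.inr 0) * x 9 - u (.inl 1) * x 12 + u (.inl 3) * x 14,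
    u (.inr 4) * x 3 - u (.inr 3) * x 4 + u (.inr 0) * x 10 - u (.inl 1) * x 13 - u (.inl 2) * x 14,
    u (.inr 3) * x 5 - u (.inr 2) * x 6 + u (.inr 1) * x 8 + u (.inl 0) * x 11 - u (.inl 4) * x 15,
    u (.inr 4) * x 5 - u (.inr 2) * x 7 + u (.inr 1) * x 9 + u (.inl 0) * x 12 + u (.inl 3) * x 15,
    u (.inr 4) * x 6 - u (.inr 3) * x 7 + u (.inr 1) * x 10 + u (.inl 0) * x 13 - u (.inl 2) * x 15,
    u (.inr 4) * x 8 - u (.inr 3) * x 9 + u (.inr 2) * x 10 + u (.inl 0) * x 14 + u (.inl 1) * x 15,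
    u (.inr 4) * x 11 - u (.inr 3) * x 12 + u (.inr 2) * x 13 - u (.inr 1) * x 14 + u (.inr 0) *
      x 15]

set_option maxHeartbeats 4000000 in
theorem cliffordAction_spinor (u : V) (x : Fin 16 → ℂ) :
    cliffordAction u (spinor x) = ∑ k, cliffordCoord u x k • wedge (oddIndex k) := by
  have h1 (i : Fin 5) : contractCoord i (spinor x) = ∑ k, x k • contractCoord i (wedge (evenIndex
      k)) := by
    simp only [spinor, map_sum, map_smul]
  have h2 (i : Fin 5) : basisVector i * spinor x = ∑ k, x k • (basisVector i * wedge (evenIndex k)) := by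
    simp only [spinor, Finset.mul_sum, mul_smul_comm]
  rw [cliffordAction_eq]
  simp only [h1, h2, Fin.sum_univ_succ, Fin.sum_univ_zero, Fin.succ_zero_eq_one,
    Fin.succ_one_eq_two,
    Fin.reduceSucc, evenIndex, oddIndex, Matrix.cons_val, wedge, List.map_cons, List.map_nil,
    List.prod_cons, List.prod_nil]
  -- Normal ordering: contractions move right until they meet 1, and the condition j < i orients
  -- anticommutation so that the factors get sorted.
  simp (disch := decide) only [basisVector_mul_self, basisVector_mul_swap, contractCoord_mul_self,
    contractCoord_mul_of_ne, contractCoord_one, mul_neg, neg_neg, mul_zero, neg_zero,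
    sub_zero, smul_zero, smul_neg, add_zero, zero_add]
  simp only [cliffordCoord, Matrix.cons_val]
  module

set_option maxHeartbeats 4000000 in
-- Contracting by the coordinate functionals of J in increasing order and taking the scalar part
-- extracts the coefficient of e_J; each contraction removes the leading factor, so no sign appears.
theorem sum_oddIndex_eq_zero_iff (c : Fin 16 → ℂ) :
    ∑ k, c k • wedge (oddIndex k) = 0 ↔ c = 0 := by
  refine ⟨fun h => ?_, fun h => by simp [h]⟩
  simp only [Fin.sum_univ_succ, Fin.sum_univ_zero, Fin.succ_zero_eq_one, Fin.succ_one_eq_two,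
    Fin.reduceSucc, oddIndex, Matrix.cons_val, wedge, List.map_cons, List.map_nil,
    List.prod_cons, List.prod_nil] at h
  have key (J : List (Fin 5)) : ExteriorAlgebra.algebraMapInv (J.foldl (fun z i => contractCoord i
      z) _) = 0 :=
    (congr(ExteriorAlgebra.algebraMapInv (J.foldl (fun z i => contractCoord i z) $h))).trans (by
      induction J with
      | nil => simp
      | cons i J ih => simpa using ih)
  have h0 := key [0]
  have h1 := key [1]
  have h2 := key [2]
  have h3 := key [3]
  have h4 := key [4]
  have h5 := key [0, 1, 2]
  have h6 := key [0, 1, 3]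
  have h7 := key [0, 1, 4]
  have h8 := key [0, 2, 3]
  have h9 := key [0, 2, 4]
  have h10 := key [0, 3, 4]
  have h11 := key [1, 2, 3]
  have h12 := key [1, 2, 4]
  have h13 := key [1, 3, 4]
  have h14 := key [2, 3, 4]
  have h15 := key [0, 1, 2, 3, 4]
  simp (disch := decide) only [List.foldl_cons, List.foldl_nil, contractCoord_mul_self,
    contractCoord_mul_of_ne, contractCoord_one, algebraMapInv_basisVector,
    map_add, map_neg, map_smul, map_mul, map_one, mul_neg, neg_neg,
    mul_zero, zero_mul, neg_zero, sub_zero, smul_zero, smul_neg, add_zero, zero_add, smul_eq_mul]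
    at h0 h1 h2 h3 h4 h5 h6 h7 h8 h9 h10 h11 h12 h13 h14 h15
  simp only [mul_one] at h0 h1 h2 h3 h4 h5 h6 h7 h8 h9 h10 h11 h12 h13 h14 h15
  funext i
  fin_cases i
  exacts [h0, h1, h2, h3, h4, h5, h6, h7, h8, h9, h10, h11, h12, h13, h14, h15]

theorem mem_halfSpinors_iff (W : Submodule ℂ V) (x : Fin 16 → ℂ) :
    x ∈ halfSpinors W ↔ ∀ u ∈ W, cliffordCoord u x = 0 := by
  refine forall₂_congr fun u _ => ?_
  rw [cliffordAction_spinor, sum_oddIndex_eq_zero_iff]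

/-! ### The quadrics through the orthogonal Grassmannian -/

/-- The values of the ten quadrics through the orthogonal Grassmannian. -/
def spinorQ (x : Fin 16 → ℂ) : V :=
  Sum.elim
    ![x 0 * x 15 - x 5 * x 10 + x 6 * x 9 - x 7 * x 8,
      -x 0 * x 14 + x 2 * x 10 - x 3 * x 9 + x 4 * x 8,
      x 0 * x 13 - x 1 * x 10 + x 3 * x 7 - x 4 * x 6,
      -x 0 * x 12 + x 1 * x 9 - x 2 * x 7 + x 4 * x 5,
      x 0 * x 11 - x 1 * x 8 + x 2 * x 6 - x 3 * x 5]
    ![-x 1 * x 14 + x 2 * x 13 - x 3 * x 12 + x 4 * x 11,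
      -x 1 * x 15 + x 5 * x 13 - x 6 * x 12 + x 7 * x 11,
      -x 2 * x 15 + x 5 * x 14 - x 8 * x 12 + x 9 * x 11,
      -x 3 * x 15 + x 6 * x 14 - x 8 * x 13 + x 10 * x 11,
      -x 4 * x 15 + x 7 * x 14 - x 9 * x 13 + x 10 * x 12]

open MvPolynomial in
/-- The ten quadrics through the orthogonal Grassmannian. -/
def spinorQuadric : Fin 5 ⊕ Fin 5 → MvPolynomial (Fin 16) ℂ :=
  Sum.elim
    ![X 0 * X 15 - X 5 * X 10 + X 6 * X 9 - X 7 * X 8,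
      -X 0 * X 14 + X 2 * X 10 - X 3 * X 9 + X 4 * X 8,
      X 0 * X 13 - X 1 * X 10 + X 3 * X 7 - X 4 * X 6,
      -X 0 * X 12 + X 1 * X 9 - X 2 * X 7 + X 4 * X 5,
      X 0 * X 11 - X 1 * X 8 + X 2 * X 6 - X 3 * X 5]
    ![-X 1 * X 14 + X 2 * X 13 - X 3 * X 12 + X 4 * X 11,
      -X 1 * X 15 + X 5 * X 13 - X 6 * X 12 + X 7 * X 11,
      -X 2 * X 15 + X 5 * X 14 - X 8 * X 12 + X 9 * X 11,
      -X 3 * X 15 + X 6 * X 14 - X 8 * X 13 + X 10 * X 11,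
      -X 4 * X 15 + X 7 * X 14 - X 9 * X 13 + X 10 * X 12]

theorem eval_spinorQuadric (x : Fin 16 → ℂ) (a : Fin 5 ⊕ Fin 5) :
    MvPolynomial.eval x (spinorQuadric a) = spinorQ x a := by
  rcases a with a | a <;> fin_cases a <;> simp [spinorQuadric, spinorQ]

theorem spinorQuadric_isHomogeneous (a : Fin 5 ⊕ Fin 5) : (spinorQuadric a).IsHomogeneous 2 := by
  have h (i j : Fin 16) : (MvPolynomial.X i * MvPolynomial.X j :
      MvPolynomial (Fin 16) ℂ).IsHomogeneous 2 :=
    (MvPolynomial.isHomogeneous_X ℂ i).mul (MvPolynomial.isHomogeneous_X ℂ j)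
  have h' (i j : Fin 16) : (-MvPolynomial.X i * MvPolynomial.X j :
      MvPolynomial (Fin 16) ℂ).IsHomogeneous 2 :=
    (MvPolynomial.isHomogeneous_X ℂ i).neg.mul (MvPolynomial.isHomogeneous_X ℂ j)
  rcases a with a | a <;> fin_cases a
  exacts [(((h 0 15).sub (h 5 10)).add (h 6 9)).sub (h 7 8),
    (((h' 0 14).add (h 2 10)).sub (h 3 9)).add (h 4 8),
    (((h 0 13).sub (h 1 10)).add (h 3 7)).sub (h 4 6),
    (((h' 0 12).add (h 1 9)).sub (h 2 7)).add (h 4 5),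
    (((h 0 11).sub (h 1 8)).add (h 2 6)).sub (h 3 5),
    (((h' 1 14).add (h 2 13)).sub (h 3 12)).add (h 4 11),
    (((h' 1 15).add (h 5 13)).sub (h 6 12)).add (h 7 11),
    (((h' 2 15).add (h 5 14)).sub (h 8 12)).add (h 9 11),
    (((h' 3 15).add (h 6 14)).sub (h 8 13)).add (h 10 11),
    (((h' 4 15).add (h 7 14)).sub (h 9 13)).add (h 10 12)]

set_option maxHeartbeats 2000000 in
/-- If `φ_u(x) = 0`, then `u` is proportional to the vector `q(x)` of values of the quadrics. -/
theorem mul_spinorQ_comm {u : V} {x : Fin 16 → ℂ} (hu : cliffordCoord u x = 0)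
    (a b : Fin 5 ⊕ Fin 5) : u a * spinorQ x b = u b * spinorQ x a := by
  have h (k : Fin 16) := congrFun hu k
  simp only [cliffordCoord, Pi.zero_apply] at h
  have h0 := h 0
  have h1 := h 1
  have h2 := h 2
  have h3 := h 3
  have h4 := h 4
  have h5 := h 5
  have h6 := h 6
  have h7 := h 7
  have h8 := h 8
  have h9 := h 9
  have h10 := h 10
  have h11 := h 11
  have h12 := h 12
  have h13 := h 13
  have h14 := h 14
  have h15 := h 15
  simp only [Matrix.cons_val] at h0 h1 h2 h3 h4 h5 h6 h7 h8 h9 h10 h11 h12 h13 h14 h15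
  -- The 45 minors of the pair (u, q(x)) are combinations of the sixteen equations φ_u(x) = 0 with
  -- coefficients linear in x. Four equations suffice, except for the dual pairs (e_{-i}, e_i),
  -- where all sixteen enter with coefficients ±1/2.
  have k0 : u (.inl 0) * spinorQ x (.inl 1) = u (.inl 1) * spinorQ x (.inl 0) := by
    simp only [spinorQ, Sum.elim_inl, Matrix.cons_val]
    linear_combination (-1) * x 0 * h14 + x 8 * h4 + (-1) * x 9 * h3 + x 10 * h2
  have k1 : u (.inl 0) * spinorQ x (.inl 2) = u (.inl 2) * spinorQ x (.inl 0) := by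
    simp only [spinorQ, Sum.elim_inl, Matrix.cons_val]
    linear_combination x 0 * h13 + (-1) * x 6 * h4 + x 7 * h3 + (-1) * x 10 * h1
  have k2 : u (.inl 0) * spinorQ x (.inl 3) = u (.inl 3) * spinorQ x (.inl 0) := by
    simp only [spinorQ, Sum.elim_inl, Matrix.cons_val]
    linear_combination (-1) * x 0 * h12 + x 5 * h4 + (-1) * x 7 * h2 + x 9 * h1
  have k3 : u (.inl 0) * spinorQ x (.inl 4) = u (.inl 4) * spinorQ x (.inl 0) := by
    simp only [spinorQ, Sum.elim_inl, Matrix.cons_val]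
    linear_combination x 0 * h11 + (-1) * x 5 * h3 + x 6 * h2 + (-1) * x 8 * h1
  have k4 : u (.inl 0) * spinorQ x (.inr 0) = u (.inr 0) * spinorQ x (.inl 0) := by
    simp only [spinorQ, Sum.elim_inl, Sum.elim_inr, Matrix.cons_val]
    linear_combination (-1 / 2) * x 0 * h15 + (-1 / 2) * x 1 * h14 + (1 / 2) * x 2 * h13 + (-1
      / 2) * x 3 * h12 + (1 / 2) * x 4 * h11 + (1 / 2) * x 5 * h10 + (-1 / 2) * x 6 * h9 + (1
      / 2) * x 7 * h8 + (1 / 2) * x 8 * h7 + (-1 / 2) * x 9 * h6 + (1 / 2) * x 10 * h5 + (1 /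
      2) * x 11 * h4 + (-1 / 2) * x 12 * h3 + (1 / 2) * x 13 * h2 + (-1 / 2) * x 14 * h1 + (-1
      / 2) * x 15 * h0
  have k5 : u (.inl 0) * spinorQ x (.inr 1) = u (.inr 1) * spinorQ x (.inl 0) := by
    simp only [spinorQ, Sum.elim_inl, Sum.elim_inr, Matrix.cons_val]
    linear_combination x 5 * h13 + (-1) * x 6 * h12 + x 7 * h11 + (-1) * x 15 * h1
  have k6 : u (.inl 0) * spinorQ x (.inr 2) = u (.inr 2) * spinorQ x (.inl 0) := by
    simp only [spinorQ, Sum.elim_inl, Sum.elim_inr, Matrix.cons_val]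
    linear_combination x 5 * h14 + (-1) * x 8 * h12 + x 9 * h11 + (-1) * x 15 * h2
  have k7 : u (.inl 0) * spinorQ x (.inr 3) = u (.inr 3) * spinorQ x (.inl 0) := by
    simp only [spinorQ, Sum.elim_inl, Sum.elim_inr, Matrix.cons_val]
    linear_combination x 6 * h14 + (-1) * x 8 * h13 + x 10 * h11 + (-1) * x 15 * h3
  have k8 : u (.inl 0) * spinorQ x (.inr 4) = u (.inr 4) * spinorQ x (.inl 0) := by
    simp only [spinorQ, Sum.elim_inl, Sum.elim_inr, Matrix.cons_val]
    linear_combination x 7 * h14 + (-1) * x 9 * h13 + x 10 * h12 + (-1) * x 15 * h4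
  have k9 : u (.inl 1) * spinorQ x (.inl 2) = u (.inl 2) * spinorQ x (.inl 1) := by
    simp only [spinorQ, Sum.elim_inl, Matrix.cons_val]
    linear_combination (-1) * x 0 * h10 + x 3 * h4 + (-1) * x 4 * h3 + x 10 * h0
  have k10 : u (.inl 1) * spinorQ x (.inl 3) = u (.inl 3) * spinorQ x (.inl 1) := by
    simp only [spinorQ, Sum.elim_inl, Matrix.cons_val]
    linear_combination x 0 * h9 + (-1) * x 2 * h4 + x 4 * h2 + (-1) * x 9 * h0
  have k11 : u (.inl 1) * spinorQ x (.inl 4) = u (.inl 4) * spinorQ x (.inl 1) := by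
    simp only [spinorQ, Sum.elim_inl, Matrix.cons_val]
    linear_combination (-1) * x 0 * h8 + x 2 * h3 + (-1) * x 3 * h2 + x 8 * h0
  have k12 : u (.inl 1) * spinorQ x (.inr 0) = u (.inr 0) * spinorQ x (.inl 1) := by
    simp only [spinorQ, Sum.elim_inl, Sum.elim_inr, Matrix.cons_val]
    linear_combination (-1) * x 2 * h10 + x 3 * h9 + (-1) * x 4 * h8 + x 14 * h0
  have k13 : u (.inl 1) * spinorQ x (.inr 1) = u (.inr 1) * spinorQ x (.inl 1) := by
    simp only [spinorQ, Sum.elim_inl, Sum.elim_inr, Matrix.cons_val]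
    linear_combination (-1 / 2) * x 0 * h15 + (-1 / 2) * x 1 * h14 + (-1 / 2) * x 2 * h13 + (1
      / 2) * x 3 * h12 + (-1 / 2) * x 4 * h11 + (-1 / 2) * x 5 * h10 + (1 / 2) * x 6 * h9 +
      (-1 / 2) * x 7 * h8 + (1 / 2) * x 8 * h7 + (-1 / 2) * x 9 * h6 + (1 / 2) * x 10 * h5 +
      (1 / 2) * x 11 * h4 + (-1 / 2) * x 12 * h3 + (1 / 2) * x 13 * h2 + (1 / 2) * x 14 * h1 +
      (1 / 2) * x 15 * h0
  have k14 : u (.inl 1) * spinorQ x (.inr 2) = u (.inr 2) * spinorQ x (.inl 1) := by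
    simp only [spinorQ, Sum.elim_inl, Sum.elim_inr, Matrix.cons_val]
    linear_combination (-1) * x 2 * h14 + x 8 * h9 + (-1) * x 9 * h8 + x 14 * h2
  have k15 : u (.inl 1) * spinorQ x (.inr 3) = u (.inr 3) * spinorQ x (.inl 1) := by
    simp only [spinorQ, Sum.elim_inl, Sum.elim_inr, Matrix.cons_val]
    linear_combination (-1) * x 3 * h14 + x 8 * h10 + (-1) * x 10 * h8 + x 14 * h3
  have k16 : u (.inl 1) * spinorQ x (.inr 4) = u (.inr 4) * spinorQ x (.inl 1) := by
    simp only [spinorQ, Sum.elim_inl, Sum.elim_inr, Matrix.cons_val]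
    linear_combination (-1) * x 4 * h14 + x 9 * h10 + (-1) * x 10 * h9 + x 14 * h4
  have k17 : u (.inl 2) * spinorQ x (.inl 3) = u (.inl 3) * spinorQ x (.inl 2) := by
    simp only [spinorQ, Sum.elim_inl, Matrix.cons_val]
    linear_combination (-1) * x 0 * h7 + x 1 * h4 + (-1) * x 4 * h1 + x 7 * h0
  have k18 : u (.inl 2) * spinorQ x (.inl 4) = u (.inl 4) * spinorQ x (.inl 2) := by
    simp only [spinorQ, Sum.elim_inl, Matrix.cons_val]
    linear_combination x 0 * h6 + (-1) * x 1 * h3 + x 3 * h1 + (-1) * x 6 * h0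
  have k19 : u (.inl 2) * spinorQ x (.inr 0) = u (.inr 0) * spinorQ x (.inl 2) := by
    simp only [spinorQ, Sum.elim_inl, Sum.elim_inr, Matrix.cons_val]
    linear_combination x 1 * h10 + (-1) * x 3 * h7 + x 4 * h6 + (-1) * x 13 * h0
  have k20 : u (.inl 2) * spinorQ x (.inr 1) = u (.inr 1) * spinorQ x (.inl 2) := by
    simp only [spinorQ, Sum.elim_inl, Sum.elim_inr, Matrix.cons_val]
    linear_combination x 1 * h13 + (-1) * x 6 * h7 + x 7 * h6 + (-1) * x 13 * h1
  have k21 : u (.inl 2) * spinorQ x (.inr 2) = u (.inr 2) * spinorQ x (.inl 2) := by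
    simp only [spinorQ, Sum.elim_inl, Sum.elim_inr, Matrix.cons_val]
    linear_combination (-1 / 2) * x 0 * h15 + (1 / 2) * x 1 * h14 + (1 / 2) * x 2 * h13 + (1 /
      2) * x 3 * h12 + (-1 / 2) * x 4 * h11 + (-1 / 2) * x 5 * h10 + (-1 / 2) * x 6 * h9 + (1
      / 2) * x 7 * h8 + (-1 / 2) * x 8 * h7 + (1 / 2) * x 9 * h6 + (1 / 2) * x 10 * h5 + (1 /
      2) * x 11 * h4 + (-1 / 2) * x 12 * h3 + (-1 / 2) * x 13 * h2 + (-1 / 2) * x 14 * h1 + (1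
      / 2) * x 15 * h0
  have k22 : u (.inl 2) * spinorQ x (.inr 3) = u (.inr 3) * spinorQ x (.inl 2) := by
    simp only [spinorQ, Sum.elim_inl, Sum.elim_inr, Matrix.cons_val]
    linear_combination x 3 * h13 + (-1) * x 6 * h10 + x 10 * h6 + (-1) * x 13 * h3
  have k23 : u (.inl 2) * spinorQ x (.inr 4) = u (.inr 4) * spinorQ x (.inl 2) := by
    simp only [spinorQ, Sum.elim_inl, Sum.elim_inr, Matrix.cons_val]
    linear_combination x 4 * h13 + (-1) * x 7 * h10 + x 10 * h7 + (-1) * x 13 * h4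
  have k24 : u (.inl 3) * spinorQ x (.inl 4) = u (.inl 4) * spinorQ x (.inl 3) := by
    simp only [spinorQ, Sum.elim_inl, Matrix.cons_val]
    linear_combination (-1) * x 0 * h5 + x 1 * h2 + (-1) * x 2 * h1 + x 5 * h0
  have k25 : u (.inl 3) * spinorQ x (.inr 0) = u (.inr 0) * spinorQ x (.inl 3) := by
    simp only [spinorQ, Sum.elim_inl, Sum.elim_inr, Matrix.cons_val]
    linear_combination (-1) * x 1 * h9 + x 2 * h7 + (-1) * x 4 * h5 + x 12 * h0
  have k26 : u (.inl 3) * spinorQ x (.inr 1) = u (.inr 1) * spinorQ x (.inl 3) := by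
    simp only [spinorQ, Sum.elim_inl, Sum.elim_inr, Matrix.cons_val]
    linear_combination (-1) * x 1 * h12 + x 5 * h7 + (-1) * x 7 * h5 + x 12 * h1
  have k27 : u (.inl 3) * spinorQ x (.inr 2) = u (.inr 2) * spinorQ x (.inl 3) := by
    simp only [spinorQ, Sum.elim_inl, Sum.elim_inr, Matrix.cons_val]
    linear_combination (-1) * x 2 * h12 + x 5 * h9 + (-1) * x 9 * h5 + x 12 * h2
  have k28 : u (.inl 3) * spinorQ x (.inr 3) = u (.inr 3) * spinorQ x (.inl 3) := by
    simp only [spinorQ, Sum.elim_inl, Sum.elim_inr, Matrix.cons_val]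
    linear_combination (-1 / 2) * x 0 * h15 + (1 / 2) * x 1 * h14 + (-1 / 2) * x 2 * h13 + (-1
      / 2) * x 3 * h12 + (-1 / 2) * x 4 * h11 + (1 / 2) * x 5 * h10 + (1 / 2) * x 6 * h9 + (1
      / 2) * x 7 * h8 + (-1 / 2) * x 8 * h7 + (-1 / 2) * x 9 * h6 + (-1 / 2) * x 10 * h5 + (1
      / 2) * x 11 * h4 + (1 / 2) * x 12 * h3 + (1 / 2) * x 13 * h2 + (-1 / 2) * x 14 * h1 + (1
      / 2) * x 15 * h0
  have k29 : u (.inl 3) * spinorQ x (.inr 4) = u (.inr 4) * spinorQ x (.inl 3) := by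
    simp only [spinorQ, Sum.elim_inl, Sum.elim_inr, Matrix.cons_val]
    linear_combination (-1) * x 4 * h12 + x 7 * h9 + (-1) * x 9 * h7 + x 12 * h4
  have k30 : u (.inl 4) * spinorQ x (.inr 0) = u (.inr 0) * spinorQ x (.inl 4) := by
    simp only [spinorQ, Sum.elim_inl, Sum.elim_inr, Matrix.cons_val]
    linear_combination x 1 * h8 + (-1) * x 2 * h6 + x 3 * h5 + (-1) * x 11 * h0
  have k31 : u (.inl 4) * spinorQ x (.inr 1) = u (.inr 1) * spinorQ x (.inl 4) := by
    simp only [spinorQ, Sum.elim_inl, Sum.elim_inr, Matrix.cons_val]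
    linear_combination x 1 * h11 + (-1) * x 5 * h6 + x 6 * h5 + (-1) * x 11 * h1
  have k32 : u (.inl 4) * spinorQ x (.inr 2) = u (.inr 2) * spinorQ x (.inl 4) := by
    simp only [spinorQ, Sum.elim_inl, Sum.elim_inr, Matrix.cons_val]
    linear_combination x 2 * h11 + (-1) * x 5 * h8 + x 8 * h5 + (-1) * x 11 * h2
  have k33 : u (.inl 4) * spinorQ x (.inr 3) = u (.inr 3) * spinorQ x (.inl 4) := by
    simp only [spinorQ, Sum.elim_inl, Sum.elim_inr, Matrix.cons_val]
    linear_combination x 3 * h11 + (-1) * x 6 * h8 + x 8 * h6 + (-1) * x 11 * h3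
  have k34 : u (.inl 4) * spinorQ x (.inr 4) = u (.inr 4) * spinorQ x (.inl 4) := by
    simp only [spinorQ, Sum.elim_inl, Sum.elim_inr, Matrix.cons_val]
    linear_combination (-1 / 2) * x 0 * h15 + (1 / 2) * x 1 * h14 + (-1 / 2) * x 2 * h13 + (1
      / 2) * x 3 * h12 + (1 / 2) * x 4 * h11 + (1 / 2) * x 5 * h10 + (-1 / 2) * x 6 * h9 + (-1
      / 2) * x 7 * h8 + (1 / 2) * x 8 * h7 + (1 / 2) * x 9 * h6 + (-1 / 2) * x 10 * h5 + (-1 /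
      2) * x 11 * h4 + (-1 / 2) * x 12 * h3 + (1 / 2) * x 13 * h2 + (-1 / 2) * x 14 * h1 + (1
      / 2) * x 15 * h0
  have k35 : u (.inr 0) * spinorQ x (.inr 1) = u (.inr 1) * spinorQ x (.inr 0) := by
    simp only [spinorQ, Sum.elim_inr, Matrix.cons_val]
    linear_combination (-1) * x 1 * h15 + x 11 * h7 + (-1) * x 12 * h6 + x 13 * h5
  have k36 : u (.inr 0) * spinorQ x (.inr 2) = u (.inr 2) * spinorQ x (.inr 0) := by
    simp only [spinorQ, Sum.elim_inr, Matrix.cons_val]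
    linear_combination (-1) * x 2 * h15 + x 11 * h9 + (-1) * x 12 * h8 + x 14 * h5
  have k37 : u (.inr 0) * spinorQ x (.inr 3) = u (.inr 3) * spinorQ x (.inr 0) := by
    simp only [spinorQ, Sum.elim_inr, Matrix.cons_val]
    linear_combination (-1) * x 3 * h15 + x 11 * h10 + (-1) * x 13 * h8 + x 14 * h6
  have k38 : u (.inr 0) * spinorQ x (.inr 4) = u (.inr 4) * spinorQ x (.inr 0) := by
    simp only [spinorQ, Sum.elim_inr, Matrix.cons_val]
    linear_combination (-1) * x 4 * h15 + x 12 * h10 + (-1) * x 13 * h9 + x 14 * h7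
  have k39 : u (.inr 1) * spinorQ x (.inr 2) = u (.inr 2) * spinorQ x (.inr 1) := by
    simp only [spinorQ, Sum.elim_inr, Matrix.cons_val]
    linear_combination (-1) * x 5 * h15 + x 11 * h12 + (-1) * x 12 * h11 + x 15 * h5
  have k40 : u (.inr 1) * spinorQ x (.inr 3) = u (.inr 3) * spinorQ x (.inr 1) := by
    simp only [spinorQ, Sum.elim_inr, Matrix.cons_val]
    linear_combination (-1) * x 6 * h15 + x 11 * h13 + (-1) * x 13 * h11 + x 15 * h6
  have k41 : u (.inr 1) * spinorQ x (.inr 4) = u (.inr 4) * spinorQ x (.inr 1) := by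
    simp only [spinorQ, Sum.elim_inr, Matrix.cons_val]
    linear_combination (-1) * x 7 * h15 + x 12 * h13 + (-1) * x 13 * h12 + x 15 * h7
  have k42 : u (.inr 2) * spinorQ x (.inr 3) = u (.inr 3) * spinorQ x (.inr 2) := by
    simp only [spinorQ, Sum.elim_inr, Matrix.cons_val]
    linear_combination (-1) * x 8 * h15 + x 11 * h14 + (-1) * x 14 * h11 + x 15 * h8
  have k43 : u (.inr 2) * spinorQ x (.inr 4) = u (.inr 4) * spinorQ x (.inr 2) := by
    simp only [spinorQ, Sum.elim_inr, Matrix.cons_val]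
    linear_combination (-1) * x 9 * h15 + x 12 * h14 + (-1) * x 14 * h12 + x 15 * h9
  have k44 : u (.inr 3) * spinorQ x (.inr 4) = u (.inr 4) * spinorQ x (.inr 3) := by
    simp only [spinorQ, Sum.elim_inr, Matrix.cons_val]
    linear_combination (-1) * x 10 * h15 + x 13 * h14 + (-1) * x 14 * h13 + x 15 * h10
  clear hu h
  generalize spinorQ x = q at *
  rcases a with a | a <;> rcases b with b | b <;> fin_cases a <;> fin_cases b <;>
    first | rfl | assumption | exact Eq.symm (by assumption)

/-- If q(x) ≠ 0, every vector which annihilates x lies on the line spanned by q(x). This gives the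
quadrics through OG(5,10) without classifying pure spinors. -/
theorem spinorQ_eq_zero {W : Submodule ℂ V} (hW : 1 < Module.finrank ℂ W) {x : Fin 16 → ℂ}
    (hx : x ∈ halfSpinors W) : spinorQ x = 0 := by
  by_contra h
  obtain ⟨b, hb⟩ := Function.ne_iff.mp h
  rw [Pi.zero_apply] at hb
  have hle : W ≤ Submodule.span ℂ {spinorQ x} := by
    intro u hu
    have hc := mul_spinorQ_comm ((mem_halfSpinors_iff W x).mp hx u hu)
    refine Submodule.mem_span_singleton.mpr ⟨u b / spinorQ x b, funext fun a => ?_⟩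
    rw [Pi.smul_apply, smul_eq_mul, div_mul_eq_mul_div, div_eq_iff hb, hc a b]
  have := Submodule.finrank_mono hle
  rw [finrank_span_singleton h] at this
  omega

/-! ### Mukai's spaces -/

/-- The polarization of the quadratic map `y ↦ (g_j(y))`. -/
def gPolar (y : Fin 7 → ℂ) : (Fin 7 → ℂ) →ₗ[ℂ] V where
  toFun z := Sum.elim
    ![-10 * (6 * y 5 * z 5 - 4 * (y 4 * z 6 + y 6 * z 4) + (y 3 * z 0 + y 0 * z 3)),
      15 * (2 * (y 4 * z 5 + y 5 * z 4) - 3 * (y 3 * z 6 + y 6 * z 3) + (y 2 * z 0 + y 0 * z 2)),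
      3 * (5 * (y 3 * z 5 + y 5 * z 3) - 8 * (y 2 * z 6 + y 6 * z 2) + 3 * (y 1 * z 0 + y 0 * z 1)),
      -2 * (10 * y 4 * z 4 - 9 * (y 2 * z 6 + y 6 * z 2) + 4 * (y 1 * z 0 + y 0 * z 1)),
      -- The y_1 y_6 terms of -10 f_3 and 25 f_5 cancel, as do the y_0² terms in the last
      -- coordinate, g_9.
      -30 * (y 2 * z 5 + y 5 * z 2) + 10 * y 0 * z 0 + 25 * (y 3 * z 4 + y 4 * z 3)]
    ![6 * y 2 * z 2 - 4 * (y 1 * z 3 + y 3 * z 1) + (y 0 * z 4 + y 4 * z 0),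
      2 * (y 2 * z 3 + y 3 * z 2) - 3 * (y 1 * z 4 + y 4 * z 1) + (y 0 * z 5 + y 5 * z 0),
      5 * (y 2 * z 4 + y 4 * z 2) - 8 * (y 1 * z 5 + y 5 * z 1) + 3 * (y 0 * z 6 + y 6 * z 0),
      10 * y 3 * z 3 - 9 * (y 1 * z 5 + y 5 * z 1) + 4 * (y 0 * z 6 + y 6 * z 0),
      -3 * (y 2 * z 5 + y 5 * z 2) + (y 1 * z 6 + y 6 * z 1) + 2 * (y 3 * z 4 + y 4 * z 3)]
  map_add' a b := by
    funext j
    rcases j with j | j <;> fin_cases j <;>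
      simp only [Sum.elim_inl, Sum.elim_inr, Fin.zero_eta, Fin.mk_one, Fin.reduceFinMk,
        Matrix.cons_val, Pi.add_apply] <;> ring
  map_smul' c a := by
    funext j
    rcases j with j | j <;> fin_cases j <;>
      simp only [Sum.elim_inl, Sum.elim_inr, Fin.zero_eta, Fin.mk_one, Fin.reduceFinMk,
        Matrix.cons_val, Pi.smul_apply, smul_eq_mul, RingHom.id_apply] <;> ring

theorem gPolar_apply (y z : Fin 7 → ℂ) : gPolar y z = Sum.elim
    ![-10 * (6 * y 5 * z 5 - 4 * (y 4 * z 6 + y 6 * z 4) + (y 3 * z 0 + y 0 * z 3)),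
      15 * (2 * (y 4 * z 5 + y 5 * z 4) - 3 * (y 3 * z 6 + y 6 * z 3) + (y 2 * z 0 + y 0 * z 2)),
      3 * (5 * (y 3 * z 5 + y 5 * z 3) - 8 * (y 2 * z 6 + y 6 * z 2) + 3 * (y 1 * z 0 + y 0 * z 1)),
      -2 * (10 * y 4 * z 4 - 9 * (y 2 * z 6 + y 6 * z 2) + 4 * (y 1 * z 0 + y 0 * z 1)),
      -30 * (y 2 * z 5 + y 5 * z 2) + 10 * y 0 * z 0 + 25 * (y 3 * z 4 + y 4 * z 3)]
    ![6 * y 2 * z 2 - 4 * (y 1 * z 3 + y 3 * z 1) + (y 0 * z 4 + y 4 * z 0),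
      2 * (y 2 * z 3 + y 3 * z 2) - 3 * (y 1 * z 4 + y 4 * z 1) + (y 0 * z 5 + y 5 * z 0),
      5 * (y 2 * z 4 + y 4 * z 2) - 8 * (y 1 * z 5 + y 5 * z 1) + 3 * (y 0 * z 6 + y 6 * z 0),
      10 * y 3 * z 3 - 9 * (y 1 * z 5 + y 5 * z 1) + 4 * (y 0 * z 6 + y 6 * z 0),
      -3 * (y 2 * z 5 + y 5 * z 2) + (y 1 * z 6 + y 6 * z 1) + 2 * (y 3 * z 4 + y 4 * z 3)] := rfl

theorem g_isHomogeneous (j : Fin 5 ⊕ Fin 5) : (g j).IsHomogeneous 2 := by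
  have h := g_mem_span_f j
  have : Submodule.span ℂ (Set.range f) ≤ grading (Fin 7) 2 :=
    Submodule.span_le.mpr (Set.range_subset_iff.mpr f_isHomogeneous)
  exact this h

theorem eval_g_apply (y : Fin 7 → ℂ) (j : Fin 5 ⊕ Fin 5) :
    2 * MvPolynomial.eval y (g j) = gPolar y y j := by
  have h (k : Fin 10) := congrFun (eval_g y) k
  simp only [finSumFinEquiv_symm_eq] at h
  rcases j with j | j <;> fin_cases j
  exacts [(congr(2 * $(h 0))).trans (by
     simp only [gPolar_apply, Sum.elim_inl, Fin.zero_eta, Matrix.cons_val]; ring),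
   (congr(2 * $(h 1))).trans (by
     simp only [gPolar_apply, Sum.elim_inl, Fin.mk_one, Matrix.cons_val]; ring),
   (congr(2 * $(h 2))).trans (by
     simp only [gPolar_apply, Sum.elim_inl, Fin.reduceFinMk, Matrix.cons_val]; ring),
   (congr(2 * $(h 3))).trans (by
     simp only [gPolar_apply, Sum.elim_inl, Fin.reduceFinMk, Matrix.cons_val]; ring),
   (congr(2 * $(h 4))).trans (by
     simp only [gPolar_apply, Sum.elim_inl, Fin.reduceFinMk, Matrix.cons_val]; ring),
   (congr(2 * $(h 5))).trans (by
     simp only [gPolar_apply, Sum.elim_inr, Fin.zero_eta, Matrix.cons_val]; ring),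
   (congr(2 * $(h 6))).trans (by
     simp only [gPolar_apply, Sum.elim_inr, Fin.mk_one, Matrix.cons_val]; ring),
   (congr(2 * $(h 7))).trans (by
     simp only [gPolar_apply, Sum.elim_inr, Fin.reduceFinMk, Matrix.cons_val]; ring),
   (congr(2 * $(h 8))).trans (by
     simp only [gPolar_apply, Sum.elim_inr, Fin.reduceFinMk, Matrix.cons_val]; ring),
   (congr(2 * $(h 9))).trans (by
     simp only [gPolar_apply, Sum.elim_inr, Fin.reduceFinMk, Matrix.cons_val]; ring)]

theorem gPolar_comm (y z : Fin 7 → ℂ) : gPolar y z = gPolar z y := by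
  funext j
  rcases j with j | j <;> fin_cases j <;>
    simp only [gPolar_apply, Sum.elim_inl, Sum.elim_inr, Fin.zero_eta, Fin.mk_one, Fin.reduceFinMk,
      Matrix.cons_val] <;> ring

theorem gPolar_smul_left (c : ℂ) (y z : Fin 7 → ℂ) : gPolar (c • y) z = gPolar y (c • z) := by
  rw [gPolar_comm, map_smul, map_smul, gPolar_comm]

/-- The partial derivative of a quadratic form. -/
theorem eval_pderiv_of_isHomogeneous_two {ι : Type} [Fintype ι] [LinearOrder ι]
    {F : MvPolynomial ι ℂ} (hF : F.IsHomogeneous 2) (y : ι → ℂ) (i : ι) :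
    MvPolynomial.eval y (MvPolynomial.pderiv i F) = MvPolynomial.eval (y + Pi.single i 1) F -
      MvPolynomial.eval y F - MvPolynomial.eval (Pi.single i 1) F := by
  obtain ⟨c, -, rfl⟩ := exists_eq_sum_of_isHomogeneous_two hF
  simp only [map_sum, ← Finset.sum_sub_distrib]
  refine Finset.sum_congr rfl fun a _ => Finset.sum_congr rfl fun b _ => ?_
  have hX (a : ι) : MvPolynomial.eval y (MvPolynomial.pderiv i (MvPolynomial.X a)) =
      (Pi.single i 1 : ι → ℂ) a := by
    by_cases h : a = i
    · subst h; simp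
    · rw [MvPolynomial.pderiv_X_of_ne (Ne.symm (Ne.symm h)), Pi.single_eq_of_ne h, map_zero]
  simp only [Derivation.leibniz, MvPolynomial.pderiv_C, smul_eq_mul, mul_zero, add_zero, map_mul,
    map_add, MvPolynomial.eval_C, MvPolynomial.eval_X, hX, Pi.add_apply]
  ring

theorem eval_pderiv_g (y : Fin 7 → ℂ) (i : Fin 7) :
    (fun j => MvPolynomial.eval y (MvPolynomial.pderiv i (g j))) = gPolar y (Pi.single i 1) := by
  funext j
  rw [eval_pderiv_of_isHomogeneous_two (g_isHomogeneous j)]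
  have h1 := eval_g_apply (y + Pi.single i 1) j
  have h2 := eval_g_apply y j
  have h3 := eval_g_apply (Pi.single i 1) j
  rw [map_add, gPolar_comm (y + _), map_add, gPolar_comm (y + _), map_add,
    gPolar_comm (Pi.single i 1) y] at h1
  simp only [Pi.add_apply] at h1
  linear_combination (h1 - h2 - h3) / 2

theorem mukaiSpace_eq_range (y : Fin 7 → ℂ) : mukaiSpace y = LinearMap.range (gPolar y) := by
  rw [LinearMap.range_eq_map, ← (Pi.basisFun ℂ (Fin 7)).span_eq, Submodule.map_span,
    ← Set.range_comp, mukaiSpace]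
  congr 2
  funext i
  rw [Function.comp, Pi.basisFun_apply, eval_pderiv_g]

/-- The Jacobian is linear in y, so its row space depends only on the point [y]. -/
theorem mukaiSpace_smul {c : ℂ} (hc : c ≠ 0) (y : Fin 7 → ℂ) :
    mukaiSpace (c • y) = mukaiSpace y := by
  rw [mukaiSpace_eq_range, mukaiSpace_eq_range]
  apply le_antisymm
  · rintro _ ⟨z, rfl⟩
    exact ⟨c • z, (gPolar_smul_left c y z).symm⟩
  · rintro _ ⟨z, rfl⟩
    exact ⟨c⁻¹ • z, by rw [gPolar_smul_left, smul_inv_smul₀ hc]⟩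

theorem eval_Q (u : V) : MvPolynomial.eval u Q = ∑ i : Fin 5, u (.inl i) * u (.inr i) := by
  simp [Q]

/-- `Q` vanishes on the space of a zero of the quadrics `g_j`. -/
theorem eval_Q_gPolar {y : Fin 7 → ℂ} (hy : gPolar y y = 0) (z : Fin 7 → ℂ) :
    MvPolynomial.eval (gPolar y z) Q = 0 := by
  -- The coefficient of s² in the identity Q(g(y + s z)) = 0; the factor 4 appears because B(y, y) =
  -- 2 g(y).
  have key : 4 * ∑ i : Fin 5, gPolar y z (.inl i) * gPolar y z (.inr i) =
      -∑ i : Fin 5, (gPolar y y (.inl i) * gPolar z z (.inr i) +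
        gPolar y y (.inr i) * gPolar z z (.inl i)) := by
    simp only [Fin.sum_univ_five, gPolar_apply, Sum.elim_inl, Sum.elim_inr, Matrix.cons_val]
    ring
  simp only [hy, Pi.zero_apply, zero_mul, add_zero, Finset.sum_const_zero, neg_zero] at key
  rw [eval_Q]
  simpa using key

/-- The coefficients of Mukai's map. -/
def spinorCoef : Fin 16 → ℂ :=
  ![-150, -30, 0, -75, -30, 50, 0, -30, -150, -90, -120, -5, -8, -9, 15, 10]

/-- The indices of the variables in Mukai's map. -/
def spinorIdx : Fin 16 → Fin 7 := ![0, 2, 0, 3, 4, 4, 0, 5, 5, 6, 6, 0, 1, 1, 2, 3]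

/-- The coordinates of the half spinor of Mukai's space. -/
def spinorPoint (y : Fin 7 → ℂ) : Fin 16 → ℂ := fun k => spinorCoef k * y (spinorIdx k)

theorem cliffordCoord_gPolar {y : Fin 7 → ℂ} (hy : gPolar y y = 0) (z : Fin 7 → ℂ) :
    cliffordCoord (gPolar y z) (spinorPoint y) = 0 := by
  -- The polarization of the cubic identity φ_{g(y)}(S(y)) = 0, whose coordinates are sixteen linear
  -- syzygies of the g_j. At a zero of g the right-hand side is φ_0 = 0.
  have key (k : Fin 16) : 2 * cliffordCoord (gPolar y z) (spinorPoint y) k =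
      -cliffordCoord (gPolar y y) (spinorPoint z) k := by
    fin_cases k <;>
      simp only [cliffordCoord, gPolar_apply, spinorPoint, spinorCoef, spinorIdx, Sum.elim_inl,
        Sum.elim_inr, Fin.zero_eta, Fin.mk_one, Fin.reduceFinMk, Matrix.cons_val] <;> ring
  have h0 (x) : cliffordCoord 0 x = 0 := by
    funext k
    fin_cases k <;> simp [cliffordCoord]
  funext k
  have := key k
  rw [hy, h0] at this
  simpa using this

theorem spinorPoint_mem_halfSpinors {y : Fin 7 → ℂ} (hy : gPolar y y = 0) :
    spinorPoint y ∈ halfSpinors (mukaiSpace y) := by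
  rw [mem_halfSpinors_iff, mukaiSpace_eq_range]
  rintro _ ⟨z, rfl⟩
  exact cliffordCoord_gPolar hy z

/-- The quadrics through OG(5,10), restricted to P_cusp, are 150 times the g_j. This is what makes
the intersection equal to the curve as a scheme. -/
theorem spinorQ_spinorPoint (y : Fin 7 → ℂ) (j : Fin 5 ⊕ Fin 5) :
    spinorQ (spinorPoint y) j = 75 * gPolar y y j := by
  rcases j with j | j <;> fin_cases j <;>
    simp only [spinorQ, gPolar_apply, spinorPoint, spinorCoef, spinorIdx, Sum.elim_inl,
      Sum.elim_inr, Fin.zero_eta, Fin.mk_one, Fin.reduceFinMk, Matrix.cons_val] <;> ring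

/-! ### The embedding -/

/-- The linear forms defining Mukai's map. -/
def spinorForms (k : Fin 16) : MvPolynomial (Fin 7) ℂ :=
  MvPolynomial.C (spinorCoef k) * MvPolynomial.X (spinorIdx k)

theorem spinorForms_isHomogeneous (k : Fin 16) : (spinorForms k).IsHomogeneous 1 :=
  MvPolynomial.isHomogeneous_C_mul_X _ _

theorem eval_spinorForms (y : Fin 7 → ℂ) :
    (fun k => MvPolynomial.eval y (spinorForms k)) = spinorPoint y := by
  funext k
  simp [spinorForms, spinorPoint]

/-- Indices of coordinates of `ℙ¹⁵` which restrict to multiples of `y_0, …, y_6`. -/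
def sectionIdx : Fin 7 → Fin 16 := ![11, 13, 14, 15, 5, 8, 10]

theorem spinorIdx_sectionIdx (j : Fin 7) : spinorIdx (sectionIdx j) = j := by
  fin_cases j <;> rfl

theorem spinorCoef_sectionIdx_ne_zero (j : Fin 7) : spinorCoef (sectionIdx j) ≠ 0 := by
  fin_cases j <;> simp only [spinorCoef, sectionIdx, Fin.zero_eta, Fin.mk_one, Fin.reduceFinMk,
    Matrix.cons_val] <;> norm_num

/-- Linear forms on `ℙ¹⁵` which restrict to `y_0, …, y_6`. -/
def sectionForms (j : Fin 7) : MvPolynomial (Fin 16) ℂ :=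
  MvPolynomial.C (spinorCoef (sectionIdx j))⁻¹ * MvPolynomial.X (sectionIdx j)

theorem sectionForms_isHomogeneous (j : Fin 7) : (sectionForms j).IsHomogeneous 1 :=
  MvPolynomial.isHomogeneous_C_mul_X _ _

theorem aeval_sectionForms (j : Fin 7) :
    MvPolynomial.aeval spinorForms (sectionForms j) = MvPolynomial.X j := by
  rw [sectionForms, map_mul, MvPolynomial.aeval_X, spinorForms, MvPolynomial.aeval_C,
    spinorIdx_sectionIdx, MvPolynomial.algebraMap_eq, ← mul_assoc, ← map_mul,
    inv_mul_cancel₀ (spinorCoef_sectionIdx_ne_zero j), map_one, one_mul]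

theorem X_mem_span_spinorForms (j : Fin 7) :
    MvPolynomial.X j ∈ Ideal.span (Set.range spinorForms) := by
  have : MvPolynomial.X j =
      MvPolynomial.C (spinorCoef (sectionIdx j))⁻¹ * spinorForms (sectionIdx j) := by
    rw [← aeval_sectionForms j, sectionForms, map_mul, MvPolynomial.aeval_X, MvPolynomial.aeval_C]
    rfl
  rw [this]
  exact Ideal.mul_mem_left _ _ (Ideal.subset_span (Set.mem_range_self _))

theorem spinorPoint_ne_zero {y : Fin 7 → ℂ} (hy : y ≠ 0) : spinorPoint y ≠ 0 := by
  obtain ⟨j, hj⟩ := Function.ne_iff.mp hy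
  refine Function.ne_iff.mpr ⟨sectionIdx j, ?_⟩
  rw [spinorPoint, spinorIdx_sectionIdx]
  exact mul_ne_zero (spinorCoef_sectionIdx_ne_zero j) hj

/-- The linear embedding `ℙ⁶ ⟶ ℙ¹⁵` which restricts to Mukai's map. -/
def spinorEmbedding : PSpace (Fin 7) ⟶ PSpace (Fin 16) :=
  Proj.map (linearSubst spinorForms spinorForms_isHomogeneous)
    (irrelevant_le_map_linearSubst' _ _ X_mem_span_spinorForms)

theorem isClosedImmersion_spinorEmbedding : IsClosedImmersion spinorEmbedding :=
  isClosedImmersion_map _ _ _ fun j => ⟨_, sectionForms_isHomogeneous j, aeval_sectionForms j⟩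

theorem spinorEmbedding_toSpecC :
    spinorEmbedding ≫ PSpace.toSpecC (Fin 16) = PSpace.toSpecC (Fin 7) :=
  map_toSpecC _ _ _

theorem spinorEmbedding_point (y : Fin 7 → ℂ) (hy : y ≠ 0) :
    spinorEmbedding (point y hy) = point (spinorPoint y) (spinorPoint_ne_zero hy) := by
  have := map_point spinorForms spinorForms_isHomogeneous
    (irrelevant_le_map_linearSubst' _ _ X_mem_span_spinorForms) y hy
    (by rw [eval_spinorForms]; exact spinorPoint_ne_zero hy)
  simp only [eval_spinorForms] at this
  exact this

/-- Mukai's embedding of the curve. -/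
def mukaiMap : cuspCurve ⟶ PSpace (Fin 16) := cuspCurve.incl ≫ spinorEmbedding

theorem isClosedImmersion_mukaiMap : IsClosedImmersion mukaiMap := by
  have h1 : IsClosedImmersion cuspCurve.incl :=
    (inferInstance : IsClosedImmersion cuspIdeal.subschemeι)
  have h2 := isClosedImmersion_spinorEmbedding
  exact (inferInstance : IsClosedImmersion (cuspCurve.incl ≫ spinorEmbedding))

theorem mukaiMap_toSpecC : mukaiMap ≫ PSpace.toSpecC (Fin 16) = cuspCurve.toSpecC := by
  rw [mukaiMap, Category.assoc, spinorEmbedding_toSpecC, cuspCurve.toSpecC]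

/-- The curve is reduced, so the scheme-theoretic image is the reduced closure of the images of its
parametrized points. -/
theorem ker_mukaiMap : mukaiMap.ker = reducedIdealSheaf (spinorPoint '' curvePoints) := by
  have h1 : cuspCurve.incl.ker = cuspIdeal := cuspIdeal.ker_subschemeι
  rw [mukaiMap, ← Scheme.IdealSheafData.map_ker, h1, cuspIdeal_eq, spinorEmbedding,
    map_reducedIdealSheaf _ _ _ _ fun v hv => by
      rw [eval_spinorForms]; exact spinorPoint_ne_zero hv]
  simp only [eval_spinorForms]

/-! ### The intersection of the linear space and the orthogonal Grassmannian -/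

theorem spinorPoint_mem_span (y : Fin 7 → ℂ) :
    spinorPoint y ∈ Submodule.span ℂ (Set.range cuspMatrix.row) := by
  -- The coefficients are the coordinates of S(y) at the pivots of M_cusp, the columns listed in
  -- `sectionIdx`.
  have h : spinorPoint y = (50 * y 4) • cuspMatrix.row 0 + (-150 * y 5) • cuspMatrix.row 1 +
      (-120 * y 6) • cuspMatrix.row 2 + (-5 * y 0) • cuspMatrix.row 3 +
      (-9 * y 1) • cuspMatrix.row 4 + (15 * y 2) • cuspMatrix.row 5 +
      (10 * y 3) • cuspMatrix.row 6 := by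
    funext k
    simp only [Pi.add_apply, Pi.smul_apply, smul_eq_mul, Matrix.row]
    fin_cases k <;> simp [spinorPoint, spinorCoef, spinorIdx, cuspMatrix] <;> ring
  have hr (i : Fin 7) (c : ℂ) :
      c • cuspMatrix.row i ∈ Submodule.span ℂ (Set.range cuspMatrix.row) :=
    Submodule.smul_mem _ _ (Submodule.subset_span (Set.mem_range_self i))
  rw [h]
  exact add_mem (add_mem (add_mem (add_mem (add_mem (add_mem (hr _ _) (hr _ _)) (hr _ _)) (hr _ _))
    (hr _ _)) (hr _ _)) (hr _ _)

/-- Linear equations of P_cusp: each coordinate is a fixed multiple of a pivot coordinate, as can be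
checked on the rows. -/
theorem apply_eq_of_mem_span {x : Fin 16 → ℂ}
    (hx : x ∈ Submodule.span ℂ (Set.range cuspMatrix.row)) (k : Fin 16) :
    x k = spinorCoef k * (spinorCoef (sectionIdx (spinorIdx k)))⁻¹ *
      x (sectionIdx (spinorIdx k)) := by
  induction hx using Submodule.span_induction with
  | mem x hx =>
    obtain ⟨i, rfl⟩ := hx
    rw [Matrix.row]
    fin_cases i <;> fin_cases k <;>
      simp only [cuspMatrix, spinorCoef, sectionIdx, spinorIdx, Fin.zero_eta, Fin.mk_one,
        Fin.reduceFinMk, Matrix.of_apply, Matrix.cons_val] <;> norm_num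
  | zero => simp
  | add a b _ _ ha hb =>
    rw [Pi.add_apply, Pi.add_apply, mul_add, ← ha, ← hb]
  | smul c a _ ha =>
    rw [Pi.smul_apply, Pi.smul_apply, smul_eq_mul, smul_eq_mul, ha]
    ring

/-- Modulo the linear equations of P_cusp a form on ℙ¹⁵ becomes a form in y_0, …, y_6, and modulo
the quadrics through OG(5,10) the g_j die. A form vanishing on the image lands in (f) = (g), after
multiplication by x_k. -/
theorem ker_mukaiMap_le : mukaiMap.ker ≤ cuspLinearSpace ⊔ orthogonalGrassmannian := by
  rw [ker_mukaiMap]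
  refine Scheme.IdealSheafData.le_of_iSup_eq_top chart (iSup_chart _) fun k z hz => ?_
  obtain ⟨n, F, hF, rfl⟩ := exists_eq_dehomog k z
  rw [dehomog_mem_reducedIdealSheaf _ _ hF] at hz
  rw [Scheme.IdealSheafData.ideal_sup]
  let I : Ideal (MvPolynomial (Fin 16) ℂ) :=
    ((cuspLinearSpace.ideal ⊔ orthogonalGrassmannian.ideal) (chart k)).comap (dehomog k)
  suffices h : MvPolynomial.X k * F ∈ I by
    rw [Ideal.mem_comap, map_mul, dehomog_X_self, one_mul] at h
    exact h
  -- Substituting `spinorForms`, then `sectionForms`, replaces each coordinate by its expression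
  -- through the pivots; the difference vanishes on P_cusp.
  have hlin (i : Fin 16) : (MvPolynomial.X i : MvPolynomial (Fin 16) ℂ) -
      MvPolynomial.aeval sectionForms (MvPolynomial.aeval spinorForms
        (MvPolynomial.X i : MvPolynomial (Fin 16) ℂ)) ∈ I := by
    refine Ideal.mem_sup_left ?_
    have hh : ((MvPolynomial.X i : MvPolynomial (Fin 16) ℂ) - MvPolynomial.aeval sectionForms
        (MvPolynomial.aeval spinorForms
          (MvPolynomial.X i : MvPolynomial (Fin 16) ℂ))).IsHomogeneous 1 := by
      refine (MvPolynomial.isHomogeneous_X ℂ i).sub ?_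
      exact (linearSubst sectionForms sectionForms_isHomogeneous).map_mem
        ((linearSubst spinorForms spinorForms_isHomogeneous).map_mem (X_mem_grading i))
    rw [cuspLinearSpace, dehomog_mem_reducedIdealSheaf _ _ hh]
    intro x hx _
    rw [MvPolynomial.aeval_X, spinorForms, map_mul, MvPolynomial.aeval_X, MvPolynomial.aeval_C,
      sectionForms, MvPolynomial.algebraMap_eq]
    simp only [map_sub, map_mul, MvPolynomial.eval_X, MvPolynomial.eval_C]
    rw [sub_eq_zero, ← mul_assoc]
    exact apply_eq_of_mem_span hx i
  have hred (G : MvPolynomial (Fin 16) ℂ) :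
      G - MvPolynomial.aeval sectionForms (MvPolynomial.aeval spinorForms G) ∈ I := by
    induction G using MvPolynomial.induction_on with
    | C a => simp
    | add p q hp hq =>
      have := add_mem hp hq
      rw [map_add, map_add]
      convert this using 1
      ring
    | mul_X p i hp =>
      have := add_mem (Ideal.mul_mem_right (MvPolynomial.X i) _ hp) (Ideal.mul_mem_left _
        (MvPolynomial.aeval sectionForms (MvPolynomial.aeval spinorForms p)) (hlin i))
      rw [map_mul, map_mul]
      convert this using 1
      ring
  have hquad (j) : spinorQuadric j ∈ I := by
    refine Ideal.mem_sup_right ?_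
    rw [orthogonalGrassmannian, dehomog_mem_reducedIdealSheaf _ _ (spinorQuadric_isHomogeneous j)]
    rintro x ⟨W, hW, hx⟩ -
    rw [eval_spinorQuadric, spinorQ_eq_zero (by rw [hW.1]; norm_num) hx, Pi.zero_apply]
  have hg (j) : MvPolynomial.aeval sectionForms (g j) ∈ I := by
    have h1 : MvPolynomial.aeval spinorForms (spinorQuadric j) = MvPolynomial.C 150 * g j := by
      refine MvPolynomial.funext fun y => ?_
      rw [eval_aeval, eval_spinorForms, eval_spinorQuadric, spinorQ_spinorPoint, ← eval_g_apply,
        map_mul, MvPolynomial.eval_C]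
      ring
    have h2 := sub_mem (hquad j) (hred (spinorQuadric j))
    rw [sub_sub_cancel, h1, map_mul, MvPolynomial.aeval_C] at h2
    have h3 := Ideal.mul_mem_left _ (MvPolynomial.C (150 : ℂ)⁻¹) h2
    rwa [MvPolynomial.algebraMap_eq, ← mul_assoc, ← map_mul, inv_mul_cancel₀ (by norm_num), map_one,
      one_mul] at h3
  have hf : Ideal.span (Set.range f) ≤ I.comap (MvPolynomial.aeval sectionForms) := by
    rw [Ideal.span_le, Set.range_subset_iff]
    intro j
    have : Submodule.span ℂ (Set.range g) ≤
        (I.comap (MvPolynomial.aeval sectionForms)).restrictScalars ℂ :=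
      Submodule.span_le.mpr (Set.range_subset_iff.mpr hg)
    exact this (f_mem_span_g j)
  -- x_k restricts to a multiple of one variable, possibly zero; the criterion allows any linear
  -- form as the localizing factor.
  have hX : MvPolynomial.aeval spinorForms (MvPolynomial.X k * F) ∈ Ideal.span (Set.range f) := by
    have hF' : (MvPolynomial.aeval spinorForms F).IsHomogeneous n :=
      (linearSubst spinorForms spinorForms_isHomogeneous).map_mem hF
    rw [map_mul, MvPolynomial.aeval_X, ← forall_curvePoints_iff hF' (spinorForms_isHomogeneous k)]
    intro v hv hne
    rw [eval_aeval, eval_spinorForms]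
    refine hz _ ⟨v, hv, rfl⟩ ?_
    rwa [← eval_spinorForms]
  have := add_mem (hred (MvPolynomial.X k * F)) (hf hX)
  rwa [sub_add_cancel] at this

/-! ### Lagrangians and their half spinors -/

/-- An isotropic subspace which projects onto a coordinate Lagrangian is a Lagrangian. -/
theorem isLagrangian_of_forall_exists {W : Submodule ℂ V} {p q : Fin 5 → Fin 5 ⊕ Fin 5}
    (hQ : ∀ u : V, MvPolynomial.eval u Q = ∑ i, u (p i) * u (q i))
    (hpq : ∀ j, (∃ i, j = p i) ∨ ∃ i, j = q i) (hW : ∀ w ∈ W, MvPolynomial.eval w Q = 0)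
    (h : ∀ v : Fin 5 → ℂ, ∃ u ∈ W, ∀ j, u (p j) = v j) : IsLagrangian W := by
  refine ⟨?_, hW⟩
  let π : W →ₗ[ℂ] (Fin 5 → ℂ) := LinearMap.funLeft ℂ ℂ p ∘ₗ W.subtype
  have hinj : Function.Injective π := by
    rw [← LinearMap.ker_eq_bot, LinearMap.ker_eq_bot']
    rintro ⟨u, hu⟩ h0
    have h0' (i) : u (p i) = 0 := congrFun h0 i
    -- If the p-coordinates of u vanish and those of w are the i-th unit vector, then Q(u + w) -
    -- Q(w) is exactly u (q i).
    have hq (i) : u (q i) = 0 := by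
      obtain ⟨w, hw, hwi⟩ := h (Pi.single i 1)
      have h1 := hW _ (add_mem hu hw)
      have h2 := hW _ hw
      rw [hQ] at h1 h2
      simp only [Pi.add_apply, h0', hwi, zero_add, mul_add, Finset.sum_add_distrib] at h1 h2
      rw [h2, add_zero] at h1
      simpa [Pi.single_apply] using h1
    ext j
    rcases hpq j with ⟨i, rfl⟩ | ⟨i, rfl⟩
    exacts [h0' i, hq i]
  have hsurj : Function.Surjective π := fun v => by
    obtain ⟨u, hu, huv⟩ := h v
    exact ⟨⟨u, hu⟩, funext huv⟩
  rw [(LinearEquiv.ofBijective π ⟨hinj, hsurj⟩).finrank_eq]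
  simp

/-- A half spinor of the graph of a map `⟨e_{-1}, …, e_{-5}⟩ → U_∞` is determined by its first
coordinate. -/
theorem eq_zero_of_mem_halfSpinors {W : Submodule ℂ V}
    (h : ∀ v : Fin 5 → ℂ, ∃ u ∈ W, ∀ j, u (.inl j) = v j) {x : Fin 16 → ℂ}
    (hx : x ∈ halfSpinors W) (h0 : x 0 = 0) : x = 0 := by
  rw [mem_halfSpinors_iff] at hx
  have key (i : Fin 5) : ∃ u : V, (∀ j, u (.inl j) = (Pi.single i 1 : Fin 5 → ℂ) j) ∧
      cliffordCoord u x = 0 := by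
    obtain ⟨u, hu, h1⟩ := h (Pi.single i 1)
    exact ⟨u, h1, hx u hu⟩
  obtain ⟨u0, a0, c0⟩ := key 0
  obtain ⟨u1, a1, c1⟩ := key 1
  obtain ⟨u2, a2, c2⟩ := key 2
  obtain ⟨u3, a3, c3⟩ := key 3
  have d01 := congrFun c0 1
  have d02 := congrFun c0 2
  have d03 := congrFun c0 3
  have d04 := congrFun c0 4
  have d12 := congrFun c1 2
  have d13 := congrFun c1 3
  have d14 := congrFun c1 4
  have d23 := congrFun c2 3
  have d24 := congrFun c2 4
  have d34 := congrFun c3 4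
  -- With zero scalar part, the degree 1 part of φ_u(x) is the contraction of the degree 2 part of
  -- x, so that part vanishes. The degree 3 equations below then kill the degree 4 part in the same
  -- way.
  simp [cliffordCoord, a0, a1, a2, a3, h0] at d01 d02 d03 d04 d12 d13 d14 d23 d24 d34
  have q0 := congrFun c0 11
  have q1 := congrFun c0 12
  have q2 := congrFun c0 13
  have q3 := congrFun c0 14
  have q4 := congrFun c1 14
  simp [cliffordCoord, a0, a1, d01, d02, d03, d04, d12, d13, d14, d23, d24, d34]
    at q0 q1 q2 q3 q4
  funext k
  fin_cases k <;> simpa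

/-- Uniqueness up to scalars follows once a single coordinate is injective on the half spinors. -/
theorem halfSpinors_eq_span {W : Submodule ℂ V} {s : Fin 16 → ℂ} (hs : s ∈ halfSpinors W)
    {k : Fin 16} (hk : s k ≠ 0) (h : ∀ x ∈ halfSpinors W, x k = 0 → x = 0) :
    halfSpinors W = Submodule.span ℂ {s} := by
  refine le_antisymm (fun x hx => ?_) ((Submodule.span_singleton_le_iff_mem _ _).mpr hs)
  refine Submodule.mem_span_singleton.mpr ⟨x k / s k, ?_⟩
  refine (sub_eq_zero.mp (h _ (sub_mem hx (Submodule.smul_mem _ (x k / s k) hs)) ?_)).symm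
  rw [Pi.sub_apply, Pi.smul_apply, smul_eq_mul, div_mul_cancel₀ _ hk, sub_self]

/-! ### Mukai's spaces at the points of the curve -/

theorem gPolar_self_eq_zero {y : Fin 7 → ℂ} (hy : ∀ j, MvPolynomial.eval y (f j) = 0) :
    gPolar y y = 0 := by
  have h : Submodule.span ℂ (Set.range f) ≤
      (LinearMap.ker (MvPolynomial.aeval (R := ℂ) y).toLinearMap) := by
    rw [Submodule.span_le, Set.range_subset_iff]
    exact hy
  funext j
  rw [← eval_g_apply, show MvPolynomial.eval y (g j) = 0 from h (g_mem_span_f j), mul_zero,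
    Pi.zero_apply]

theorem eval_curvePoint_f (t : ℂ) (j : Fin 10) :
    MvPolynomial.eval (fun i => (curvePoly i).eval t) (f j) = 0 := by
  rw [← eval_aeval_curvePoly, aeval_curvePoly_f, Polynomial.eval_zero]

/-- Inverts the 5 × 5 block of the Jacobian with z_0 = z_1 = 0 and values in the coordinates e_{-1},
…, e_{-5}, denominators cleared. The factor 52920 t^7 (1 - t^7)^3 explains why t = 0 and the cusps
are left out of `curvePoints`. -/
theorem exists_gPolar_eq (t : ℂ) (v : Fin 5 → ℂ) : ∃ z, ∀ j : Fin 5,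
    gPolar (fun i => (curvePoly i).eval t) z (.inl j) = 52920 * t ^ 7 * (1 - t ^ 7) ^ 3 * v j := by
  refine ⟨![0, 0,
      (1452 + 6816 * t ^ 7 + 18027 * t ^ 14 + 9720 * t ^ 21) * v 0 +
        (1788 * t ^ 1 + 4534 * t ^ 8 + 13008 * t ^ 15 + 4680 * t ^ 22) * v 1 +
        (6352 * t ^ 2 + 24456 * t ^ 9 + 55512 * t ^ 16 + 9720 * t ^ 23) * v 2 +
        (8721 * t ^ 2 + 22788 * t ^ 9 + 67176 * t ^ 16 + 9360 * t ^ 23) * v 3 +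
        (1080 * t ^ 3 - 3240 * t ^ 10 + 3240 * t ^ 17 - 1080 * t ^ 24) * v 4,
      (4356 * t ^ 1 + 22212 * t ^ 8 + 41292 * t ^ 15 + 18576 * t ^ 22) * v 0 +
        (4608 * t ^ 2 + 16752 * t ^ 9 + 26760 * t ^ 16 + 9504 * t ^ 23) * v 1 +
        (19056 * t ^ 3 + 79248 * t ^ 10 + 113616 * t ^ 17 + 18576 * t ^ 24) * v 2 +
        (23328 * t ^ 3 + 83484 * t ^ 10 + 133488 * t ^ 17 + 19008 * t ^ 24) * v 3 +
        (1728 * t ^ 4 - 5184 * t ^ 11 + 5184 * t ^ 18 - 1728 * t ^ 25) * v 4,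
      (9720 * t ^ 2 + 39636 * t ^ 9 + 58266 * t ^ 16 + 22032 * t ^ 23) * v 0 +
        (9720 * t ^ 3 + 29052 * t ^ 10 + 36216 * t ^ 17 + 11448 * t ^ 24) * v 1 +
        (41472 * t ^ 4 + 136656 * t ^ 11 + 145584 * t ^ 18 + 22032 * t ^ 25) * v 2 +
        (48546 * t ^ 4 + 148068 * t ^ 11 + 169452 * t ^ 18 + 22896 * t ^ 25) * v 3 +
        (1944 * t ^ 5 - 5832 * t ^ 12 + 5832 * t ^ 19 - 1944 * t ^ 26) * v 4,
      (15780 * t ^ 3 + 50268 * t ^ 10 + 57924 * t ^ 17 + 20088 * t ^ 24) * v 0 +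
        (15360 * t ^ 4 + 34672 * t ^ 11 + 35496 * t ^ 18 + 10512 * t ^ 25) * v 1 +
        (67720 * t ^ 5 + 159048 * t ^ 12 + 137304 * t ^ 19 + 20088 * t ^ 26) * v 2 +
        (77760 * t ^ 5 + 174204 * t ^ 12 + 159192 * t ^ 19 + 21024 * t ^ 26) * v 3 +
        (1728 * t ^ 6 - 5184 * t ^ 13 + 5184 * t ^ 20 - 1728 * t ^ 27) * v 4,
      (17244 * t ^ 4 + 39996 * t ^ 11 + 38061 * t ^ 18 + 12744 * t ^ 25) * v 0 +
        (16236 * t ^ 5 + 25674 * t ^ 12 + 23424 * t ^ 19 + 6696 * t ^ 26) * v 1 +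
        (73104 * t ^ 6 + 113496 * t ^ 13 + 88776 * t ^ 20 + 12744 * t ^ 27) * v 2 +
        (83187 * t ^ 6 + 124848 * t ^ 13 + 102708 * t ^ 20 + 13392 * t ^ 27) * v 3 +
        (1080 * t ^ 7 - 3240 * t ^ 14 + 3240 * t ^ 21 - 1080 * t ^ 28) * v 4], fun j => ?_⟩
  fin_cases j <;>
    simp only [gPolar_apply, curvePoly, Sum.elim_inl, Fin.zero_eta, Fin.mk_one, Fin.reduceFinMk,
      Matrix.cons_val, Polynomial.eval_add, Polynomial.eval_mul, Polynomial.eval_pow,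
      Polynomial.eval_X, Polynomial.eval_one, Polynomial.eval_ofNat] <;> ring

theorem exists_mem_mukaiSpace_curvePoint {t : ℂ} (ht : t ≠ 0) (ht' : t ^ 7 ≠ 1)
    (v : Fin 5 → ℂ) :
    ∃ u ∈ mukaiSpace (fun i => (curvePoly i).eval t), ∀ j, u (.inl j) = v j := by
  have hD : 52920 * t ^ 7 * (1 - t ^ 7) ^ 3 ≠ 0 :=
    mul_ne_zero (mul_ne_zero (by norm_num) (pow_ne_zero _ ht))
      (pow_ne_zero _ (sub_ne_zero.mpr ht'.symm))
  obtain ⟨z, hz⟩ := exists_gPolar_eq t v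
  refine ⟨(52920 * t ^ 7 * (1 - t ^ 7) ^ 3)⁻¹ • gPolar (fun i => (curvePoly i).eval t) z, ?_,
    fun j => ?_⟩
  · rw [mukaiSpace_eq_range]
    exact Submodule.smul_mem _ _ (LinearMap.mem_range_self _ z)
  · rw [Pi.smul_apply, hz, smul_eq_mul, inv_mul_cancel_left₀ hD]

/-- Mukai's space is a Lagrangian, whose half spinors are the multiples of the given one. -/
def HasMukaiSpinor (y : Fin 7 → ℂ) : Prop :=
  IsLagrangian (mukaiSpace y) ∧ halfSpinors (mukaiSpace y) = Submodule.span ℂ {spinorPoint y}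

theorem HasMukaiSpinor.smul {y : Fin 7 → ℂ} (h : HasMukaiSpinor y) {c : ℂ} (hc : c ≠ 0) :
    HasMukaiSpinor (c • y) := by
  have : spinorPoint (c • y) = c • spinorPoint y := by
    funext k
    simp only [spinorPoint, Pi.smul_apply, smul_eq_mul]
    ring
  rw [HasMukaiSpinor, mukaiSpace_smul hc, this, Submodule.span_singleton_smul_eq hc.isUnit]
  exact h

theorem hasMukaiSpinor_curvePoint {t : ℂ} (ht : t ≠ 0) (ht' : t ^ 7 ≠ 1) :
    HasMukaiSpinor (fun i => (curvePoly i).eval t) := by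
  have h0 := gPolar_self_eq_zero (eval_curvePoint_f t)
  have hW := exists_mem_mukaiSpace_curvePoint ht ht'
  constructor
  · refine isLagrangian_of_forall_exists (p := .inl) (q := .inr) eval_Q ?_ ?_ hW
    · rintro (j | j)
      exacts [.inl ⟨j, rfl⟩, .inr ⟨j, rfl⟩]
    · rw [mukaiSpace_eq_range]
      rintro _ ⟨z, rfl⟩
      exact eval_Q_gPolar h0 z
  -- The scalar part of S(y) is -150 y_0 = -1050 t^6, nonzero since t ≠ 0.
  · refine halfSpinors_eq_span (spinorPoint_mem_halfSpinors h0) (k := 0) ?_ fun x hx =>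
      eq_zero_of_mem_halfSpinors hW hx
    simp [spinorPoint, spinorCoef, spinorIdx, curvePoly, ht]

theorem hasMukaiSpinor_single_one : HasMukaiSpinor (Pi.single 1 1) := by
  have h0 : gPolar (Pi.single 1 1) (Pi.single 1 1) = 0 := by
    funext j
    rcases j with j | j <;> fin_cases j <;> simp [gPolar_apply]
  constructor
  -- The point t = 0. Here y_0 = 0 and the spinor has no scalar part, so another coordinate
  -- Lagrangian is needed, and below a coordinate of S which involves y_1.
  · refine isLagrangian_of_forall_exists (p := ![.inr 0, .inr 1, .inl 2, .inr 3, .inr 4])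
      (q := ![.inl 0, .inl 1, .inr 2, .inl 3, .inl 4]) ?_ ?_ ?_ fun v =>
      ⟨_, mukaiSpace_eq_range _ ▸ LinearMap.mem_range_self _
        ![v 2 / 9, 0, 0, -v 0 / 4, -v 1 / 3, -v 3 / 9, v 4], ?_⟩
    · intro u
      simp only [eval_Q, Fin.sum_univ_five, Matrix.cons_val]
      ring
    · rintro (j | j) <;> fin_cases j
      exacts [.inr ⟨0, rfl⟩, .inr ⟨1, rfl⟩, .inl ⟨2, rfl⟩, .inr ⟨3, rfl⟩, .inr ⟨4, rfl⟩,
        .inl ⟨0, rfl⟩, .inl ⟨1, rfl⟩, .inr ⟨2, rfl⟩, .inl ⟨3, rfl⟩, .inl ⟨4, rfl⟩]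
    · rw [mukaiSpace_eq_range]
      rintro _ ⟨z, rfl⟩
      exact eval_Q_gPolar h0 z
    · intro j
      fin_cases j <;> simp [gPolar_apply] <;> ring
  · refine halfSpinors_eq_span (spinorPoint_mem_halfSpinors h0) (k := 12) ?_ fun x hx hx0 => ?_
    · simp [spinorPoint, spinorCoef, spinorIdx]
    · rw [mem_halfSpinors_iff, mukaiSpace_eq_range] at hx
      have key (i : Fin 7) := hx _ (LinearMap.mem_range_self _ (Pi.single i 1))
      have k0 := key 0
      have k3 := key 3
      have k4 := key 4
      have k6 := key 6
      simp [funext_iff, Fin.forall_fin_succ, cliffordCoord, gPolar_apply] at k0 k3 k4 k6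
      have k13 : x 13 = 0 := by linear_combination (-1 / 8) * k0.2.2.2.2.2.1 + 9 / 8 * hx0
      funext k
      fin_cases k <;> simp [*]

theorem hasMukaiSpinor_single_six : HasMukaiSpinor (Pi.single 6 1) := by
  have h0 : gPolar (Pi.single 6 1) (Pi.single 6 1) = 0 := by
    funext j
    rcases j with j | j <;> fin_cases j <;> simp [gPolar_apply]
  constructor
  -- The point t = ∞, where only y_6 is nonzero; uniqueness below uses the coordinate -90 y_6 of S.
  · refine isLagrangian_of_forall_exists (p := ![.inl 0, .inl 1, .inl 2, .inr 3, .inr 4])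
      (q := ![.inr 0, .inr 1, .inr 2, .inl 3, .inl 4]) ?_ ?_ ?_ fun v =>
      ⟨_, mukaiSpace_eq_range _ ▸ LinearMap.mem_range_self _
        ![v 3 / 4, v 4, -v 2 / 24, -v 1 / 45, v 0 / 40, 0, 0], ?_⟩
    · intro u
      simp only [eval_Q, Fin.sum_univ_five, Matrix.cons_val]
      ring
    · rintro (j | j) <;> fin_cases j
      exacts [.inl ⟨0, rfl⟩, .inl ⟨1, rfl⟩, .inl ⟨2, rfl⟩, .inr ⟨3, rfl⟩, .inr ⟨4, rfl⟩,
        .inr ⟨0, rfl⟩, .inr ⟨1, rfl⟩, .inr ⟨2, rfl⟩, .inl ⟨3, rfl⟩, .inl ⟨4, rfl⟩]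
    · rw [mukaiSpace_eq_range]
      rintro _ ⟨z, rfl⟩
      exact eval_Q_gPolar h0 z
    · intro j
      fin_cases j <;> simp [gPolar_apply] <;> ring
  · refine halfSpinors_eq_span (spinorPoint_mem_halfSpinors h0) (k := 9) ?_ fun x hx hx0 => ?_
    · simp [spinorPoint, spinorCoef, spinorIdx]
    · rw [mem_halfSpinors_iff, mukaiSpace_eq_range] at hx
      have key (i : Fin 7) := hx _ (LinearMap.mem_range_self _ (Pi.single i 1))
      have k0 := key 0
      have k1 := key 1
      have k2 := key 2
      have k3 := key 3
      have k4 := key 4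
      simp [funext_iff, Fin.forall_fin_succ, cliffordCoord, gPolar_apply] at k0 k1 k2 k3 k4
      have k10 : x 10 = 0 := by linear_combination k0.2.2.2.2.2.2.1 / 3 + 4 / 3 * hx0
      funext k
      fin_cases k <;> simp [*]

theorem ker_mukaiMap_eq : mukaiMap.ker = cuspLinearSpace ⊔ orthogonalGrassmannian := by
  refine le_antisymm ker_mukaiMap_le ?_
  rw [ker_mukaiMap]
  refine sup_le (reducedIdealSheaf_anti ?_) (reducedIdealSheaf_anti ?_)
  · rintro _ ⟨y, -, rfl⟩
    exact spinorPoint_mem_span y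
  · rintro _ ⟨_, ⟨t, ht, ht', rfl⟩, rfl⟩
    exact ⟨_, (hasMukaiSpinor_curvePoint ht ht').1,
      spinorPoint_mem_halfSpinors (gPolar_self_eq_zero (eval_curvePoint_f t))⟩

/-! ### The points of the curve -/

/-- If y_0, …, y_3 agree with the tangent vector with s = u = 1, then f_9, f_8, f_7 determine y_4,
y_5, y_6 in turn, and f_3 becomes the hyperplane condition v t^6 = 1. -/
theorem eq_of_forall_eval_f_eq_zero {y : Fin 7 → ℂ} (hy : ∀ j, MvPolynomial.eval y (f j) = 0)
    {t v : ℂ} (h0 : y 0 = 7) (h1 : y 1 = 6 * t + v) (h2 : y 2 = 5 * t ^ 2 + 2 * t * v)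
    (h3 : y 3 = 4 * t ^ 3 + 3 * t ^ 2 * v) :
    v * t ^ 6 = 1 ∧ y = v • fun i => (curvePoly i).eval t := by
  have hf (j : Fin 10) := (congrFun (aeval_f y) j).symm.trans (hy j)
  have e3 := hf 3
  have e7 := hf 7
  have e8 := hf 8
  have e9 := hf 9
  simp only [Matrix.cons_val, h0, h1, h2, h3] at e3 e7 e8 e9
  have h4 : y 4 = 3 * t ^ 4 + 4 * t ^ 3 * v := by linear_combination e9 / 7
  rw [h4] at e8
  have h5 : y 5 = 2 * t ^ 5 + 5 * t ^ 4 * v := by linear_combination e8 / 7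
  rw [h5] at e7 e3
  have h6 : y 6 = t ^ 6 + 6 * t ^ 5 * v := by linear_combination e7 / 28
  rw [h6] at e3
  have hv : v * t ^ 6 = 1 := by linear_combination -e3 / 98
  refine ⟨hv, ?_⟩
  funext i
  fin_cases i <;>
    simp only [Pi.smul_apply, smul_eq_mul, curvePoly, Fin.zero_eta, Fin.mk_one, Fin.reduceFinMk,
      Matrix.cons_val, Polynomial.eval_add, Polynomial.eval_mul, Polynomial.eval_pow,
      Polynomial.eval_X, Polynomial.eval_one, Polynomial.eval_ofNat, h0, h1, h2, h3, h4, h5, h6]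
  · linear_combination -7 * hv
  · linear_combination -6 * t * hv
  · linear_combination -5 * t ^ 2 * hv
  · linear_combination -4 * t ^ 3 * hv
  · linear_combination -3 * t ^ 4 * hv
  · linear_combination -2 * t ^ 5 * hv
  · linear_combination -t ^ 6 * hv

theorem exists_eq_smul_of_apply_zero_eq {y : Fin 7 → ℂ}
    (hy : ∀ j, MvPolynomial.eval y (f j) = 0) (h0 : y 0 = 7) :
    ∃ v t : ℂ, v ≠ 0 ∧ y = v • fun i => (curvePoly i).eval t := by
  -- Eliminating v from y_1 = 6t + v and y_2 = 5t² + 2tv gives 7t² - 2 y_1 t + y_2 = 0, hence the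
  -- candidates t = (y_1 ± s)/7.
  obtain ⟨s, hs⟩ := IsAlgClosed.exists_pow_nat_eq (y 1 ^ 2 - 7 * y 2) two_pos
  have hf (j : Fin 10) := (congrFun (aeval_f y) j).symm.trans (hy j)
  have e6 := hf 6
  have e7 := hf 7
  have e8 := hf 8
  have e9 := hf 9
  simp only [Matrix.cons_val, h0] at e6 e7 e8 e9
  have key (r : ℂ) (hr : r ^ 2 = y 1 ^ 2 - 7 * y 2)
      (h3 : y 3 = 3 * ((y 1 + r) / 7) ^ 2 * y 1 - 14 * ((y 1 + r) / 7) ^ 3) :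
      ∃ v t : ℂ, v ≠ 0 ∧ y = v • fun i => (curvePoly i).eval t := by
    obtain ⟨h, h'⟩ := eq_of_forall_eval_f_eq_zero hy (t := (y 1 + r) / 7)
      (v := y 1 - 6 * ((y 1 + r) / 7)) h0 (by ring) (by linear_combination hr / 7)
      (by linear_combination h3)
    exact ⟨_, _, left_ne_zero_of_mul_eq_one h, h'⟩
  -- The values of y_3 predicted by the two roots. The combination 4 f_6 - 3 f_7 is free of y_6 and
  -- factors into the two deviations, so one root is correct.
  have h : (y 3 - (3 * ((y 1 + s) / 7) ^ 2 * y 1 - 14 * ((y 1 + s) / 7) ^ 3)) *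
      (y 3 - (3 * ((y 1 - s) / 7) ^ 2 * y 1 - 14 * ((y 1 - s) / 7) ^ 3)) = 0 := by
    have h2 : y 2 = (y 1 ^ 2 - s ^ 2) / 7 := by linear_combination hs / 7
    have h4 : y 4 = (4 * y 1 * y 3 - 3 * y 2 ^ 2) / 7 := by linear_combination e9 / 7
    have h5 : y 5 = (3 * y 1 * y 4 - 2 * y 2 * y 3) / 7 := by linear_combination e8 / 7
    rw [h5, h4, h2] at e6 e7
    linear_combination (-1 / 15) * (4 * e6 - 3 * e7)
  rcases mul_eq_zero.mp h with h | h
  · exact key s hs (sub_eq_zero.mp h)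
  · exact key (-s) (by rw [neg_sq, hs]) (by rw [← sub_eq_add_neg]; exact sub_eq_zero.mp h)

theorem exists_eq_smul_of_forall_eval_f_eq_zero {y : Fin 7 → ℂ} (hy0 : y ≠ 0)
    (hy : ∀ j, MvPolynomial.eval y (f j) = 0) :
    ∃ c : ℂ, c ≠ 0 ∧ (y = c • Pi.single 6 1 ∨ ∃ t, y = c • fun i => (curvePoly i).eval t) := by
  have hf (j : Fin 10) := (congrFun (aeval_f y) j).symm.trans (hy j)
  by_cases h0 : y 0 = 0
  · have e0 := hf 0
    have e2 := hf 2
    have e4 := hf 4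
    have e5 := hf 5
    have e6 := hf 6
    have e7 := hf 7
    have e8 := hf 8
    have e9 := hf 9
    simp only [Matrix.cons_val, h0] at e0 e2 e4 e5 e6 e7 e8 e9
    -- If y_0 = 0 ≠ y_1, the quadrics f_9, f_8, f_6, f_5 give y_3, …, y_6 as monomials in y_2 / y_1,
    -- and f_4 becomes a nonzero multiple of y_2^6.
    have h2 : y 2 = 0 := by
      by_cases h1 : y 1 = 0
      · simpa [h1] using e9
      · have h3 : y 3 = 3 / 4 * y 2 ^ 2 / y 1 := by
          field_simp
          linear_combination -e9
        have h4 : y 4 = 1 / 2 * y 2 ^ 3 / y 1 ^ 2 := by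
          rw [h3] at e8
          field_simp at e8 ⊢
          linear_combination -e8 / 6
        have h5 : y 5 = 5 / 16 * y 2 ^ 4 / y 1 ^ 3 := by
          rw [h4] at e6
          field_simp at e6 ⊢
          linear_combination -e6
        have h6 : y 6 = 3 / 16 * y 2 ^ 5 / y 1 ^ 4 := by
          rw [h3, h4] at e5
          field_simp at e5 ⊢
          linear_combination -e5
        rw [h4, h6] at e4
        field_simp at e4
        norm_num at e4
        exact e4
    have h4 : y 4 = 0 := by simpa [h2] using e4
    have h5 : y 5 = 0 := by simpa [h4] using e0
    have h3 : y 3 = 0 := by simpa [h5] using e7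
    have h16 : y 1 = 0 ∨ y 6 = 0 := by simpa [h3] using e5
    rcases h16 with h1 | h6
    · refine ⟨y 6, fun h6 => hy0 ?_, .inl ?_⟩ <;> funext k <;> fin_cases k <;> simp [*]
    · refine ⟨y 1, fun h1 => hy0 ?_, .inr ⟨0, ?_⟩⟩ <;> funext k <;> fin_cases k <;>
        simp [*, curvePoly]
  · have h7 : 7 / y 0 ≠ 0 := div_ne_zero (by norm_num) h0
    have hsm (j) : MvPolynomial.eval ((7 / y 0) • y) (f j) = 0 := by
      have h1 := congrFun (aeval_f ((7 / y 0) • y)) j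
      have h2 := hf j
      refine Eq.trans h1 ?_
      refine Eq.trans ?_ (congrArg ((7 / y 0) ^ 2 * ·) h2 |>.trans (mul_zero _))
      fin_cases j <;> simp only [Pi.smul_apply, smul_eq_mul, Fin.zero_eta, Fin.mk_one,
        Fin.reduceFinMk, Matrix.cons_val] <;> ring
    obtain ⟨v, t, hv, h⟩ := exists_eq_smul_of_apply_zero_eq hsm
      (by rw [Pi.smul_apply, smul_eq_mul, div_mul_cancel₀ _ h0])
    refine ⟨(7 / y 0)⁻¹ * v, mul_ne_zero (inv_ne_zero h7) hv, .inr ⟨t, ?_⟩⟩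
    rw [mul_smul, ← h, inv_smul_smul₀ h7]

theorem eval_f_eq_zero_of_incl_eq {p : cuspCurve} {y : Fin 7 → ℂ} {hy : y ≠ 0}
    (hp : cuspCurve.incl p = point y hy) (j : Fin 10) : MvPolynomial.eval y (f j) = 0 := by
  rw [← mem_point_iff y hy (f_isHomogeneous j), ← hp]
  refine (forall_mem_incl_iff (f_isHomogeneous j)).mpr ?_ p
  rw [← aeval_curvePoly_eq_zero_iff]
  exact aeval_curvePoly_f j

theorem curvePoint_zero :
    (fun i => (curvePoly i).eval 0) = (Pi.single 1 1 : Fin 7 → ℂ) := by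
  funext k
  fin_cases k <;> simp [curvePoly]

/-- The homogeneous coordinates of a cusp. -/
def IsCusp (y : Fin 7 → ℂ) : Prop :=
  ∃ c t : ℂ, c ≠ 0 ∧ t ^ 7 = 1 ∧ y = c • fun i => (curvePoly i).eval t

theorem hasMukaiSpinor_of_incl_eq {p : cuspCurve} {y : Fin 7 → ℂ} {hy : y ≠ 0}
    (hp : cuspCurve.incl p = point y hy) (h : ¬IsCusp y) : HasMukaiSpinor y := by
  obtain ⟨c, hc, rfl | ⟨t, rfl⟩⟩ :=
    exists_eq_smul_of_forall_eval_f_eq_zero hy (eval_f_eq_zero_of_incl_eq hp)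
  · exact hasMukaiSpinor_single_six.smul hc
  · refine HasMukaiSpinor.smul ?_ hc
    by_cases ht : t = 0
    · rw [ht, curvePoint_zero]
      exact hasMukaiSpinor_single_one
    · exact hasMukaiSpinor_curvePoint ht fun ht' => h ⟨c, t, hc, ht', rfl⟩

/-! ### Points of the curve with values in an algebra -/

theorem dehomog_C {σ : Type} (i : σ) (c : ℂ) : dehomog i (MvPolynomial.C c) = chartConst i c :=
  MvPolynomial.eval₂Hom_C _ _ _

/-- Evaluation of the functions on a chart at a point `y` with values in `T` and `y_i = 1`. -/
def chartEval {σ T : Type} [CommRing T] [Algebra ℂ T] (i : σ) (y : σ → T) (hy : y i = 1) :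
    Γ(PSpace σ, (chart i).1) →+* T :=
  ((IsLocalization.Away.lift (S := Localization.Away (MvPolynomial.X i : MvPolynomial σ ℂ))
      (g := (MvPolynomial.aeval (R := ℂ) y).toRingHom) (MvPolynomial.X i)
      (by
        change IsUnit (MvPolynomial.aeval (R := ℂ) y (MvPolynomial.X i))
        rw [MvPolynomial.aeval_X, hy]
        exact isUnit_one)).comp
    (algebraMap (HomogeneousLocalization.Away (grading σ) (MvPolynomial.X i))
      (Localization.Away (MvPolynomial.X i : MvPolynomial σ ℂ)))).comp
    (RingEquiv.ofBijective _ (awayToChart_bijective i)).symm.toRingHom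

theorem chartEval_dehomog {σ T : Type} [CommRing T] [Algebra ℂ T] (i : σ) (y : σ → T)
    (hy : y i = 1) {n : ℕ} {F : MvPolynomial σ ℂ} (hF : F.IsHomogeneous n) :
    chartEval i y hy (dehomog i F) = MvPolynomial.aeval y F := by
  rw [dehomog_eq_frac i hF, chartEval, RingHom.comp_apply]
  have h1 : (RingEquiv.ofBijective _ (awayToChart_bijective i)).symm.toRingHom
      (frac i n F hF) = HomogeneousLocalization.Away.mk (grading σ) (X_mem_grading i) n F
      ((MvPolynomial.mem_homogeneousSubmodule _ F).mpr (by simpa using hF)) :=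
    (RingEquiv.ofBijective _ (awayToChart_bijective i)).symm_apply_apply _
  rw [h1, RingHom.comp_apply, HomogeneousLocalization.algebraMap_apply,
    HomogeneousLocalization.Away.val_mk, Localization.mk_eq_mk', IsLocalization.Away.lift,
    IsLocalization.lift_mk'_spec]
  change MvPolynomial.aeval (R := ℂ) y F =
    MvPolynomial.aeval (R := ℂ) y (MvPolynomial.X i ^ n) * MvPolynomial.aeval (R := ℂ) y F
  rw [map_pow, MvPolynomial.aeval_X, hy, one_pow, one_mul]

/-- A T-valued zero of the f_j is a T-point of the curve: if F / x_i^n is in the ideal, x_i F lies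
in (f), and y_i = 1. -/
theorem chartEval_eq_zero {T : Type} [CommRing T] [Algebra ℂ T] {i : Fin 7} {y : Fin 7 → T}
    (hy : y i = 1) (hf : ∀ j, MvPolynomial.aeval y (f j) = 0)
    {z : Γ(PSpace (Fin 7), (chart i).1)} (hz : z ∈ cuspIdeal.ideal (chart i)) :
    chartEval i y hy z = 0 := by
  obtain ⟨n, F, hF, rfl⟩ := exists_eq_dehomog i z
  rw [cuspIdeal_eq, dehomog_mem_reducedIdealSheaf _ _ hF] at hz
  have h1 : MvPolynomial.X i * F ∈ Ideal.span (Set.range f) :=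
    (forall_curvePoints_iff hF (MvPolynomial.isHomogeneous_X ℂ i)).mp (by simpa using hz)
  have h2 : Ideal.span (Set.range f) ≤ RingHom.ker (MvPolynomial.aeval (R := ℂ) y) := by
    rw [Ideal.span_le]
    rintro _ ⟨j, rfl⟩
    exact hf j
  have h3 : MvPolynomial.aeval y (MvPolynomial.X i * F) = 0 := h2 h1
  rwa [map_mul, MvPolynomial.aeval_X, hy, one_mul, ← chartEval_dehomog i y hy hF] at h3

theorem dehomog_f_mem (i : Fin 7) (j : Fin 10) : dehomog i (f j) ∈ cuspIdeal.ideal (chart i) := by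
  rw [cuspIdeal_eq, dehomog_mem_reducedIdealSheaf _ _ (f_isHomogeneous j)]
  rintro _ ⟨t, -, -, rfl⟩ -
  exact eval_curvePoint_f t j

/-- The structure morphism of a chart, on functions. -/
def chartStructure {σ : Type} (i : σ) :
    CommRingCat.of ℂ ⟶ Γ(PSpace σ, Proj.basicOpen (grading σ) (MvPolynomial.X i)) :=
  CommRingCat.ofHom (algebraMap ℂ (grading σ 0)) ≫
    CommRingCat.ofHom (HomogeneousLocalization.fromZeroRingHom (grading σ) _) ≫
    Proj.awayToSection (grading σ) (MvPolynomial.X i)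

theorem isAffineOpen_chart {σ : Type} (i : σ) :
    IsAffineOpen (Proj.basicOpen (grading σ) (MvPolynomial.X i)) := (chart i).2

theorem fromSpec_chart_toSpecC {σ : Type} (i : σ) :
    (isAffineOpen_chart i).fromSpec ≫ PSpace.toSpecC σ = Spec.map (chartStructure i) := by
  have h1 : (Proj.basicOpen (grading σ) (MvPolynomial.X i)).ι =
      (Proj.basicOpenIsoSpec (grading σ) _ (X_mem_grading i) one_pos).hom ≫
        Proj.awayι (grading σ) _ (X_mem_grading i) one_pos := by
    rw [Proj.awayι, Iso.hom_inv_id_assoc]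
  have h : (Proj.basicOpen (grading σ) (MvPolynomial.X i)).ι ≫ PSpace.toSpecC σ =
      (Proj.basicOpen (grading σ) (MvPolynomial.X i)).toSpecΓ ≫ Spec.map (chartStructure i) := by
    rw [h1, Category.assoc, PSpace.toSpecC, Proj.awayι_toSpecZero_assoc,
      Proj.basicOpenIsoSpec_hom, Proj.basicOpenToSpec, Category.assoc, ← Spec.map_comp,
      ← Spec.map_comp, chartStructure, Category.assoc]
  rw [← IsAffineOpen.isoSpec_inv_ι, Category.assoc, h, IsAffineOpen.isoSpec_inv_toSpecΓ_assoc]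

/-- A smooth point has a basic affine neighbourhood in a given chart whose ring of functions is
formally smooth. -/
theorem exists_formallySmooth {p : cuspCurve} (hp : IsSmoothPoint p) {i : Fin 7}
    (hi : cuspCurve.incl p ∈ (chart i).1) :
    ∃ (h : Γ(cuspCurve, cuspCurve.incl ⁻¹ᵁ (chart i).1)), p ∈ cuspCurve.basicOpen h ∧
      ((cuspCurve.presheaf.map (homOfLE (cuspCurve.basicOpen_le h)).op).hom.comp
        ((cuspCurve.incl.app (chart i).1).hom.comp (chartConst i))).FormallySmooth := by
  obtain ⟨U, hpU, hU⟩ := hp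
  have hV : IsAffineOpen (cuspCurve.incl ⁻¹ᵁ (chart i).1) := by
    have : IsAffineHom cuspCurve.incl := (inferInstance : IsAffineHom cuspIdeal.subschemeι)
    exact (chart i).2.preimage _
  obtain ⟨h, hle, hph⟩ := hV.exists_basicOpen_le (V := U) ⟨p, hpU⟩ hi
  refine ⟨h, hph, ?_⟩
  have hD := hV.basicOpen h
  have e : cuspCurve.basicOpen h ≤ cuspCurve.incl ⁻¹ᵁ (chart i).1 := cuspCurve.basicOpen_le h
  have h1 : hD.fromSpec ≫ cuspCurve.toSpecC =
      Spec.map (chartStructure i ≫ cuspCurve.incl.appLE _ _ e) := by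
    rw [cuspCurve.toSpecC, ← Category.assoc,
      ← IsAffineOpen.SpecMap_appLE_fromSpec cuspCurve.incl (isAffineOpen_chart i) hD e,
        Category.assoc,
      fromSpec_chart_toSpecC, Spec.map_comp]
  have h2 : hD.fromSpec ≫ cuspCurve.toSpecC =
      (hD.isoSpec.inv ≫ cuspCurve.homOfLE hle) ≫ U.ι ≫ cuspCurve.toSpecC := by
    rw [← IsAffineOpen.isoSpec_inv_ι, Category.assoc, Category.assoc, Scheme.homOfLE_ι_assoc]
  -- The basic open set lies inside the given smooth neighbourhood, and an open immersion preserves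
  -- smoothness.
  have h3 : Smooth (hD.fromSpec ≫ cuspCurve.toSpecC) := by
    rw [h2]
    infer_instance
  rw [h1, HasRingHomProperty.Spec_iff (P := @Smooth)] at h3
  exact h3.formallySmooth

/-- Γ → B → A models the functions on a chart of ℙ⁶, on the curve in it, and on a smooth basic open
subset. The T/I-point extends to A as h is invertible there, formal smoothness lifts it to T, and
composition pulls the lift back to Γ. -/
theorem exists_lift_of_formallySmooth {Γ B A T : Type} [CommRing Γ] [CommRing B] [CommRing A]
    [CommRing T] [Algebra ℂ T] [Algebra B A] {h : B} [IsLocalization.Away h A] {κ : ℂ →+* Γ}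
    {π : Γ →+* B} (hπ : Function.Surjective π)
    (hsm : ((algebraMap B A).comp (π.comp κ)).FormallySmooth) {I : Ideal T} (hI : IsNilpotent I)
    {τ : Γ →+* T ⧸ I} (hκ : ∀ c, τ (κ c) = algebraMap ℂ (T ⧸ I) c)
    (hτ : RingHom.ker π ≤ RingHom.ker τ) {z : Γ} (hz : π z = h) (hu : IsUnit (τ z)) :
    ∃ ψ : Γ →+* T, (∀ c, ψ (κ c) = algebraMap ℂ T c) ∧
      (∀ a, Ideal.Quotient.mk I (ψ a) = τ a) ∧ RingHom.ker π ≤ RingHom.ker ψ := by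
  let τ' : B →+* T ⧸ I := π.liftOfSurjective hπ ⟨τ, hτ⟩
  have hτ' (a) : τ' (π a) = τ a := RingHom.liftOfRightInverse_comp_apply _ _ _ ⟨τ, hτ⟩ a
  have hu' : IsUnit (τ' h) := by rw [← hz, hτ']; exact hu
  let τ'' : A →+* T ⧸ I := IsLocalization.Away.lift h hu'
  have hτ'' (b) : τ'' (algebraMap B A b) = τ' b := IsLocalization.Away.lift_eq h hu' b
  let _ : Algebra ℂ A := ((algebraMap B A).comp (π.comp κ)).toAlgebra
  have : Algebra.FormallySmooth ℂ A := hsm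
  let g : A →ₐ[ℂ] T ⧸ I :=
    { τ'' with
      commutes' := fun c => (hτ'' _).trans ((hτ' _).trans (hκ c)) }
  obtain ⟨ψ, hψ⟩ := Algebra.FormallySmooth.exists_lift I hI g
  refine ⟨(ψ : A →+* T).comp ((algebraMap B A).comp π), fun c => ψ.commutes c, fun a => ?_,
    fun a ha => ?_⟩
  · exact (DFunLike.congr_fun hψ _).trans ((hτ'' _).trans (hτ' _))
  · rw [RingHom.mem_ker] at ha ⊢
    rw [RingHom.comp_apply, RingHom.comp_apply, ha, map_zero, map_zero]

theorem eval_smul_of_isHomogeneous {σ : Type} {n : ℕ} {F : MvPolynomial σ ℂ}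
    (hF : F.IsHomogeneous n) (c : ℂ) (y : σ → ℂ) :
    MvPolynomial.eval (c • y) F = c ^ n * MvPolynomial.eval y F := by
  rw [MvPolynomial.eval_eq, MvPolynomial.eval_eq, Finset.mul_sum]
  refine Finset.sum_congr rfl fun m hm => ?_
  have h : ∑ i ∈ m.support, m i = n := by
    rw [← hF (MvPolynomial.mem_support_iff.mp hm)]
    exact DFunLike.congr_fun Finsupp.degree_eq_weight_one m
  simp only [Pi.smul_apply, smul_eq_mul, mul_pow, Finset.prod_mul_distrib,
    Finset.prod_pow_eq_pow_sum, h]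
  ring

/-- The value of a polynomial at an infinitesimal thickening of `y` is a unit if it does not vanish
at `y`. -/
theorem isUnit_aeval {σ T : Type} [CommRing T] [Algebra ℂ T] {J : Ideal T} (hJ : IsNilpotent J)
    {Y : σ → T} {y : σ → ℂ} (hY : ∀ k, Y k - algebraMap ℂ T (y k) ∈ J) {F : MvPolynomial σ ℂ}
    (hF : MvPolynomial.eval y F ≠ 0) : IsUnit (MvPolynomial.aeval Y F) := by
  have h : MvPolynomial.aeval Y F - algebraMap ℂ T (MvPolynomial.eval y F) ∈ J := by
    rw [← Ideal.Quotient.eq_zero_iff_mem, map_sub, sub_eq_zero]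
    have h1 : (Ideal.Quotient.mkₐ ℂ J) (MvPolynomial.aeval Y F) =
        MvPolynomial.aeval (fun k => algebraMap ℂ (T ⧸ J) (y k)) F := by
      rw [← AlgHom.comp_apply, MvPolynomial.comp_aeval]
      congr 2
      funext k
      have := hY k
      rw [← Ideal.Quotient.eq_zero_iff_mem, map_sub, sub_eq_zero] at this
      exact this
    refine h1.trans ?_
    exact MvPolynomial.aeval_algebraMap_apply _ _ _
  obtain ⟨n, hn⟩ := hJ
  -- A nonzero constant plus a nilpotent element is a unit.
  have hnil : IsNilpotent (MvPolynomial.aeval Y F - algebraMap ℂ T (MvPolynomial.eval y F)) :=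
    ⟨n, by simpa [hn] using Ideal.pow_mem_pow h n⟩
  have := hnil.isUnit_add_right_of_commute (hF.isUnit.map (algebraMap ℂ T)) (Commute.all _ _)
  rwa [sub_add_cancel] at this

/-- Infinitesimal lifting at a smooth point of the curve. -/
theorem exists_lift_of_isSmoothPoint {p : cuspCurve} {y : Fin 7 → ℂ} {hy : y ≠ 0}
    (hp : cuspCurve.incl p = point y hy) (hs : IsSmoothPoint p) {i : Fin 7} (hyi : y i ≠ 0)
    {T : Type} [CommRing T] [Algebra ℂ T] {I J : Ideal T} (hI : IsNilpotent I)
    (hJ : IsNilpotent J) {Y : Fin 7 → T} (hYi : Y i = 1)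
    (hYf : ∀ j, MvPolynomial.aeval Y (f j) ∈ I)
    (hYy : ∀ k, Y k - algebraMap ℂ T ((y i)⁻¹ * y k) ∈ J) :
    ∃ Z : Fin 7 → T, Z i = 1 ∧ (∀ j, MvPolynomial.aeval Z (f j) = 0) ∧ ∀ k, Z k - Y k ∈ I := by
  have hi : cuspCurve.incl p ∈ (chart i).1 := by
    rw [hp]
    change MvPolynomial.X i ∉ (point y hy).asHomogeneousIdeal
    rw [mem_point_iff y hy (MvPolynomial.isHomogeneous_X ℂ i), MvPolynomial.eval_X]
    exact hyi
  obtain ⟨h, hph, hsm⟩ := exists_formallySmooth hs hi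
  have hV : IsAffineOpen (cuspCurve.incl ⁻¹ᵁ (chart i).1) := by
    have : IsAffineHom cuspCurve.incl := (inferInstance : IsAffineHom cuspIdeal.subschemeι)
    exact (chart i).2.preimage _
  have hloc := hV.isLocalization_basicOpen h
  have hsurj : Function.Surjective (cuspCurve.incl.app (chart i).1) :=
    cuspIdeal.subschemeι_app_surjective (chart i)
  have hker : RingHom.ker (cuspCurve.incl.app (chart i).1).hom = cuspIdeal.ideal (chart i) :=
    cuspIdeal.ker_subschemeι_app (chart i)
  obtain ⟨z, hz⟩ := hsurj h
  have hYi' : Ideal.Quotient.mk I (Y i) = 1 := by rw [hYi, map_one]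
  have hmk (F : MvPolynomial (Fin 7) ℂ) :
      MvPolynomial.aeval (fun k => Ideal.Quotient.mk I (Y k)) F =
        Ideal.Quotient.mk I (MvPolynomial.aeval Y F) :=
    (DFunLike.congr_fun (MvPolynomial.comp_aeval Y (Ideal.Quotient.mkₐ ℂ I)) F).symm
  have hκ (c : ℂ) : chartEval i (fun k => Ideal.Quotient.mk I (Y k)) hYi' (chartConst i c) =
      algebraMap ℂ (T ⧸ I) c := by
    rw [← dehomog_C, chartEval_dehomog i _ _ (MvPolynomial.isHomogeneous_C _ c),
      MvPolynomial.aeval_C]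
  have hτ : RingHom.ker (cuspCurve.incl.app (chart i).1).hom ≤
      RingHom.ker (chartEval i (fun k => Ideal.Quotient.mk I (Y k)) hYi') := by
    intro a ha
    rw [hker] at ha
    refine chartEval_eq_zero hYi' (fun j => ?_) ha
    rw [hmk, Ideal.Quotient.eq_zero_iff_mem]
    exact hYf j
  -- The thickened point stays inside the smooth basic open set: h does not vanish at p, and Y
  -- differs from the point by the nilpotent ideal J.
  have hu : IsUnit (chartEval i (fun k => Ideal.Quotient.mk I (Y k)) hYi' z) := by
    obtain ⟨n, F, hF, rfl⟩ := exists_eq_dehomog i z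
    rw [chartEval_dehomog i _ _ hF, hmk]
    refine (isUnit_aeval hJ hYy ?_).map (Ideal.Quotient.mk I)
    have h1 : cuspCurve.incl p ∈ (PSpace (Fin 7)).basicOpen (dehomog i F) := by
      rw [← hz] at hph
      have := Scheme.preimage_basicOpen cuspCurve.incl (dehomog i F)
      rw [← this] at hph
      exact hph
    rw [dehomog_eq_frac i hF, mem_basicOpen_frac i hF hi, hp, mem_point_iff y hy hF] at h1
    have h2 := eval_smul_of_isHomogeneous hF (y i)⁻¹ y
    exact h2.trans_ne (mul_ne_zero (pow_ne_zero _ (inv_ne_zero hyi)) h1)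
  obtain ⟨ψ, hψc, hψ, hψk⟩ := exists_lift_of_formallySmooth hsurj hsm hI hκ hτ hz hu
  have hψF (F : MvPolynomial (Fin 7) ℂ) : ψ (dehomog i F) =
      MvPolynomial.aeval (fun k => ψ (dehomog i (MvPolynomial.X k))) F := by
    induction F using MvPolynomial.induction_on with
    | C a => rw [dehomog_C, hψc, MvPolynomial.aeval_C]
    | add p q hp hq => rw [map_add, map_add, map_add, hp, hq]
    | mul_X p k hp => rw [map_mul, map_mul, map_mul, hp, MvPolynomial.aeval_X]
  refine ⟨fun k => ψ (dehomog i (MvPolynomial.X k)), ?_, fun j => ?_, fun k => ?_⟩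
  · exact (congrArg ψ (dehomog_X_self i)).trans (map_one ψ)
  · rw [← hψF]
    exact hψk (hker ▸ dehomog_f_mem i j)
  · rw [← Ideal.Quotient.eq_zero_iff_mem, map_sub, sub_eq_zero, hψ,
      chartEval_dehomog i _ _ (MvPolynomial.isHomogeneous_X ℂ k), MvPolynomial.aeval_X]

/-! ### The cusps -/

/-- The heptagonal symmetry y_k ↦ τ^k y_k. Each f_j is isobaric modulo 7; τ^7 = 1 matters where y_0
stands for y_7. It moves any cusp to [1 : ⋯ : 1]. -/
theorem aeval_f_twist {R : Type} [CommRing R] [Algebra ℂ R] {τ : R} (hτ : τ ^ 7 = 1)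
    (x : Fin 7 → R) (j : Fin 10) :
    MvPolynomial.aeval (fun k : Fin 7 => τ ^ (k : ℕ) * x k) (f j) =
      τ ^ (![3, 2, 1, 0, 1, 0, 6, 6, 5, 4] : Fin 10 → ℕ) j * MvPolynomial.aeval x (f j) := by
  rw [show MvPolynomial.aeval (fun k : Fin 7 => τ ^ (k : ℕ) * x k) (f j) = _ from
    congrFun (aeval_f _) j, show MvPolynomial.aeval x (f j) = _ from congrFun (aeval_f _) j]
  fin_cases j <;> simp only [Fin.zero_eta, Fin.mk_one, Fin.reduceFinMk, Matrix.cons_val,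
    Fin.coe_ofNat_eq_mod, Nat.reduceMod]
  · linear_combination (3 * x 5 ^ 2 - 4 * x 4 * x 6) * τ ^ 3 * hτ
  · linear_combination (2 * x 4 * x 5 - 3 * x 3 * x 6) * τ ^ 2 * hτ
  · linear_combination (5 * x 3 * x 5 - 8 * x 2 * x 6) * τ * hτ
  · linear_combination (3 * x 2 * x 5 - 5 * x 1 * x 6) * hτ
  · linear_combination (5 * x 4 ^ 2 - 9 * x 2 * x 6) * τ * hτ
  · linear_combination (x 3 * x 4 - 2 * x 1 * x 6) * hτ
  all_goals ring

/-- The cuspidal tangent direction. -/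
def cuspTangent {R : Type} [CommRing R] (ε : R) : Fin 7 → R :=
  -- Expanding y_k / y_0 at t = exp(s) gives no linear term, k(7-k)/2 at s², and k(7-k)(2k-7)/6 at
  -- s³. The last are the coefficients used: the direction of the local coordinate s³ on the cusp,
  -- outside the tangent cone.
  ![1, 1 - 5 * ε, 1 - 5 * ε, 1 - 2 * ε, 1 + 2 * ε, 1 + 5 * ε, 1 + 5 * ε]

theorem aeval_f_cuspTangent {R : Type} [CommRing R] [Algebra ℂ R] (ε : R) (j : Fin 10) :
    MvPolynomial.aeval (cuspTangent ε) (f j) =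
      ε ^ 2 * (![35, 50, 150, 50, 245, 46, 150, 245, 50, 35] : Fin 10 → R) j := by
  rw [show MvPolynomial.aeval (cuspTangent ε) (f j) = _ from congrFun (aeval_f _) j]
  fin_cases j <;> simp only [cuspTangent, Fin.zero_eta, Fin.mk_one, Fin.reduceFinMk,
    Matrix.cons_val] <;> ring

theorem dvd_cuspTangent_sub_one {R : Type} [CommRing R] (ε : R) (k : Fin 7) :
    ε ∣ cuspTangent ε k - 1 := by
  refine ⟨(![0, -5, -5, -2, 2, 5, 5] : Fin 7 → R) k, ?_⟩
  fin_cases k <;> simp only [cuspTangent, Fin.zero_eta, Fin.mk_one, Fin.reduceFinMk,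
    Matrix.cons_val] <;> ring

/-- The cuspidal tangent vector does not lift to second order. -/
theorem sq_eq_zero_of_aeval_f_eq_zero {R : Type} [CommRing R] [Algebra ℂ R] {ε : R}
    (hε : ε ^ 3 = 0) {x : Fin 7 → R} (hx : ∀ j, MvPolynomial.aeval x (f j) = 0) (h0 : x 0 = 1)
    (h : ∀ k, x k - cuspTangent ε k ∈ Ideal.span {ε ^ 2}) : 96 * ε ^ 2 = 0 := by
  have hz (k) : ∃ z, x k = cuspTangent ε k + ε ^ 2 * z := by
    obtain ⟨z, hz⟩ := Ideal.mem_span_singleton.mp (h k)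
    exact ⟨z, by rw [← hz, add_sub_cancel]⟩
  choose z hz using hz
  have hf (j : Fin 10) := (congrFun (aeval_f x) j).symm.trans (hx j)
  have e1 := hf 1
  have e3 := hf 3
  have e5 := hf 5
  have e8 := hf 8
  simp only [Matrix.cons_val, h0, hz 1, hz 2, hz 3, hz 4, hz 5, hz 6, cuspTangent]
    at e1 e3 e5 e8
  have h4 : ε ^ 4 = 0 := by rw [pow_succ, hε, zero_mul]
  ring_nf at e1 e3 e5 e8 ⊢
  simp only [hε, h4, zero_mul, add_zero, sub_zero] at e1 e3 e5 e8
  -- The differential of f_1 - f_3 + f_5 + f_8 vanishes at (1, …, 1), so the correction z drops out,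
  -- leaving 50 - 50 + 46 + 50 = 96 times ε².
  linear_combination e1 - e3 + e5 + e8

/-- At a smooth point, the point over ℂ[ε]/ε² given by the cuspidal direction would lift to ℂ[ε]/ε³;
after undoing the rotation this forces 96 ε² = 0. -/
theorem not_isSmoothPoint_of_isCusp {p : cuspCurve} {y : Fin 7 → ℂ} {hy : y ≠ 0}
    (hp : cuspCurve.incl p = point y hy) (h : IsCusp y) : ¬IsSmoothPoint p := by
  intro hs
  obtain ⟨c, t, hc, ht, hyt⟩ := h
  have ht0 : t ≠ 0 := by
    rintro rfl
    norm_num at ht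
  -- For t^7 = 1 both summands k t^(k-1) and (7-k) t^(k+6) are multiples of t^(k+6), with
  -- coefficients adding up to 7.
  have hyk (k : Fin 7) : y k = 7 * c * t ^ 6 * t ^ (k : ℕ) := by
    rw [hyt]
    fin_cases k <;> simp only [Pi.smul_apply, smul_eq_mul, curvePoly, Fin.zero_eta, Fin.mk_one,
      Fin.reduceFinMk, Matrix.cons_val, Polynomial.eval_add, Polynomial.eval_mul,
      Polynomial.eval_pow, Polynomial.eval_X, Polynomial.eval_one, Polynomial.eval_ofNat]
    · ring
    · linear_combination -c * ht
    · linear_combination -2 * c * t * ht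
    · linear_combination -3 * c * t ^ 2 * ht
    · linear_combination -4 * c * t ^ 3 * ht
    · linear_combination -5 * c * t ^ 4 * ht
    · linear_combination -6 * c * t ^ 5 * ht
  have hy0 : y 0 ≠ 0 := by
    rw [hyk]
    simp [hc, ht0]
  let T := Polynomial ℂ ⧸ Ideal.span {(Polynomial.X : Polynomial ℂ) ^ 3}
  let ε : T := Ideal.Quotient.mk _ Polynomial.X
  have hε : ε ^ 3 = 0 := by
    rw [← map_pow, Ideal.Quotient.eq_zero_iff_mem]
    exact Ideal.mem_span_singleton_self _
  have hε2 : 96 * ε ^ 2 ≠ 0 := by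
    intro h
    have h1 : Ideal.Quotient.mk (Ideal.span {(Polynomial.X : Polynomial ℂ) ^ 3})
        (96 * Polynomial.X ^ 2) = 0 := by
      rw [map_mul, map_ofNat, map_pow]
      exact h
    rw [Ideal.Quotient.eq_zero_iff_mem, Ideal.mem_span_singleton, Polynomial.X_pow_dvd_iff] at h1
    have h2 := h1 2 (by norm_num)
    rw [show (96 : Polynomial ℂ) = Polynomial.C 96 from (map_ofNat _ _).symm,
      Polynomial.coeff_C_mul_X_pow] at h2
    norm_num at h2
  let τ : T := algebraMap ℂ T t
  let τ' : T := algebraMap ℂ T t⁻¹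
  have hτ : τ ^ 7 = 1 := by rw [← map_pow, ht, map_one]
  have hτ' : τ' ^ 7 = 1 := by rw [← map_pow, inv_pow, ht, inv_one, map_one]
  have hττ' : τ' * τ = 1 := by rw [← map_mul, inv_mul_cancel₀ ht0, map_one]
  -- I = (ε²) is the obstruction ideal to be lifted over; J = (ε) measures the distance to the
  -- closed point.
  obtain ⟨Z, hZ0, hZf, hZ⟩ := exists_lift_of_isSmoothPoint hp hs hy0 (T := T)
    (I := Ideal.span {ε ^ 2}) (J := Ideal.span {ε}) (Y := fun k => τ ^ (k : ℕ) * cuspTangent ε k)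
    ⟨2, by
      rw [Ideal.span_singleton_pow, ← pow_mul, show ε ^ (2 * 2) = ε ^ 3 * ε by ring, hε, zero_mul]
      exact Ideal.span_singleton_eq_bot.mpr rfl⟩
    ⟨3, by
      rw [Ideal.span_singleton_pow, hε]
      exact Ideal.span_singleton_eq_bot.mpr rfl⟩
    (by simp [cuspTangent])
    (fun j => by
      rw [aeval_f_twist hτ, aeval_f_cuspTangent]
      exact Ideal.mul_mem_left _ _ (Ideal.mul_mem_right _ _ (Ideal.mem_span_singleton_self _)))
    (fun k => by
      have h1 : (y 0)⁻¹ * y k = t ^ (k : ℕ) := by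
        rw [hyk k, hyk 0]
        simp only [Fin.coe_ofNat_eq_mod, Nat.zero_mod, pow_zero]
        field_simp
      rw [h1, map_pow, ← mul_sub_one]
      exact Ideal.mul_mem_left _ _ (Ideal.mem_span_singleton.mpr (dvd_cuspTangent_sub_one ε k)))
  -- The inverse rotation τ' brings the lift back to the cusp [1 : ⋯ : 1].
  refine hε2 (sq_eq_zero_of_aeval_f_eq_zero hε (x := fun k => τ' ^ (k : ℕ) * Z k) (fun j => ?_) ?_
    fun k => ?_)
  · rw [aeval_f_twist hτ', hZf, mul_zero]
  · simp [hZ0]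
  · have h1 := Ideal.mul_mem_left _ (τ' ^ (k : ℕ)) (hZ k)
    rwa [mul_sub, ← mul_assoc, ← mul_pow, hττ', one_pow, one_mul] at h1

end

end MukaiCusp

/-! ### The proposition -/

theorem mainTheorem4 :
    -- the curve is reduced, the `g_j` form a basis of the space `I₂` of quadrics through it, and
    -- the kernel of `Sym² I₂ → I₄` is spanned by `Q`
    (IsReduced MukaiCusp.cuspCurve ∧
      LinearIndependent ℂ MukaiCusp.g ∧
      Submodule.span ℂ (Set.range MukaiCusp.g) = MukaiCusp.quadricsThroughCurve ∧
      ∀ q : MvPolynomial (Fin 5 ⊕ Fin 5) ℂ, q.IsHomogeneous 2 →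
        (MvPolynomial.aeval MukaiCusp.g q = 0 ↔ q ∈ Submodule.span ℂ {MukaiCusp.Q})) ∧
    -- Mukai's map is defined on the smooth locus, and extends to an embedding `φ` over `ℂ`
    ∃ φ : MukaiCusp.cuspCurve ⟶ MukaiCusp.PSpace (Fin 16),
      φ ≫ MukaiCusp.PSpace.toSpecC (Fin 16) = MukaiCusp.cuspCurve.toSpecC ∧
      IsClosedImmersion φ ∧
      (∀ (p : MukaiCusp.cuspCurve) (y : Fin 7 → ℂ) (hy : y ≠ 0),
        MukaiCusp.cuspCurve.incl p = MukaiCusp.point y hy → MukaiCusp.IsSmoothPoint p →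
          MukaiCusp.IsLagrangian (MukaiCusp.mukaiSpace y) ∧
          ∃ (s : Fin 16 → ℂ) (hs : s ≠ 0),
            MukaiCusp.halfSpinors (MukaiCusp.mukaiSpace y) = Submodule.span ℂ {s} ∧ φ p = MukaiCusp.point s hs) ∧
      -- the image of `φ` is the scheme-theoretic intersection of `P_cusp` and `OG(5,10)`
      φ.ker = MukaiCusp.cuspLinearSpace ⊔ MukaiCusp.orthogonalGrassmannian := by
  refine ⟨⟨MukaiCusp.isReduced_cuspCurve, MukaiCusp.linearIndependent_g, MukaiCusp.span_g_eq,
    fun q hq => MukaiCusp.aeval_g_eq_zero_iff hq⟩, MukaiCusp.mukaiMap, MukaiCusp.mukaiMap_toSpecC,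
    MukaiCusp.isClosedImmersion_mukaiMap, fun p y hy hp hs => ?_, MukaiCusp.ker_mukaiMap_eq⟩
  obtain ⟨h1, h2⟩ := MukaiCusp.hasMukaiSpinor_of_incl_eq hp fun h =>
    MukaiCusp.not_isSmoothPoint_of_isCusp hp h hs
  refine ⟨h1, MukaiCusp.spinorPoint y, MukaiCusp.spinorPoint_ne_zero hy, h2, ?_⟩
  rw [← MukaiCusp.spinorEmbedding_point y hy, ← hp]
  rfl
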